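/- Let $(E,d)$ be a Polish metric space with its Borel $\sigma$-algebra, $\mu$ a Borel probability measure on $E$, and $X_1,X_2,\dots$ i.i.d. random variables with law $\mu$ on a probability space $(\Omega,\mathcal A,\mathbb P)$. Let $L_n=\frac1n\sum_{i=1}^n\delta_{X_i}$, and let $W_p^p(\mu,\nu)=\inf_\pi\int d(x,y)^p\,\pi(dx,dy)$, the infimum being over all couplings $\pi$ of $\mu$ and $\nu$. Fix $x_0\in E$, write $B(x_0,t)$ for the closed ball, $H(t)=\mu(B(x_0,t)^c)$, and $$\|X\|_{q,w}^q=\sup_{t\ge 0}t^qH(t),\qquad I_{\alpha,p}=\int_0^\infty H(t)^{\frac{\alpha-p}{\alpha}}t^{p-1}\,dt,\qquad I_{2p,p}=\int_0^\infty\sqrt{H(t)}\,t^{p-1}\,dt .$$ We say that $\mu$ has a weak moment of order $q$ if $\|X\|_{q,w}^q<\infty$. For bounded $A\subset E$ let $N(A,\delta)$ be the smallest number of closed balls of radius $\delta$ with centres in $A$ that cover $A$. Let $p\ge 1$, $\alpha>2p$, $\beta>0$, and let $S\subset E$ be a set with $\mu(S)=1$ such that $$N(S\cap B(x_0,R),\delta)\le\beta\left(\frac{2R}{\delta}\right)^\alpha\qquad\text{for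 all }R>0\text{ and all }\delta\in(0,2R].$$ Below, $C_{a_1,\dots,a_k}$ denotes a positive constant that depends only on $a_1,\dots,a_k$ (and may differ from line to line). 1. If $\mu$ has a weak moment of order $rp$ with $r>2$, then for all $\rho\in(\frac{\alpha-p}{\alpha},1]$ and $x>0$, $$\limsup_{n\to\infty}n^{r\rho-1}\,\mathbb P\Big(W_p^p(\mu,L_n)>\frac{x}{n^{1-\rho}}\Big)\le C_{p,r}\frac{\|X\|_{rp,w}^{rp}}{x^r}.$$ 2. If $I_{2p,p}<\infty$, then for all $\rho\in(\frac{\alpha-p}{\alpha},1]$ and $x>0$, $$\limsup_{n\to\infty}n^{2\rho-1}\,\mathbb P\Big(W_p^p(\mu,L_n)>\frac{x}{n^{1-\rho}}\Big)\le C_p\frac{I_{2p,p}^2}{x^2}.$$ 3. If $\mu$ has a weak moment of order $rp$ with $r\in(\frac{\alpha}{\alpha-p},2)$, then for all $\rho\in(\frac{\alpha-p}{\alpha},1]$ and $x>0$, $$\limsup_{n\to\infty}n^{r\rho-1}\,\mathbb P\Big(W_p^p(\mu,L_n)>\frac{x}{n^{1-\rho}}\Big)\le C_{p,r}\frac{\|X\|_{rp,w}^{rp}}{x^r}.$$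 4. If $I_{\alpha,p}<\infty$, then for all $\rho\in[\frac{\alpha-p}{\alpha},1]$, $x>0$ and $n\ge1$, $$n^{\frac{\alpha\rho}{\alpha-p}-1}\,\mathbb P\Big(W_p^p(\mu,L_n)>\frac{x}{n^{1-\rho}}\Big)\le C_{p,\alpha,\beta}\frac{I_{\alpha,p}^{\frac{\alpha}{\alpha-p}}}{x^{\frac{\alpha}{\alpha-p}}}.$$ 5. If $\mu$ has a weak moment of order $rp$ with $r\in(1,\frac{\alpha}{\alpha-p})$, then for all $\rho\in[\frac1r,1]$, $x>0$ and $n\ge1$, $$n^{r\rho-1}\,\mathbb P\Big(W_p^p(\mu,L_n)>\frac{x}{n^{1-\rho}}\Big)\le C_{p,\alpha,\beta,r}\frac{\|X\|_{rp,w}^{rp}}{x^r}.$$ In particular ($\rho=1$), if $\mu$ has a weak moment of order $rp$ with $r>1$, $r\ne2$, $r\neq\frac{\alpha}{\alpha-p}$, then for all $x>0$, $$\limsup_{n\to\infty}n^{r-1}\,\mathbb P\big(W_p^p(\mu,L_n)>x\big)\le C_{p,\alpha,\beta,r}\frac{\|X\|_{rp,w}^{rp}}{x^r}.$$ -/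

import Mathlib

open MeasureTheory ProbabilityTheory Filter Set
open scoped ENNReal NNReal Topology

universe u v

namespace WassersteinEmpirical

noncomputable section

/-- `W_p^p(μ, ν)`: the infimum of `∫ d(x, y) ^ p dπ(x, y)` over all couplings `π` of `μ` and `ν`.
(When `μ` and `ν` are probability measures, every such `π` is one too.) -/
def wassersteinPow {E : Type*} [MetricSpace E] [MeasurableSpace E] (p : ℝ)
    (μ ν : Measure E) : ℝ≥0∞ :=
  ⨅ (π : Measure (E × E)) (_ : π.fst = μ ∧ π.snd = ν), ∫⁻ z, edist z.1 z.2 ^ p ∂π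

/-- The empirical measure `L_n = (1 / n) ∑ δ_{X_i}` of the first `n` observations. -/
def empiricalMeasure {E Ω : Type*} [MeasurableSpace E] (X : ℕ → Ω → E) (n : ℕ) (ω : Ω) :
    Measure E :=
  (n : ℝ≥0∞)⁻¹ • ∑ i ∈ Finset.range n, Measure.dirac (X i ω)

/-- The variables `X 0, X 1, …` are independent and each of them has law `μ`. -/
structure IsIIDSample {E Ω : Type*} [MeasurableSpace E] [MeasurableSpace Ω]
    (X : ℕ → Ω → E) (μ : Measure E) (P : Measure Ω) : Prop where
  measurable : ∀ i, Measurable (X i)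
  indep : iIndepFun X P
  law : ∀ i, P.map (X i) = μ

/-- Uniform control of covering numbers: `N(S ∩ B(x₀, R), δ) ≤ β (2R / δ) ^ α` for all `R > 0`
and all `δ ∈ (0, 2R]`, with closed balls and centres in the covered set. -/
def HasCoveringDim {E : Type*} [MetricSpace E] (S : Set E) (x₀ : E) (α β : ℝ) : Prop :=
  ∀ R δ : ℝ≥0, 0 < R → 0 < δ → δ ≤ 2 * R →
    (Metric.coveringNumber δ (S ∩ Metric.closedBall x₀ (R : ℝ)) : ℝ≥0∞) ≤
      ENNReal.ofReal (β * (2 * (R : ℝ) / (δ : ℝ)) ^ α)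

/-- The tail function `H(t) = μ(B(x₀, t)ᶜ)`. -/
def tail {E : Type*} [MetricSpace E] [MeasurableSpace E] (μ : Measure E) (x₀ : E) (t : ℝ) :
    ℝ≥0∞ :=
  μ (Metric.closedBall x₀ t)ᶜ

/-- The `q`-th power `‖X‖_{q,w}^q = sup_{t ≥ 0} t ^ q H(t)` of the weak moment of order `q`. -/
def weakMoment {E : Type*} [MetricSpace E] [MeasurableSpace E] (μ : Measure E) (x₀ : E) (q : ℝ) :
    ℝ≥0∞ :=
  ⨆ t : ℝ≥0, (t : ℝ≥0∞) ^ q * tail μ x₀ (t : ℝ)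

/-- `∫_0^∞ H(t) ^ s t ^ (p - 1) dt`. -/
def tailIntegral {E : Type*} [MetricSpace E] [MeasurableSpace E] (μ : Measure E) (x₀ : E)
    (s p : ℝ) : ℝ≥0∞ :=
  ∫⁻ t in Ioi (0 : ℝ), tail μ x₀ t ^ s * ENNReal.ofReal (t ^ (p - 1))

/-- `I_{α,p} = ∫_0^∞ H(t) ^ ((α - p) / α) t ^ (p - 1) dt`. -/
def momentIntegral {E : Type*} [MetricSpace E] [MeasurableSpace E] (μ : Measure E) (x₀ : E)
    (α p : ℝ) : ℝ≥0∞ :=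
  tailIntegral μ x₀ ((α - p) / α) p

/-- `I_{2p,p} = ∫_0^∞ √H(t) t ^ (p - 1) dt`. -/
def sqrtMomentIntegral {E : Type*} [MetricSpace E] [MeasurableSpace E] (μ : Measure E) (x₀ : E)
    (p : ℝ) : ℝ≥0∞ :=
  tailIntegral μ x₀ (1 / 2) p

/-- The probability `P(W_p^p(μ, L_n) > y)`. -/
def devProb {E Ω : Type*} [MetricSpace E] [MeasurableSpace E] [MeasurableSpace Ω]
    (P : Measure Ω) (X : ℕ → Ω → E) (μ : Measure E) (p : ℝ) (n : ℕ) (y : ℝ) : ℝ≥0∞ :=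
  P {ω | ENNReal.ofReal y < wassersteinPow p μ (empiricalMeasure X n ω)}

end

end WassersteinEmpirical

/-! Put s = (α - p)/α and study n W_p^p(μ, L_n) against the threshold y = x n^ρ. Its size is split
into fluctuations inside a ball of radius R about x₀, a deterministic part, and the contribution of
observations outside the ball.

Inside, the ball is cut into dyadic annuli A_k of outer radius r_k = R/2^k, and each annulus is
coupled along a tree of nested cells: mass is matched in the finest cells, the remainder in their
parents, and so on. The mass moved at scale r_k/2^l is controlled by deviations of cell counts from
their means (`HasCoveringDim.wassersteinPow_le`). A count of mean m has an exponential moment at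
scale √m + 1 (`IsIIDSample.subExp_countDev`); such scales add by convexity, without independence
between cells, and Cauchy–Schwarz sums them over the roughly 2^(αl) cells of a level. Since α > 2p,
the deepest level dominates, and stopping once there are about as many cells as expected
observations gives r_k^p (1 + n μ(A_k))^s (`exists_block_constant`). Summing over k, the inner part
has exponential moments at scale B, where B dominates R^p and ∑ r_k^p (n H(r_(k+1)))^s
(`exists_subExp_bound`).

Polynomial decay comes from the outside observations. Suppose H(t) ≤ K t^(-rp). For the
non-asymptotic bounds take R^p = A with A^r = nK. If r < 2 and the sum over k is of order A,
truncation and a second moment give a probability of order (A/y)^r (`exists_deviation_bound`). The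
sum is geometric when rs < 1; at rs = 1 it is compared with the integral I_(α,p).

When rs > 1, only limits are claimed, and one takes R^p = n^(ρ-ε) instead. The inner part then
exceeds y only with probability exp(-c n^ε), two observations outside the ball are too rare to
matter, and what remains is one observation at distance of order y^(1/p), of probability n H. The
covering constants affect only vanishing terms, so the limit constant depends on p and r alone
(`limsup_devProb_le`). -/

namespace WassersteinEmpirical

/-! ### Partial couplings within the cells of a labelling -/

section Coupling

variable {E : Type*} [MeasurableSpace E]

lemma sum_restrict_fiber [MeasurableSingletonClass E] (a : Measure E) {g : E → E} (hg : Measurable g) {C : Finset E}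
    (hC : ∀ x, g x ∈ C) : ∑ c ∈ C, a.restrict (g ⁻¹' {c}) = a := by
  ext s hs
  rw [Measure.finsetSum_apply]
  have h1 : ∀ c ∈ C, a.restrict (g ⁻¹' {c}) s = a.restrict s (g ⁻¹' {c}) := fun c _ => by
    rw [Measure.restrict_apply hs, Measure.restrict_apply (hg (measurableSet_singleton c)),
      inter_comm]
  rw [Finset.sum_congr rfl h1, sum_measure_preimage_singleton C
    (fun c _ => hg (measurableSet_singleton c))]
  have : g ⁻¹' (C : Set E) = univ := by ext x; simpa using hC x
  rw [this]; simp

lemma sum_measure_fiber [MeasurableSingletonClass E] (a : Measure E) {g : E → E} (hg : Measurable g) {C : Finset E}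
    (hC : ∀ x, g x ∈ C) : ∑ c ∈ C, a (g ⁻¹' {c}) = a univ := by
  rw [sum_measure_preimage_singleton C (fun c _ => hg (measurableSet_singleton c))]
  congr 1
  ext x; simpa using hC x

lemma sum_smul_restrict_fiber_apply [MeasurableSingletonClass E] (a : Measure E) {g : E → E} (hg : Measurable g) {C : Finset E}
    (t : E → ℝ≥0∞) {c : E} (hc : c ∈ C) :
    (∑ c ∈ C, t c • a.restrict (g ⁻¹' {c})) (g ⁻¹' {c}) = t c * a (g ⁻¹' {c}) := by
  rw [Measure.finsetSum_apply, Finset.sum_eq_single c]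
  · simp
  · intro c' _ hne
    have : g ⁻¹' {c} ∩ g ⁻¹' {c'} = ∅ := by
      ext x
      simp only [mem_inter_iff, mem_preimage, mem_singleton_iff, mem_empty_iff_false, iff_false]
      rintro ⟨h1, h2⟩
      exact hne (h2.symm.trans h1)
    simp [Measure.restrict_apply (hg (measurableSet_singleton c)), this]
  · exact fun h => absurd hc h

/-- Inside each fibre of the label map `g`, as much mass as possible of `a` and `b` is coupled. -/
lemma exists_fiberwise_coupling [MeasurableSingletonClass E] (a b : Measure E) [IsFiniteMeasure a] [IsFiniteMeasure b]
    {g : E → E} (hg : Measurable g) {C : Finset E} (hC : ∀ x, g x ∈ C) :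
    ∃ (π : Measure (E × E)) (a' b' : Measure E), π.fst + a' = a ∧ π.snd + b' = b ∧
      (∀ c ∈ C, a' (g ⁻¹' {c}) = 0 ∨ b' (g ⁻¹' {c}) = 0) ∧
      (∀ᵐ z ∂π, g z.1 = g z.2) := by
  have hA : ∀ c, MeasurableSet (g ⁻¹' {c}) := fun c => hg (measurableSet_singleton c)
  -- Dividing the product of the restrictions by the larger of the two masses makes both marginals
  -- sub-marginals and exhausts the lighter measure on the fibre. On a null fibre the infinite
  -- inverse multiplies zero.
  set m : E → ℝ≥0∞ := fun c => max (a (g ⁻¹' {c})) (b (g ⁻¹' {c})) with hm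
  have hmtop : ∀ c, m c ≠ ∞ := fun c => by simp [hm]
  have key : ∀ c (u : ℝ≥0∞), u ≤ m c → (m c)⁻¹ * u ≤ 1 := fun c u hu => by
    calc (m c)⁻¹ * u ≤ (m c)⁻¹ * m c := by gcongr
      _ ≤ 1 := ENNReal.inv_mul_le_one _
  have one : ∀ c, m c ≠ 0 → (m c)⁻¹ * m c = 1 := fun c h => ENNReal.inv_mul_cancel h (hmtop c)
  refine ⟨∑ c ∈ C, (m c)⁻¹ • ((a.restrict (g ⁻¹' {c})).prod (b.restrict (g ⁻¹' {c}))),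
    ∑ c ∈ C, (1 - (m c)⁻¹ * b (g ⁻¹' {c})) • a.restrict (g ⁻¹' {c}),
    ∑ c ∈ C, (1 - (m c)⁻¹ * a (g ⁻¹' {c})) • b.restrict (g ⁻¹' {c}), ?_, ?_, ?_, ?_⟩
  · conv_rhs => rw [← sum_restrict_fiber a hg hC]
    rw [Measure.fst, Measure.map_finset_sum measurable_fst.aemeasurable, ← Finset.sum_add_distrib]
    refine Finset.sum_congr rfl fun c _ => ?_
    rw [Measure.map_smul, Measure.map_fst_prod, smul_smul, ← add_smul, Measure.restrict_apply_univ,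
      add_tsub_cancel_of_le (key c _ (le_max_right _ _)), one_smul]
  · conv_rhs => rw [← sum_restrict_fiber b hg hC]
    rw [Measure.snd, Measure.map_finset_sum measurable_snd.aemeasurable, ← Finset.sum_add_distrib]
    refine Finset.sum_congr rfl fun c _ => ?_
    rw [Measure.map_smul, Measure.map_snd_prod, smul_smul, ← add_smul, Measure.restrict_apply_univ,
      add_tsub_cancel_of_le (key c _ (le_max_left _ _)), one_smul]
  · intro c hc
    rw [sum_smul_restrict_fiber_apply a hg _ hc, sum_smul_restrict_fiber_apply b hg _ hc]
    rcases le_total (a (g ⁻¹' {c})) (b (g ⁻¹' {c})) with h | h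
    · left
      by_cases h0 : m c = 0
      · have : a (g ⁻¹' {c}) = 0 := le_antisymm (h0 ▸ le_max_left _ _) bot_le
        simp [this]
      · have : b (g ⁻¹' {c}) = m c := (max_eq_right h).symm
        rw [this, one c h0]; simp
    · right
      by_cases h0 : m c = 0
      · have : b (g ⁻¹' {c}) = 0 := le_antisymm (h0 ▸ le_max_right _ _) bot_le
        simp [this]
      · have : a (g ⁻¹' {c}) = m c := (max_eq_left h).symm
        rw [this, one c h0]; simp
  · rw [ae_iff, Measure.finsetSum_apply]
    refine Finset.sum_eq_zero fun c _ => ?_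
    rw [Measure.smul_apply, Measure.prod_restrict]
    have h : ∀ᵐ z ∂((a.prod b).restrict ((g ⁻¹' {c}) ×ˢ (g ⁻¹' {c}))), g z.1 = g z.2 := by
      filter_upwards [ae_restrict_mem ((hA c).prod (hA c))] with z hz
      exact hz.1.trans hz.2.symm
    rw [ae_iff] at h
    rw [h]; simp

lemma ae_fst_of_add_eq {π : Measure (E × E)} {a a' : Measure E} (h : π.fst + a' = a)
    {q : E → Prop} (hq : ∀ᵐ x ∂a, q x) : ∀ᵐ z ∂π, q z.1 := by
  have h1 : ∀ᵐ x ∂π.fst, q x := by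
    refine (Measure.absolutelyContinuous_of_le ?_).ae_le hq
    rw [← h]; exact Measure.le_add_right le_rfl
  exact ae_of_ae_map measurable_fst.aemeasurable h1

lemma ae_snd_of_add_eq {π : Measure (E × E)} {a a' : Measure E} (h : π.snd + a' = a)
    {q : E → Prop} (hq : ∀ᵐ x ∂a, q x) : ∀ᵐ z ∂π, q z.2 := by
  have h1 : ∀ᵐ x ∂π.snd, q x := by
    refine (Measure.absolutelyContinuous_of_le ?_).ae_le hq
    rw [← h]; exact Measure.le_add_right le_rfl
  exact ae_of_ae_map measurable_snd.aemeasurable h1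

/-- Balance of mass between the two marginals on the fibres of a label map. -/
lemma balance_of_ae_eq [MeasurableSingletonClass E] {π : Measure (E × E)} {a b a' b' : Measure E} (h1 : π.fst + a' = a)
    (h2 : π.snd + b' = b) {g : E → E} (hg : Measurable g) (hπ : ∀ᵐ z ∂π, g z.1 = g z.2) (c : E) :
    a (g ⁻¹' {c}) + b' (g ⁻¹' {c}) = b (g ⁻¹' {c}) + a' (g ⁻¹' {c}) := by
  have hA : MeasurableSet (g ⁻¹' {c}) := hg (measurableSet_singleton c)
  have : π.fst (g ⁻¹' {c}) = π.snd (g ⁻¹' {c}) := by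
    rw [Measure.fst_apply hA, Measure.snd_apply hA]
    refine measure_congr ?_
    filter_upwards [hπ] with z hz
    apply propext
    show g z.1 = c ↔ g z.2 = c
    rw [hz]
  rw [← h1, ← h2, Measure.add_apply, Measure.add_apply, this]
  ring

/-- As one of the two leftovers vanishes, the balance equation determines the other. This converts
leftover mass in a cell into a truncated difference of masses. -/
lemma le_tsub_of_balance {x y x' y' : ℝ≥0∞} (hx : x ≠ ∞) (h : x + y' = y + x') (h0 : x' = 0 ∨ y' = 0) :
    x' ≤ x - y := by
  rcases h0 with h0 | h0
  · simp [h0]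
  · rw [h0, add_zero] at h
    rw [h]
    refine le_of_eq (ENNReal.add_sub_cancel_left ?_).symm
    rintro rfl
    rw [top_add] at h
    exact hx h

end Coupling

/-! ### Nested labels and multiscale coupling -/

section Tree

variable {E : Type*} [MetricSpace E] [MeasurableSpace E]

lemma lintegral_edist_rpow_le [BorelSpace E] {π : Measure (E × E)} {a a' : Measure E} {p : ℝ} (hp : 0 ≤ p)
    (h1 : π.fst + a' = a) {D : ℝ≥0∞} (hD : ∀ᵐ z ∂π, edist z.1 z.2 ≤ D) :
    ∫⁻ z, edist z.1 z.2 ^ p ∂π ≤ D ^ p * a univ := by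
  calc ∫⁻ z, edist z.1 z.2 ^ p ∂π ≤ ∫⁻ _, D ^ p ∂π :=
        lintegral_mono_ae (hD.mono fun z hz => ENNReal.rpow_le_rpow hz hp)
    _ = D ^ p * π univ := lintegral_const _
    _ ≤ D ^ p * a univ := by
        gcongr
        rw [← h1, Measure.add_apply, Measure.fst_apply MeasurableSet.univ, preimage_univ]
        exact le_self_add

/-- Coupling along a tree of labels `f L, …, f 0` of decreasing resolution. -/
lemma exists_tree_coupling [BorelSpace E] {p : ℝ} (hp : 0 ≤ p) {L : ℕ} {f φ : ℕ → E → E}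
    {C : ℕ → Finset E} {A : Set E} {D : ℕ → ℝ≥0∞}
    (hf : ∀ l, Measurable (f l)) (hC : ∀ l x, f l x ∈ C l)
    (hφ : ∀ l < L, f l = φ l ∘ f (l + 1))
    (hD : ∀ l ≤ L, ∀ x ∈ A, ∀ y ∈ A, f l x = f l y → edist x y ≤ D l)
    (μ ν : Measure E) [IsFiniteMeasure μ] [IsFiniteMeasure ν]
    (hμ : ∀ᵐ x ∂μ, x ∈ A) (hν : ∀ᵐ x ∂ν, x ∈ A) {l : ℕ} (hl : l ≤ L) :
    ∃ (π : Measure (E × E)) (μ' ν' : Measure E), π.fst + μ' = μ ∧ π.snd + ν' = ν ∧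
      (∀ c ∈ C l, μ' (f l ⁻¹' {c}) = 0 ∨ ν' (f l ⁻¹' {c}) = 0) ∧
      (∀ᵐ z ∂π, f l z.1 = f l z.2) ∧
      ∫⁻ z, edist z.1 z.2 ^ p ∂π ≤ D L ^ p * μ univ +
        ∑ i ∈ Finset.Ico l L, D i ^ p *
          ∑ c ∈ C (i + 1), (μ (f (i + 1) ⁻¹' {c}) - ν (f (i + 1) ⁻¹' {c})) := by
  -- The induction runs from the finest level to the coarsest. At level L the whole mass is charged
  -- D L; at a level l below it, only the leftover of level l + 1 moves, at price D l, and in each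
  -- cell of level l + 1 that leftover is at most the truncated difference of the original masses.
  induction hl using Nat.decreasingInduction with
  | self =>
    obtain ⟨π, μ', ν', h1, h2, h3, h4⟩ := exists_fiberwise_coupling μ ν (hf L) (hC L)
    refine ⟨π, μ', ν', h1, h2, h3, h4, ?_⟩
    rw [Finset.Ico_self, Finset.sum_empty, add_zero]
    refine lintegral_edist_rpow_le hp h1 ?_
    filter_upwards [ae_fst_of_add_eq h1 hμ, ae_snd_of_add_eq h2 hν, h4] with z hz1 hz2 hz
    exact hD L le_rfl _ hz1 _ hz2 hz
  | of_succ l hl ih =>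
    obtain ⟨π, μ', ν', h1, h2, h3, h4, h5⟩ := ih
    have hμ'le : μ' ≤ μ := by rw [← h1]; exact Measure.le_add_left le_rfl
    have hν'le : ν' ≤ ν := by rw [← h2]; exact Measure.le_add_left le_rfl
    have : IsFiniteMeasure μ' := isFiniteMeasure_of_le μ hμ'le
    have : IsFiniteMeasure ν' := isFiniteMeasure_of_le ν hν'le
    obtain ⟨π₂, a', b', g1, g2, g3, g4⟩ := exists_fiberwise_coupling μ' ν' (hf l) (hC l)
    refine ⟨π + π₂, a', b', ?_, ?_, g3, ?_, ?_⟩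
    · rw [Measure.fst_add, add_assoc, g1, h1]
    · rw [Measure.snd_add, add_assoc, g2, h2]
    · rw [ae_add_measure_iff]
      refine ⟨?_, g4⟩
      filter_upwards [h4] with z hz
      rw [hφ l hl, Function.comp_apply, Function.comp_apply, hz]
    · rw [lintegral_add_measure, Finset.sum_eq_sum_Ico_succ_bot hl, ← add_assoc, add_right_comm]
      refine add_le_add h5 ?_
      have hμ'A : ∀ᵐ x ∂μ', x ∈ A := (Measure.absolutelyContinuous_of_le hμ'le).ae_le hμ
      have hν'A : ∀ᵐ x ∂ν', x ∈ A := (Measure.absolutelyContinuous_of_le hν'le).ae_le hν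
      refine (lintegral_edist_rpow_le hp g1 (D := D l) ?_).trans ?_
      · filter_upwards [ae_fst_of_add_eq g1 hμ'A, ae_snd_of_add_eq g2 hν'A, g4] with z hz1 hz2 hz
        exact hD l hl.le _ hz1 _ hz2 hz
      · gcongr
        rw [← sum_measure_fiber μ' (hf (l + 1)) (hC (l + 1))]
        exact Finset.sum_le_sum fun c hc => le_tsub_of_balance (measure_ne_top _ _)
          (balance_of_ae_eq h1 h2 (hf (l + 1)) h4 c) (h3 c hc)

/-- A finite cover gives a measurable map with finite range that moves covered points little. -/
lemma exists_measurable_selector [BorelSpace E] (x₀ : E) (δ : ℝ) (C : Finset E) :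
    ∃ q : E → E, Measurable q ∧ (∀ x, q x ∈ insert x₀ (C : Set E)) ∧
      ∀ x, (∃ c ∈ C, dist x c ≤ δ) → q x ∈ C ∧ dist x (q x) ≤ δ := by
  classical
  induction C using Finset.induction_on with
  | empty => exact ⟨fun _ => x₀, measurable_const, by simp, by simp⟩
  | insert c C _ ih =>
    obtain ⟨q, hq, h1, h2⟩ := ih
    refine ⟨(Metric.closedBall c δ).piecewise (fun _ => c) q,
      measurable_const.piecewise Metric.isClosed_closedBall.measurableSet hq, fun x => ?_,
      fun x hx => ?_⟩
    · by_cases h : x ∈ Metric.closedBall c δ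
      · simp [h]
      · rw [piecewise_eq_of_notMem _ _ _ h]
        rcases h1 x with h | h
        · exact Or.inl h
        · exact Or.inr (by simpa using Or.inr h)
    · by_cases h : x ∈ Metric.closedBall c δ
      · rw [piecewise_eq_of_mem _ _ _ h]
        exact ⟨Finset.mem_insert_self _ _, h⟩
      · rw [piecewise_eq_of_notMem _ _ _ h]
        obtain ⟨c', hc', hd⟩ := hx
        rcases Finset.mem_insert.1 hc' with rfl | hc'
        · exact absurd hd h
        · exact ⟨Finset.mem_insert_of_mem (h2 x ⟨c', hc', hd⟩).1, (h2 x ⟨c', hc', hd⟩).2⟩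

/-- Because the centres lie in the covered set, the selector maps that set to itself and can be
iterated across scales. The point x₀ labels what is not covered; this extra label turns β into β +
1. -/
lemma HasCoveringDim.exists_selector [BorelSpace E] {S : Set E} {x₀ : E} {α β : ℝ}
    (h : HasCoveringDim S x₀ α β) (hβ : 0 < β) (hα : 0 ≤ α) {R : ℝ} (hR : 0 < R) (l : ℕ) :
    ∃ (q : E → E) (C : Finset E), Measurable q ∧ (∀ x, q x ∈ C) ∧
      (∀ x ∈ S ∩ Metric.closedBall x₀ R, q x ∈ S ∩ Metric.closedBall x₀ R ∧
        dist x (q x) ≤ 2 * R / 2 ^ l) ∧ (C.card : ℝ) ≤ (β + 1) * 2 ^ (α * l) := by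
  classical
  obtain ⟨δ, hδ⟩ : ∃ δ : ℝ≥0, (δ : ℝ) = 2 * R / 2 ^ l := ⟨⟨2 * R / 2 ^ l, by positivity⟩, rfl⟩
  have h1 := h R.toNNReal δ (by simpa using hR) (by rw [← NNReal.coe_pos, hδ]; positivity) (by
    rw [← NNReal.coe_le_coe, NNReal.coe_mul, Real.coe_toNNReal _ hR.le, hδ]
    exact div_le_self (by positivity) (one_le_pow₀ (by norm_num)))
  have h2 : (2 * R / (2 * R / 2 ^ l)) ^ α = 2 ^ (α * l) := by
    rw [div_div_cancel₀ (by positivity), ← Real.rpow_natCast, ← Real.rpow_mul (by norm_num), mul_comm]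
  rw [hδ, Real.coe_toNNReal _ hR.le, h2] at h1
  have hne : Metric.coveringNumber δ (S ∩ Metric.closedBall x₀ R) ≠ ⊤ := by
    intro h
    rw [h] at h1
    simp at h1
  obtain ⟨N, hNA, hNfin, hNcov, hNcard⟩ := Metric.exists_set_encard_eq_coveringNumber hne
  obtain ⟨q, hq, hq1, hq2⟩ := exists_measurable_selector x₀ (2 * R / 2 ^ l) hNfin.toFinset
  refine ⟨q, insert x₀ hNfin.toFinset, hq, fun x => by simpa using hq1 x, fun x hx => ?_, ?_⟩
  · obtain ⟨c, hc, hxc⟩ := hNcov hx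
    have := hq2 x ⟨c, by simpa using hc, by
      have : edist x c ≤ δ := hxc
      rw [edist_nndist, ENNReal.coe_le_coe, ← NNReal.coe_le_coe, coe_nndist, hδ] at this
      exact this⟩
    exact ⟨hNA (by simpa using this.1), this.2⟩
  · have h3 : ((hNfin.toFinset.card : ℕ∞) : ℝ≥0∞) ≤ ENNReal.ofReal (β * 2 ^ (α * l)) := by
      rw [← hNfin.encard_eq_coe_toFinset_card, hNcard]; exact h1
    have h4 : (hNfin.toFinset.card : ℝ) ≤ β * 2 ^ (α * l) := by
      have := ENNReal.toReal_mono ENNReal.ofReal_ne_top h3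
      rw [ENNReal.toReal_ofReal (by positivity)] at this
      simpa using this
    have h5 : (1 : ℝ) ≤ 2 ^ (α * l) := Real.one_le_rpow (by norm_num) (by positivity)
    calc ((insert x₀ hNfin.toFinset).card : ℝ) ≤ (hNfin.toFinset.card + 1 : ℕ) := by
          exact_mod_cast Finset.card_insert_le _ _
      _ ≤ _ := by push_cast; linarith

/-- Nested label maps at the scales `R, R / 2, …, R / 2 ^ L`. -/
lemma HasCoveringDim.exists_labels [BorelSpace E] {S : Set E} {x₀ : E} {α β : ℝ}
    (h : HasCoveringDim S x₀ α β) (hβ : 0 < β) (hα : 0 ≤ α) {R : ℝ} (hR : 0 < R) (L : ℕ) :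
    ∃ (f φ : ℕ → E → E) (C : ℕ → Finset E), (∀ l, Measurable (f l)) ∧ (∀ l x, f l x ∈ C l) ∧
      (∀ l < L, f l = φ l ∘ f (l + 1)) ∧ C 0 = {x₀} ∧
      (∀ l, ((C l).card : ℝ) ≤ (β + 1) * 2 ^ (α * l)) ∧
      ∀ l ≤ L, ∀ x ∈ S ∩ Metric.closedBall x₀ R, ∀ y ∈ S ∩ Metric.closedBall x₀ R,
        f l x = f l y → edist x y ≤ ENNReal.ofReal (8 * R / 2 ^ l) := by
  set A := S ∩ Metric.closedBall x₀ R with hA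
  choose q C hq hqC hqA hcard using fun l => h.exists_selector hβ hα hR l
  -- The root receives a single label, so that the tree matches as much mass as possible over the
  -- whole block.
  let q' : ℕ → E → E := fun l => if l = 0 then fun _ => x₀ else q l
  let C' : ℕ → Finset E := fun l => if l = 0 then {x₀} else C l
  have hq' : ∀ l, Measurable (q' l) := fun l => by
    by_cases hl : l = 0 <;> simp [q', hl, hq]
  have hqC' : ∀ l x, q' l x ∈ C' l := fun l x => by
    by_cases hl : l = 0 <;> simp [q', C', hl, hqC]
  -- `G j` is the label at level L - j, obtained by projecting the previous finer label rather than
  -- the point itself; a coarse label is thus a function of the finer one.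
  let G : ℕ → E → E := fun j => Nat.rec (q' L) (fun j F => q' (L - (j + 1)) ∘ F) j
  have hG0 : G 0 = q' L := rfl
  have hGs : ∀ j, G (j + 1) = q' (L - (j + 1)) ∘ G j := fun j => rfl
  have hG : ∀ j, Measurable (G j) := fun j => by
    induction j with
    | zero => exact hq' L
    | succ j ih => exact (hq' _).comp ih
  have hGC : ∀ j x, G j x ∈ C' (L - j) := fun j x => by
    cases j with
    | zero => exact hqC' L x
    | succ j => exact hqC' _ _
  have hf0 : ∀ l ≤ L, G (L - l) = if l = L then q' L else q' l ∘ G (L - (l + 1)) := by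
    intro l hl
    split_ifs with h
    · rw [h, Nat.sub_self, hG0]
    · have : L - l = (L - (l + 1)) + 1 := by omega
      rw [this, hGs]
      congr 2
      omega
  -- Successive projections move a point by 2R/2^i for i ≥ l, hence by at most 4R/2^l in total. The
  -- root is excluded, as its constant label need not lie in A.
  have hdist : ∀ j, j < L → ∀ x ∈ A, G j x ∈ A ∧ dist x (G j x) ≤ 4 * R / 2 ^ (L - j) := by
    intro j
    induction j with
    | zero =>
      intro hj x hx
      have : q' L = q L := if_neg (by omega)
      rw [hG0, this]
      refine ⟨(hqA L x hx).1, (hqA L x hx).2.trans ?_⟩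
      simp only [Nat.sub_zero]
      gcongr
      norm_num
    | succ j ih =>
      intro hj x hx
      have h1 := ih (by omega) x hx
      have : q' (L - (j + 1)) = q (L - (j + 1)) := if_neg (by omega)
      have h2 := hqA (L - (j + 1)) _ h1.1
      rw [hGs, this]
      refine ⟨h2.1, ?_⟩
      calc dist x (q (L - (j + 1)) (G j x)) ≤ dist x (G j x) + dist (G j x) (q (L - (j + 1)) (G j x)) :=
            dist_triangle _ _ _
        _ ≤ 4 * R / 2 ^ (L - j) + 2 * R / 2 ^ (L - (j + 1)) := add_le_add h1.2 h2.2
        _ = 4 * R / 2 ^ (L - (j + 1)) := by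
            rw [(by omega : L - j = (L - (j + 1)) + 1), pow_succ]
            field_simp
            ring
  refine ⟨fun l => if l ≤ L then G (L - l) else q' l, q', C', ?_, ?_, ?_, by simp [C'], ?_, ?_⟩
  · intro l
    by_cases hl : l ≤ L <;> simp [hl, hG, hq']
  · intro l x
    by_cases hl : l ≤ L
    · have := hGC (L - l) x
      rw [Nat.sub_sub_self hl] at this
      simpa [hl] using this
    · simpa [hl] using hqC' l x
  · intro l hl
    simp only [hl.le, if_true, Nat.succ_le_of_lt hl, hf0 l hl.le, hl.ne, if_false]
  · intro l
    by_cases hl : l = 0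
    · simp [hl, C']; linarith
    · simpa [hl, C'] using hcard l
  · intro l hl x hx y hy hxy
    simp only [hl, if_true] at hxy
    rw [edist_dist]
    refine ENNReal.ofReal_le_ofReal ?_
    by_cases h0 : l = 0
    · rw [h0, pow_zero, div_one]
      have h1 : dist x x₀ ≤ R := hx.2
      have h2 : dist y x₀ ≤ R := hy.2
      linarith [dist_triangle_right x y x₀]
    · have h1 := (hdist (L - l) (by omega) x hx).2
      have h2 := (hdist (L - l) (by omega) y hy).2
      rw [Nat.sub_sub_self hl] at h1 h2
      rw [← hxy] at h2
      calc dist x y ≤ dist x (G (L - l) x) + dist y (G (L - l) x) := dist_triangle_right _ _ _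
        _ ≤ 4 * R / 2 ^ l + 4 * R / 2 ^ l := add_le_add h1 h2
        _ = _ := by ring

end Tree

/-! ### Gluing annuli: a deterministic bound for W_p^p -/

section Glue

variable {E : Type*} [MetricSpace E]

/-- The total excess of mass between two measures of the same set. -/
def excess {E : Type*} [MeasurableSpace E] (μ ν : Measure E) (B : Set E) : ℝ≥0∞ := (μ B - ν B) + (ν B - μ B)

lemma lintegral_edist_rpow_le_marginals [MeasurableSpace E] [BorelSpace E] [SecondCountableTopology E] {p : ℝ}
    (hp : 1 ≤ p) (x₀ : E) (π : Measure (E × E)) :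
    ∫⁻ z, edist z.1 z.2 ^ p ∂π ≤
      2 ^ (p - 1) * (∫⁻ x, edist x x₀ ^ p ∂π.fst + ∫⁻ x, edist x x₀ ^ p ∂π.snd) := by
  have hm : Measurable fun x : E => edist x x₀ ^ p :=
    (measurable_id.edist measurable_const).pow_const p
  have hm1 : Measurable fun z : E × E => edist z.1 x₀ ^ p := hm.comp measurable_fst
  rw [Measure.fst, Measure.snd, lintegral_map hm measurable_fst, lintegral_map hm measurable_snd,
    ← lintegral_add_left hm1,
    ← lintegral_const_mul' _ _ (ENNReal.rpow_ne_top_of_nonneg (by linarith) ENNReal.ofNat_ne_top)]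
  refine lintegral_mono fun z => ?_
  refine (ENNReal.rpow_le_rpow (edist_triangle_right z.1 z.2 x₀) (by linarith)).trans ?_
  exact ENNReal.rpow_add_le_mul_rpow_add_rpow _ _ hp

lemma lintegral_edist_rpow_le_of_ae [MeasurableSpace E] {a : Measure E} {p : ℝ} (hp : 0 ≤ p) {x₀ : E} {r : ℝ≥0∞}
    (h : ∀ᵐ x ∂a, edist x x₀ ≤ r) : ∫⁻ x, edist x x₀ ^ p ∂a ≤ r ^ p * a univ := by
  rw [← lintegral_const]
  exact lintegral_mono_ae (h.mono fun x hx => ENNReal.rpow_le_rpow hx hp)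

/-- Couplings on disjoint blocks are glued; what they leave over is coupled arbitrarily. -/
lemma wassersteinPow_le_of_blocks [MeasurableSpace E] [BorelSpace E] [SecondCountableTopology E] {p : ℝ} (hp : 1 ≤ p)
    (x₀ : E) (μ ν : Measure E) [IsProbabilityMeasure μ] [IsProbabilityMeasure ν] (K : ℕ)
    {B : ℕ → Set E} (hB : ∀ k, MeasurableSet (B k)) (hdisj : Pairwise (Function.onFun Disjoint B))
    {r c : ℕ → ℝ≥0∞} (hr : ∀ k, ∀ x ∈ B k, edist x x₀ ≤ r k)
    (hπ : ∀ k, ∃ (π : Measure (E × E)) (μ' ν' : Measure E),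
      π.fst + μ' = μ.restrict (B k) ∧ π.snd + ν' = ν.restrict (B k) ∧
      μ' univ ≤ μ (B k) - ν (B k) ∧ ν' univ ≤ ν (B k) - μ (B k) ∧
      ∫⁻ z, edist z.1 z.2 ^ p ∂π ≤ c k) :
    wassersteinPow p μ ν ≤ ∑ k ∈ Finset.range K, c k + 2 ^ (p - 1) *
      (∑ k ∈ Finset.range K, r k ^ p * excess μ ν (B k) +
        (∫⁻ x in (⋃ k ∈ Finset.range K, B k)ᶜ, edist x x₀ ^ p ∂μ +
          ∫⁻ x in (⋃ k ∈ Finset.range K, B k)ᶜ, edist x x₀ ^ p ∂ν)) := by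
  choose π μ' ν' h1 h2 h3 h4 h5 using hπ
  set V := ⋃ k ∈ Finset.range K, B k with hV
  have hVm : MeasurableSet V := Finset.measurableSet_biUnion _ fun k _ => hB k
  have hsplit : ∀ a : Measure E, ∑ k ∈ Finset.range K, a.restrict (B k) + a.restrict Vᶜ = a := by
    intro a
    have : a.restrict V = ∑ k ∈ Finset.range K, a.restrict (B k) := by
      rw [hV, Measure.restrict_biUnion_finset (fun i _ j _ hij => hdisj hij) hB]
      exact Measure.sum_coe_finset _ fun k => a.restrict (B k)
    rw [← this, Measure.restrict_add_restrict_compl hVm]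
  set M := ∑ k ∈ Finset.range K, μ' k + μ.restrict Vᶜ with hM
  set N := ∑ k ∈ Finset.range K, ν' k + ν.restrict Vᶜ with hN
  have hMμ : ∑ k ∈ Finset.range K, (π k).fst + M = μ := by
    rw [hM, ← add_assoc, ← Finset.sum_add_distrib, Finset.sum_congr rfl fun k _ => h1 k, hsplit]
  have hNν : ∑ k ∈ Finset.range K, (π k).snd + N = ν := by
    rw [hN, ← add_assoc, ← Finset.sum_add_distrib, Finset.sum_congr rfl fun k _ => h2 k, hsplit]
  have hMle : M ≤ μ := by rw [← hMμ]; exact Measure.le_add_left le_rfl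
  have hNle : N ≤ ν := by rw [← hNν]; exact Measure.le_add_left le_rfl
  have : IsFiniteMeasure M := isFiniteMeasure_of_le μ hMle
  have : IsFiniteMeasure N := isFiniteMeasure_of_le ν hNle
  -- With a constant label the fibre is the whole space. Both original measures have mass one, so
  -- the two final leftovers have equal mass; one of them is zero, hence both are, and a genuine
  -- coupling is obtained.
  obtain ⟨ρ, a', b', g1, g2, g3, g4⟩ := exists_fiberwise_coupling M N
    (g := fun _ => x₀) measurable_const (C := {x₀}) (by simp)
  have hu : (fun _ : E => x₀) ⁻¹' {x₀} = univ := by ext; simp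
  have hfst : (∑ k ∈ Finset.range K, π k).fst = ∑ k ∈ Finset.range K, (π k).fst := by
    rw [Measure.fst, Measure.map_finset_sum measurable_fst.aemeasurable]; rfl
  have hsnd : (∑ k ∈ Finset.range K, π k).snd = ∑ k ∈ Finset.range K, (π k).snd := by
    rw [Measure.snd, Measure.map_finset_sum measurable_snd.aemeasurable]; rfl
  have e1 : (∑ k ∈ Finset.range K, π k + ρ).fst + a' = μ := by
    rw [Measure.fst_add, hfst, add_assoc, g1, hMμ]
  have e2 : (∑ k ∈ Finset.range K, π k + ρ).snd + b' = ν := by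
    rw [Measure.snd_add, hsnd, add_assoc, g2, hNν]
  have hbal := balance_of_ae_eq e1 e2 (g := fun _ => x₀) measurable_const (by simp) x₀
  have hg3 := g3 x₀ (by simp)
  rw [hu] at hbal hg3
  simp only [measure_univ] at hbal
  have hbal' : b' univ = a' univ := (ENNReal.add_right_inj ENNReal.one_ne_top).1 hbal
  have ha' : a' = 0 := by
    rw [← Measure.measure_univ_eq_zero]
    rcases hg3 with h | h
    · exact h
    · rw [← hbal', h]
  have hb' : b' = 0 := by
    rw [← Measure.measure_univ_eq_zero, hbal', ha']; simp
  rw [ha', add_zero] at e1 g1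
  rw [hb', add_zero] at e2 g2
  have hp0 : 0 ≤ p := by linarith
  have hle1 : ∀ k, μ' k ≤ μ.restrict (B k) := fun k => by
    rw [← h1 k]; exact Measure.le_add_left le_rfl
  have hle2 : ∀ k, ν' k ≤ ν.restrict (B k) := fun k => by
    rw [← h2 k]; exact Measure.le_add_left le_rfl
  have hae : ∀ (a b : Measure E) (k : ℕ), a ≤ b.restrict (B k) → ∀ᵐ x ∂a, edist x x₀ ≤ r k :=
    fun a b k hab => (Measure.absolutelyContinuous_of_le hab).ae_le
      ((ae_restrict_mem (hB k)).mono fun x hx => hr k x hx)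
  refine (iInf₂_le _ ⟨e1, e2⟩).trans ?_
  rw [lintegral_add_measure, lintegral_finsetSum_measure]
  refine add_le_add (Finset.sum_le_sum fun k _ => h5 k) ?_
  refine (lintegral_edist_rpow_le_marginals hp x₀ ρ).trans ?_
  rw [g1, g2, hM, hN, lintegral_add_measure, lintegral_add_measure, lintegral_finsetSum_measure,
    lintegral_finsetSum_measure, add_add_add_comm, ← Finset.sum_add_distrib]
  gcongr with k _
  rw [excess, mul_add]
  gcongr
  · exact (lintegral_edist_rpow_le_of_ae hp0 (hae _ _ k (hle1 k))).trans (by gcongr; exact h3 k)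
  · exact (lintegral_edist_rpow_le_of_ae hp0 (hae _ _ k (hle2 k))).trans (by gcongr; exact h4 k)

/-- The dyadic annulus `R / 2 ^ (k + 1) < d(x, x₀) ≤ R / 2 ^ k`. -/
def annulus (x₀ : E) (R : ℝ) (k : ℕ) : Set E :=
  Metric.closedBall x₀ (R / 2 ^ k) \ Metric.closedBall x₀ (R / 2 ^ (k + 1))

lemma measurableSet_annulus [MeasurableSpace E] [BorelSpace E] (x₀ : E) (R : ℝ) (k : ℕ) :
    MeasurableSet (annulus x₀ R k) :=
  Metric.isClosed_closedBall.measurableSet.diff Metric.isClosed_closedBall.measurableSet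

lemma pairwise_disjoint_annulus (x₀ : E) {R : ℝ} (hR : 0 < R) :
    Pairwise (Function.onFun Disjoint (annulus x₀ R)) := by
  refine (pairwise_disjoint_on _).2 fun k l hkl => ?_
  rw [Set.disjoint_left]
  intro x hx hx'
  have h1 : ¬ dist x x₀ ≤ R / 2 ^ (k + 1) := hx.2
  have h2 : dist x x₀ ≤ R / 2 ^ l := hx'.1
  refine h1 (h2.trans ?_)
  have : k + 1 ≤ l := hkl
  gcongr
  norm_num

lemma compl_iUnion_annulus_subset (x₀ : E) (R : ℝ) (K : ℕ) :
    (⋃ k ∈ Finset.range K, annulus x₀ R k)ᶜ ⊆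
      Metric.closedBall x₀ (R / 2 ^ K) ∪ (Metric.closedBall x₀ R)ᶜ := by
  intro x hx
  by_contra hcon
  simp only [mem_union, not_or, mem_compl_iff, not_not] at hcon
  obtain ⟨hc1, hc2⟩ := hcon
  have hall : ∀ k ≤ K, x ∈ Metric.closedBall x₀ (R / 2 ^ k) := by
    intro k
    induction k with
    | zero => intro _; simpa using hc2
    | succ k ih =>
      intro hk
      by_contra h
      exact hx (mem_biUnion (x := k) (by simpa using hk) ⟨ih (by omega), h⟩)
  exact hc1 (hall K le_rfl)

/-- Multiscale upper bound for `W_p^p` at finite depth. -/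
lemma HasCoveringDim.wassersteinPow_le [MeasurableSpace E] [BorelSpace E] [SecondCountableTopology E]
    {S : Set E} {x₀ : E} {α β : ℝ}
    (h : HasCoveringDim S x₀ α β) (hβ : 0 < β) (hα : 0 ≤ α) {R : ℝ} (hR : 0 < R) {p : ℝ}
    (hp : 1 ≤ p) (K : ℕ) (L : ℕ → ℕ) :
    ∃ (f : ℕ → ℕ → E → E) (C : ℕ → ℕ → Finset E), (∀ k l, Measurable (f k l)) ∧
      (∀ k l x, f k l x ∈ C k l) ∧ (∀ k l, ((C k l).card : ℝ) ≤ (β + 1) * 2 ^ (α * l)) ∧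
      ∀ (μ ν : Measure E) [IsProbabilityMeasure μ] [IsProbabilityMeasure ν],
        (∀ᵐ x ∂μ, x ∈ S) → (∀ᵐ x ∂ν, x ∈ S) → wassersteinPow p μ ν ≤
        ∑ k ∈ Finset.range K, (ENNReal.ofReal (8 * (R / 2 ^ k) / 2 ^ (L k)) ^ p * μ (annulus x₀ R k) +
          ∑ l ∈ Finset.range (L k), ENNReal.ofReal (8 * (R / 2 ^ k) / 2 ^ l) ^ p *
            ∑ c ∈ C k (l + 1), excess μ ν (f k (l + 1) ⁻¹' {c} ∩ annulus x₀ R k)) +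
        2 ^ (p - 1) * (∑ k ∈ Finset.range K, ENNReal.ofReal (R / 2 ^ k) ^ p * excess μ ν (annulus x₀ R k) +
          (2 * ENNReal.ofReal (R / 2 ^ K) ^ p +
            (∫⁻ x in (Metric.closedBall x₀ R)ᶜ, edist x x₀ ^ p ∂μ +
              ∫⁻ x in (Metric.closedBall x₀ R)ᶜ, edist x x₀ ^ p ∂ν))) := by
  have hp0 : 0 ≤ p := by linarith
  choose f φ C hf hC hφ hC0 hcard hD using
    fun k => h.exists_labels hβ hα (R := R / 2 ^ k) (by positivity) (L k)
  refine ⟨f, C, hf, hC, hcard, fun μ ν _ _ hμ hν => ?_⟩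
  have hrest : ∀ a : Measure E, IsProbabilityMeasure a →
      ∫⁻ x in (⋃ k ∈ Finset.range K, annulus x₀ R k)ᶜ, edist x x₀ ^ p ∂a ≤
        ENNReal.ofReal (R / 2 ^ K) ^ p + ∫⁻ x in (Metric.closedBall x₀ R)ᶜ, edist x x₀ ^ p ∂a := by
    intro a _
    refine (lintegral_mono_set (compl_iUnion_annulus_subset x₀ R K)).trans ?_
    refine (lintegral_union_le _ _ _).trans ?_
    gcongr
    refine (lintegral_edist_rpow_le_of_ae hp0 (r := ENNReal.ofReal (R / 2 ^ K)) ?_).trans ?_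
    · filter_upwards [ae_restrict_mem Metric.isClosed_closedBall.measurableSet] with x hx
      rw [edist_dist]
      exact ENNReal.ofReal_le_ofReal hx
    · refine mul_le_of_le_one_right' ?_
      simpa using prob_le_one
  refine (wassersteinPow_le_of_blocks hp x₀ μ ν K (measurableSet_annulus x₀ R)
    (pairwise_disjoint_annulus x₀ hR) (r := fun k => ENNReal.ofReal (R / 2 ^ k))
    (c := fun k => ENNReal.ofReal (8 * (R / 2 ^ k) / 2 ^ (L k)) ^ p * μ (annulus x₀ R k) +
          ∑ l ∈ Finset.range (L k), ENNReal.ofReal (8 * (R / 2 ^ k) / 2 ^ l) ^ p *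
            ∑ c ∈ C k (l + 1), excess μ ν (f k (l + 1) ⁻¹' {c} ∩ annulus x₀ R k)) ?_ ?_).trans ?_
  · intro k x hx
    rw [edist_dist]
    exact ENNReal.ofReal_le_ofReal hx.1
  · intro k
    have hAm := measurableSet_annulus x₀ R k
    have hres : ∀ a : Measure E, (∀ᵐ x ∂a, x ∈ S) →
        ∀ᵐ x ∂(a.restrict (annulus x₀ R k)), x ∈ S ∩ Metric.closedBall x₀ (R / 2 ^ k) := by
      intro a ha
      filter_upwards [ae_restrict_of_ae ha, ae_restrict_mem hAm] with x h1 h2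
      exact ⟨h1, h2.1⟩
    obtain ⟨π, μ', ν', h1, h2, h3, h4, h5⟩ := exists_tree_coupling hp0 (hf k) (hC k) (hφ k) (hD k)
      (μ.restrict (annulus x₀ R k)) (ν.restrict (annulus x₀ R k)) (hres μ hμ) (hres ν hν)
      (Nat.zero_le (L k))
    -- The root cell is everything, so the tree leaves only the net imbalance of the annulus, to be
    -- moved at cost of order (R/2^k)^p.
    have hu : f k 0 ⁻¹' {x₀} = univ := by
      ext x
      have := hC k 0 x
      rw [hC0] at this
      simpa using this
    have hb := balance_of_ae_eq h1 h2 (hf k 0) h4 x₀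
    have hz := h3 x₀ (by simp [hC0])
    rw [hu] at hb hz
    simp only [Measure.restrict_apply_univ] at hb
    refine ⟨π, μ', ν', h1, h2, le_tsub_of_balance (measure_ne_top _ _) hb hz,
      le_tsub_of_balance (measure_ne_top _ _) hb.symm hz.symm, h5.trans ?_⟩
    rw [Measure.restrict_apply_univ, ← Finset.range_eq_Ico]
    gcongr with l _ c _
    have hm : MeasurableSet (f k (l + 1) ⁻¹' {c}) := hf k (l + 1) (measurableSet_singleton c)
    rw [Measure.restrict_apply hm, Measure.restrict_apply hm]
    exact le_self_add
  · refine add_le_add le_rfl (mul_le_mul_right (add_le_add le_rfl ?_) _)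
    refine (add_le_add (hrest μ inferInstance) (hrest ν inferInstance)).trans (le_of_eq ?_)
    ring

end Glue

/-! ### Calculus of exponential moments -/

section SubExponential

variable {Ω : Type*} [MeasurableSpace Ω]

/-- Nonnegative variables with an exponential moment at scale `a`. -/
structure SubExp (P : Measure Ω) (T : Ω → ℝ) (a : ℝ) : Prop where
  measurable : Measurable T
  nonneg : ∀ ω, 0 ≤ T ω
  pos : 0 < a
  lintegral_le : ∫⁻ ω, ENNReal.ofReal (Real.exp (T ω / a)) ∂P ≤ 6

variable {P : Measure Ω} {T T₁ T₂ : Ω → ℝ} {a a₁ a₂ : ℝ}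

lemma SubExp.mono (h : SubExp P T a₁) (ha : a₁ ≤ a₂) : SubExp P T a₂ where
  measurable := h.measurable
  nonneg := h.nonneg
  pos := h.pos.trans_le ha
  lintegral_le := by
    refine (lintegral_mono fun ω => ?_).trans h.lintegral_le
    gcongr
    · exact h.nonneg ω
    · exact h.pos

lemma SubExp.const_mul (h : SubExp P T a) {c : ℝ} (hc : 0 < c) :
    SubExp P (fun ω => c * T ω) (c * a) where
  measurable := h.measurable.const_mul c
  nonneg := fun ω => mul_nonneg hc.le (h.nonneg ω)
  pos := mul_pos hc h.pos
  lintegral_le := by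
    simp_rw [mul_div_mul_left _ _ hc.ne']
    exact h.lintegral_le

/-- By convexity of exp, with weights proportional to the scales, exponential moments survive
addition without any independence. -/
lemma SubExp.add (h₁ : SubExp P T₁ a₁) (h₂ : SubExp P T₂ a₂) :
    SubExp P (fun ω => T₁ ω + T₂ ω) (a₁ + a₂) where
  measurable := h₁.measurable.add h₂.measurable
  nonneg := fun ω => add_nonneg (h₁.nonneg ω) (h₂.nonneg ω)
  pos := add_pos h₁.pos h₂.pos
  lintegral_le := by
    have p1 := h₁.pos
    have p2 := h₂.pos
    have hconv : ∀ ω, ENNReal.ofReal (Real.exp ((T₁ ω + T₂ ω) / (a₁ + a₂))) ≤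
        ENNReal.ofReal (a₁ / (a₁ + a₂)) * ENNReal.ofReal (Real.exp (T₁ ω / a₁)) +
        ENNReal.ofReal (a₂ / (a₁ + a₂)) * ENNReal.ofReal (Real.exp (T₂ ω / a₂)) := by
      intro ω
      rw [← ENNReal.ofReal_mul (by positivity), ← ENNReal.ofReal_mul (by positivity),
        ← ENNReal.ofReal_add (by positivity) (by positivity)]
      refine ENNReal.ofReal_le_ofReal ?_
      have := convexOn_exp.2 (mem_univ (T₁ ω / a₁)) (mem_univ (T₂ ω / a₂))
        
        (by positivity : 0 ≤ a₁ / (a₁ + a₂)) (by positivity : 0 ≤ a₂ / (a₁ + a₂)) (by field_simp)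
      simp only [smul_eq_mul] at this
      refine le_trans (le_of_eq ?_) this
      congr 1
      field_simp
    refine (lintegral_mono hconv).trans ?_
    have m1 : Measurable fun ω => ENNReal.ofReal (Real.exp (T₁ ω / a₁)) :=
      (Real.measurable_exp.comp (h₁.measurable.div_const _)).ennreal_ofReal
    rw [lintegral_add_left (m1.const_mul _), lintegral_const_mul' _ _ ENNReal.ofReal_ne_top,
      lintegral_const_mul' _ _ ENNReal.ofReal_ne_top]
    calc _ ≤ ENNReal.ofReal (a₁ / (a₁ + a₂)) * 6 + ENNReal.ofReal (a₂ / (a₁ + a₂)) * 6 := by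
          gcongr
          · exact h₁.lintegral_le
          · exact h₂.lintegral_le
      _ = 6 := by
          rw [← add_mul, ← ENNReal.ofReal_add (by positivity) (by positivity), ← add_div,
            div_self (by positivity)]
          simp

lemma SubExp.add_sum {ι : Type*} (h₀ : SubExp P T a) (s : Finset ι) {U : ι → Ω → ℝ} {b : ι → ℝ}
    (h : ∀ i ∈ s, SubExp P (U i) (b i)) :
    SubExp P (fun ω => T ω + ∑ i ∈ s, U i ω) (a + ∑ i ∈ s, b i) := by
  classical
  induction s using Finset.induction_on with
  | empty => simpa using h₀
  | insert i s hi ih =>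
    have h1 := ih fun j hj => h j (Finset.mem_insert_of_mem hj)
    have h2 := (h i (Finset.mem_insert_self _ _)).add h1
    simp only [Finset.sum_insert hi]
    convert h2 using 1
    · ext ω; ring
    · ring

lemma SubExp.sum {ι : Type*} {s : Finset ι} (hs : s.Nonempty) {U : ι → Ω → ℝ} {b : ι → ℝ}
    (h : ∀ i ∈ s, SubExp P (U i) (b i)) :
    SubExp P (fun ω => ∑ i ∈ s, U i ω) (∑ i ∈ s, b i) := by
  classical
  obtain ⟨i, hi⟩ := hs
  have := (h i hi).add_sum (s.erase i) fun j hj => h j (Finset.mem_of_mem_erase hj)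
  simpa only [Finset.add_sum_erase _ _ hi,
    fun ω => Finset.add_sum_erase s (fun j => U j ω) hi] using this

lemma SubExp.measure_gt_le (h : SubExp P T a) (y : ℝ) :
    P {ω | y < T ω} ≤ ENNReal.ofReal (6 * Real.exp (-(y / a))) := by
  have hpos := h.pos
  have h1 : P {ω | y < T ω} ≤ P {ω | ENNReal.ofReal (Real.exp (y / a)) ≤
      ENNReal.ofReal (Real.exp (T ω / a))} := by
    refine measure_mono fun ω hω => ?_
    have : y < T ω := hω
    exact ENNReal.ofReal_le_ofReal (Real.exp_le_exp.2
      (div_le_div_of_nonneg_right this.le hpos.le))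
  have h2 : ENNReal.ofReal (Real.exp (y / a)) * P {ω | y < T ω} ≤ 6 :=
    (mul_le_mul_right h1 _).trans ((mul_meas_ge_le_lintegral₀
      (Real.measurable_exp.comp (h.measurable.div_const _)).ennreal_ofReal.aemeasurable _).trans
      h.lintegral_le)
  have h3 : ENNReal.ofReal (Real.exp (-(y / a))) * ENNReal.ofReal (Real.exp (y / a)) = 1 := by
    rw [← ENNReal.ofReal_mul (Real.exp_pos _).le, ← Real.exp_add]; simp
  calc P {ω | y < T ω} = ENNReal.ofReal (Real.exp (-(y / a))) *
        (ENNReal.ofReal (Real.exp (y / a)) * P {ω | y < T ω}) := by rw [← mul_assoc, h3, one_mul]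
    _ ≤ ENNReal.ofReal (Real.exp (-(y / a))) * 6 := by gcongr
    _ = _ := by
        rw [mul_comm, ENNReal.ofReal_mul (by norm_num)]; simp

end SubExponential

/-! ### Fluctuations of counts -/

section Counts

variable {E Ω : Type*} [MeasurableSpace E]

/-- `|N_n(G) - n μ(G)|`, where `N_n(G)` counts the observations in `G`. -/
noncomputable def countDev (X : ℕ → Ω → E) (μ : Measure E) (n : ℕ) (G : Set E) (ω : Ω) : ℝ :=
  |∑ i ∈ Finset.range n, (G.indicator (fun _ => (1 : ℝ)) (X i ω) - μ.real G)|

lemma ofReal_tsub_add_tsub {x y : ℝ} (hx : 0 ≤ x) (hy : 0 ≤ y) :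
    (ENNReal.ofReal x - ENNReal.ofReal y) + (ENNReal.ofReal y - ENNReal.ofReal x) =
      ENNReal.ofReal |x - y| := by
  rw [← ENNReal.ofReal_sub _ hy, ← ENNReal.ofReal_sub _ hx]
  rcases le_total x y with h | h
  · rw [ENNReal.ofReal_of_nonpos (sub_nonpos.2 h), zero_add, abs_of_nonpos (sub_nonpos.2 h), neg_sub]
  · rw [ENNReal.ofReal_of_nonpos (sub_nonpos.2 h), add_zero, abs_of_nonneg (sub_nonneg.2 h)]

lemma natCast_mul_empiricalMeasure (X : ℕ → Ω → E) {n : ℕ} (hn : n ≠ 0) (ω : Ω) {G : Set E}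
    (hG : MeasurableSet G) : (n : ℝ≥0∞) * empiricalMeasure X n ω G =
      ENNReal.ofReal (∑ i ∈ Finset.range n, G.indicator (fun _ => (1 : ℝ)) (X i ω)) := by
  rw [empiricalMeasure, Measure.smul_apply, smul_eq_mul, ← mul_assoc,
    ENNReal.mul_inv_cancel (by simpa using hn) (ENNReal.natCast_ne_top n), one_mul,
    Measure.finsetSum_apply, ENNReal.ofReal_sum_of_nonneg fun i _ => indicator_nonneg (by simp) _]
  refine Finset.sum_congr rfl fun i _ => ?_
  rw [Measure.dirac_apply' _ hG]
  by_cases h : X i ω ∈ G <;> simp [h]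

lemma natCast_mul_excess (X : ℕ → Ω → E) (μ : Measure E) [IsProbabilityMeasure μ] {n : ℕ}
    (hn : n ≠ 0) (ω : Ω) {G : Set E} (hG : MeasurableSet G) :
    (n : ℝ≥0∞) * excess μ (empiricalMeasure X n ω) G = ENNReal.ofReal (countDev X μ n G ω) := by
  have h1 : (n : ℝ≥0∞) * μ G = ENNReal.ofReal (n * μ.real G) := by
    rw [ENNReal.ofReal_mul (by positivity), ENNReal.ofReal_natCast, ofReal_measureReal]
  rw [excess, mul_add, ENNReal.mul_sub (fun _ _ => ENNReal.natCast_ne_top n),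
    ENNReal.mul_sub (fun _ _ => ENNReal.natCast_ne_top n), natCast_mul_empiricalMeasure X hn ω hG, h1,
    ofReal_tsub_add_tsub (by positivity)
      (Finset.sum_nonneg fun i _ => indicator_nonneg (by simp) _), abs_sub_comm, countDev,
    Finset.sum_sub_distrib]
  simp

lemma measurable_indicator_comp [MeasurableSpace Ω] {X : Ω → E} (hX : Measurable X) {G : Set E} (hG : MeasurableSet G) :
    Measurable fun ω => G.indicator (fun _ => (1 : ℝ)) (X ω) :=
  (measurable_const.indicator hG).comp hX

/-- With q = μ(G), use 1 + q(e^t - 1) ≤ exp(q(e^t - 1)) and e^t - 1 - t ≤ t². Keeping q in the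
exponent makes the later scale shrink with the variance of small cells. -/
lemma mgf_indicator_le (μ : Measure E) [IsProbabilityMeasure μ] {G : Set E} (hG : MeasurableSet G)
    {t : ℝ} (ht : |t| ≤ 1) :
    ∫ x, Real.exp (t * (G.indicator (fun _ => (1 : ℝ)) x - μ.real G)) ∂μ ≤
      Real.exp (μ.real G * t ^ 2) := by
  set q := μ.real G with hq
  have h1 : ∀ x, Real.exp (t * (G.indicator (fun _ => (1 : ℝ)) x - q)) =
      Real.exp (-(t * q)) * (1 + G.indicator (fun _ => Real.exp t - 1) x) := by
    intro x
    rw [mul_sub, sub_eq_add_neg, Real.exp_add, mul_comm]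
    by_cases h : x ∈ G <;> simp [h]
  simp_rw [h1]
  rw [integral_const_mul, integral_add (integrable_const _)
    ((integrable_const _).indicator hG), integral_indicator_const _ hG]
  simp only [integral_const, probReal_univ, smul_eq_mul, mul_one]
  rw [← hq]
  have h2 := Real.abs_exp_sub_one_sub_id_le ht
  have hq0 : 0 ≤ q := measureReal_nonneg
  calc Real.exp (-(t * q)) * (1 + q * (Real.exp t - 1))
      ≤ Real.exp (-(t * q)) * Real.exp (q * (Real.exp t - 1)) := by
        gcongr
        rw [add_comm]; exact Real.add_one_le_exp _
    _ = Real.exp (q * (Real.exp t - 1 - t)) := by rw [← Real.exp_add]; ring_nf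
    _ ≤ _ := by
        gcongr
        exact (le_abs_self _).trans h2

/-- At t = ±1/a with a = √(nq) + 1, both |t| ≤ 1 and n q t² ≤ 1 hold, so each one-sided exponential
moment is at most e; their sum 2e lies below the constant 6 of `SubExp`. -/
lemma IsIIDSample.subExp_countDev [MeasurableSpace Ω] {X : ℕ → Ω → E} {μ : Measure E} {P : Measure Ω}
    [IsProbabilityMeasure P] [IsProbabilityMeasure μ] (h : IsIIDSample X μ P) (n : ℕ) {G : Set E}
    (hG : MeasurableSet G) :
    SubExp P (countDev X μ n G) (√(n * μ.real G) + 1) := by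
  set q := μ.real G with hq
  have hq0 : 0 ≤ q := measureReal_nonneg
  set Y : ℕ → Ω → ℝ := fun i ω => G.indicator (fun _ => (1 : ℝ)) (X i ω) - q with hY
  have hYm : ∀ i, Measurable (Y i) := fun i =>
    (measurable_indicator_comp (h.measurable i) hG).sub_const _
  have hYi : iIndepFun Y P := h.indep.comp (fun _ x => G.indicator (fun _ => (1 : ℝ)) x - q)
    fun _ => (measurable_const.indicator hG).sub_const _
  have hmgf : ∀ t : ℝ, |t| ≤ 1 → mgf (∑ i ∈ Finset.range n, Y i) P t ≤ Real.exp (n * q * t ^ 2) := by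
    intro t ht
    rw [hYi.mgf_sum hYm]
    calc ∏ i ∈ Finset.range n, mgf (Y i) P t ≤ ∏ i ∈ Finset.range n, Real.exp (q * t ^ 2) := by
          refine Finset.prod_le_prod (fun _ _ => mgf_nonneg) fun i _ => ?_
          have hm : Measurable fun x => Real.exp (t * (G.indicator (fun _ => (1 : ℝ)) x - q)) :=
            Real.measurable_exp.comp
              (((measurable_const.indicator hG).sub_const _).const_mul t)
          rw [mgf, ← integral_map (h.measurable i).aemeasurable
            (f := fun x => Real.exp (t * (G.indicator (fun _ => (1 : ℝ)) x - q)))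
            hm.aestronglyMeasurable, h.law i]
          exact mgf_indicator_le μ hG ht
      _ = _ := by
          rw [Finset.prod_const, Finset.card_range, ← Real.exp_nat_mul]; ring_nf
  have hbound : ∀ i ω, |Y i ω| ≤ 1 + q := fun i ω => by
    have : |G.indicator (fun _ => (1 : ℝ)) (X i ω)| ≤ 1 := by
      by_cases hx : X i ω ∈ G <;> simp [hx]
    exact (abs_sub _ _).trans (add_le_add this (abs_of_nonneg hq0).le)
  have hSm : Measurable fun ω => ∑ i ∈ Finset.range n, Y i ω :=
    Finset.measurable_fun_sum _ fun i _ => hYm i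
  have hlint : ∀ t : ℝ, |t| ≤ 1 →
      ∫⁻ ω, ENNReal.ofReal (Real.exp (t * ∑ i ∈ Finset.range n, Y i ω)) ∂P ≤
        ENNReal.ofReal (Real.exp (n * q * t ^ 2)) := by
    intro t ht
    rw [← ofReal_integral_eq_lintegral_ofReal]
    · refine ENNReal.ofReal_le_ofReal ?_
      have := hmgf t ht
      simpa [mgf] using this
    · refine Integrable.of_bound (Real.measurable_exp.comp (hSm.const_mul t)).aestronglyMeasurable
        (Real.exp (n * (1 + q))) (ae_of_all _ fun ω => ?_)
      rw [Real.norm_eq_abs, Real.abs_exp]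
      refine Real.exp_le_exp.2 ((le_abs_self _).trans ?_)
      rw [abs_mul]
      calc |t| * |∑ i ∈ Finset.range n, Y i ω| ≤ 1 * ∑ i ∈ Finset.range n, |Y i ω| :=
            mul_le_mul ht (Finset.abs_sum_le_sum_abs _ _) (abs_nonneg _) zero_le_one
        _ ≤ 1 * ∑ i ∈ Finset.range n, (1 + q) := by gcongr; exact hbound _ _
        _ = _ := by simp [mul_add]
    · exact ae_of_all _ fun ω => (Real.exp_pos _).le
  set a := √(n * q) + 1 with ha
  have ha1 : 1 ≤ a := by rw [ha]; linarith [Real.sqrt_nonneg (n * q)]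
  have hnq : n * q * (1 / a) ^ 2 ≤ 1 := by
    rw [one_div, inv_pow, ← div_eq_mul_inv, div_le_one (by positivity)]
    calc n * q = √(n * q) ^ 2 := (Real.sq_sqrt (by positivity)).symm
      _ ≤ a ^ 2 := by gcongr; rw [ha]; linarith
  have ht1 : |1 / a| ≤ 1 := by
    rw [abs_of_pos (by positivity)]; exact (div_le_one (by positivity)).2 ha1
  refine ⟨hSm.norm, fun ω => abs_nonneg _, by positivity, ?_⟩
  calc ∫⁻ ω, ENNReal.ofReal (Real.exp (countDev X μ n G ω / a)) ∂P
      ≤ ∫⁻ ω, (ENNReal.ofReal (Real.exp (1 / a * ∑ i ∈ Finset.range n, Y i ω)) +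
          ENNReal.ofReal (Real.exp (-(1 / a) * ∑ i ∈ Finset.range n, Y i ω))) ∂P := by
        refine lintegral_mono fun ω => ?_
        show ENNReal.ofReal (Real.exp (|∑ i ∈ Finset.range n, Y i ω| / a)) ≤ _
        rcases abs_choice (∑ i ∈ Finset.range n, Y i ω) with h | h
        · rw [h]; refine le_trans (le_of_eq ?_) le_self_add; congr 2; ring
        · rw [h]; refine le_trans (le_of_eq ?_) le_add_self; congr 2; ring
    _ ≤ ENNReal.ofReal (Real.exp 1) + ENNReal.ofReal (Real.exp 1) := by
        have hm : Measurable fun ω =>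
            ENNReal.ofReal (Real.exp (1 / a * ∑ i ∈ Finset.range n, Y i ω)) :=
          (Real.measurable_exp.comp (hSm.const_mul _)).ennreal_ofReal
        rw [lintegral_add_left hm]
        refine add_le_add ((hlint _ ht1).trans ?_) ((hlint _ (by rwa [abs_neg])).trans ?_)
        · gcongr
        · rw [neg_sq]; gcongr
    _ ≤ 6 := by
        rw [← ENNReal.ofReal_add (Real.exp_pos _).le (Real.exp_pos _).le]
        refine ENNReal.ofReal_le_of_le_toReal ?_
        have := Real.exp_one_lt_d9
        norm_num
        linarith

end Counts

/-! ### Choice of depth and summation over levels -/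

section Numerics

lemma sum_two_rpow_le {γ : ℝ} (hγ : 0 < γ) (L : ℕ) :
    ∑ l ∈ Finset.range L, (2 : ℝ) ^ (γ * l) ≤ 2 ^ (γ * L) * (1 / (2 ^ γ - 1)) := by
  have h1 : (1 : ℝ) < 2 ^ γ := Real.one_lt_rpow (by norm_num) hγ
  have h2 : ∀ l : ℕ, (2 : ℝ) ^ (γ * l) = (2 ^ γ) ^ l := fun l => by
    rw [Real.rpow_mul (by norm_num), Real.rpow_natCast]
  simp_rw [h2]
  rw [geom_sum_eq h1.ne', mul_one_div]
  have : 0 < (2 : ℝ) ^ γ - 1 := by linarith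
  gcongr
  linarith

/-- Here u is the expected number of observations in a block: the tree stops when the number of
cells is comparable to 1 + u. -/
lemma exists_depth {α u : ℝ} (hα : 0 < α) (hu : 0 ≤ u) :
    ∃ L : ℕ, 1 + u ≤ 2 ^ (α * L) ∧ (2 : ℝ) ^ (α * L) ≤ 2 ^ α * (1 + u) := by
  have h1 : (0 : ℝ) < 1 + u := by linarith
  have h0 : 0 ≤ Real.logb 2 (1 + u) := Real.logb_nonneg (by norm_num) (by linarith)
  have h2 : (2 : ℝ) ^ Real.logb 2 (1 + u) = 1 + u := Real.rpow_logb (by norm_num) (by norm_num) h1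
  have h3 := Nat.le_ceil (Real.logb 2 (1 + u) / α)
  have h4 := (Nat.ceil_lt_add_one (div_nonneg h0 hα.le)).le
  refine ⟨⌈Real.logb 2 (1 + u) / α⌉₊, ?_, ?_⟩
  · conv_lhs => rw [← h2]
    refine Real.rpow_le_rpow_of_exponent_le (by norm_num) ?_
    rwa [div_le_iff₀ hα, mul_comm] at h3
  · conv_rhs => rw [← h2, ← Real.rpow_add (by norm_num)]
    refine Real.rpow_le_rpow_of_exponent_le (by norm_num) ?_
    calc α * (⌈Real.logb 2 (1 + u) / α⌉₊ : ℝ) ≤ α * (Real.logb 2 (1 + u) / α + 1) := by gcongr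
      _ = _ := by field_simp; ring

lemma scale_div_two_pow_rpow {x : ℝ} (hx : 0 ≤ x) (p : ℝ) (l : ℕ) :
    (x / 2 ^ l) ^ p = x ^ p * 2 ^ (-p * l) := by
  rw [Real.div_rpow hx (by positivity), ← Real.rpow_natCast, ← Real.rpow_mul (by norm_num),
    div_eq_mul_inv, ← Real.rpow_neg (by norm_num)]
  ring_nf

/-- For a block of radius ρ with cell counts N l, the two bounds concern the cost in the leaves and
the fluctuation scale of all levels. As α > 2p, the series with exponents α/2 - p and α - p both
grow and are dominated by their last term; u ≤ 2^(αL) then brings everything to ρ^p 2^((α-p)L). -/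
lemma exists_block_constant {p α β : ℝ} (hp : 1 ≤ p) (hα : 2 * p < α) (hβ : 0 < β) :
    ∃ C : ℝ, 0 < C ∧ ∀ (ρ u : ℝ) (L : ℕ) (N : ℕ → ℝ), 0 ≤ ρ → 0 ≤ u → 1 + u ≤ 2 ^ (α * L) →
      (∀ l, 0 ≤ N l) → (∀ l : ℕ, N l ≤ (β + 1) * 2 ^ (α * l)) →
      (8 * ρ / 2 ^ L) ^ p * u ≤ C * (ρ ^ p * 2 ^ ((α - p) * L)) ∧
      2 ^ (p - 1) * ρ ^ p * (√u + 1) +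
        ∑ l ∈ Finset.range L, (8 * ρ / 2 ^ l) ^ p * (√(N (l + 1) * u) + N (l + 1)) ≤
        C * (ρ ^ p * 2 ^ ((α - p) * L)) := by
  have hγ1 : 0 < α / 2 - p := by linarith
  have hγ2 : 0 < α - p := by linarith
  have k1 : 0 < 1 / ((2 : ℝ) ^ (α / 2 - p) - 1) :=
    one_div_pos.2 (sub_pos.2 (Real.one_lt_rpow (by norm_num) hγ1))
  have k2 : 0 < 1 / ((2 : ℝ) ^ (α - p) - 1) :=
    one_div_pos.2 (sub_pos.2 (Real.one_lt_rpow (by norm_num) hγ2))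
  set c1 := 1 / ((2 : ℝ) ^ (α / 2 - p) - 1)
  set c2 := 1 / ((2 : ℝ) ^ (α - p) - 1)
  refine ⟨8 ^ p + 2 ^ p + 8 ^ p * ((β + 1) * 2 ^ α) * (c1 + c2), by positivity, ?_⟩
  intro ρ u L N hρ hu huL hN0 hN
  set v : ℝ := 2 ^ ((α - p) * L) with hv
  have hv1 : 1 ≤ v := Real.one_le_rpow (by norm_num) (by positivity)
  have huL' : u ≤ 2 ^ (α * L) := by linarith
  have hsq : √u ≤ 2 ^ (α / 2 * L) := by
    rw [Real.sqrt_le_left (by positivity), ← Real.rpow_natCast, ← Real.rpow_mul (by norm_num)]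
    refine huL'.trans (le_of_eq ?_)
    congr 1; push_cast; ring
  have hsqv : (2 : ℝ) ^ (α / 2 * L) ≤ v := by
    refine Real.rpow_le_rpow_of_exponent_le (by norm_num) ?_
    gcongr; linarith
  have hleaf : (8 * ρ / 2 ^ L) ^ p * u ≤ 8 ^ p * (ρ ^ p * v) := by
    rw [scale_div_two_pow_rpow (by positivity), Real.mul_rpow (by norm_num) hρ]
    calc 8 ^ p * ρ ^ p * 2 ^ (-p * L) * u ≤ 8 ^ p * ρ ^ p * 2 ^ (-p * L) * 2 ^ (α * L) := by gcongr
      _ = 8 ^ p * (ρ ^ p * (2 ^ (-p * L) * 2 ^ (α * L))) := by ring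
      _ = _ := by
        rw [← Real.rpow_add (by norm_num), hv]; congr 3; ring
  have htop : 2 ^ (p - 1) * ρ ^ p * (√u + 1) ≤ 2 ^ p * (ρ ^ p * v) := by
    calc 2 ^ (p - 1) * ρ ^ p * (√u + 1) ≤ 2 ^ (p - 1) * ρ ^ p * (v + v) := by
          gcongr; exact hsq.trans hsqv
      _ = (2 ^ (p - 1) * 2 ^ (1 : ℝ)) * (ρ ^ p * v) := by rw [Real.rpow_one]; ring
      _ = _ := by rw [← Real.rpow_add (by norm_num)]; congr 2; ring
  have hlev : ∀ l : ℕ, (8 * ρ / 2 ^ l) ^ p * (√(N (l + 1) * u) + N (l + 1)) ≤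
      8 ^ p * ((β + 1) * 2 ^ α) * ρ ^ p *
        (2 ^ (α / 2 * L) * 2 ^ ((α / 2 - p) * l) + 2 ^ ((α - p) * l)) := by
    intro l
    have hNl : N (l + 1) ≤ (β + 1) * 2 ^ α * 2 ^ (α * l) := by
      refine (hN (l + 1)).trans (le_of_eq ?_)
      rw [mul_assoc, ← Real.rpow_add (by norm_num)]
      congr 2; push_cast; ring
    have hb1 : 1 ≤ (β + 1) * 2 ^ α :=
      one_le_mul_of_one_le_of_one_le (by linarith) (Real.one_le_rpow (by norm_num) (by linarith))
    -- The factor (β + 1) 2^α is at least 1, so it may replace its own square root.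
    have hsqN : √(N (l + 1) * u) ≤ (β + 1) * 2 ^ α * (2 ^ (α / 2 * l) * 2 ^ (α / 2 * L)) := by
      rw [Real.sqrt_mul (hN0 _), ← mul_assoc]
      refine mul_le_mul ?_ hsq (by positivity) (by positivity)
      rw [Real.sqrt_le_left (by positivity), mul_pow]
      refine hNl.trans ?_
      have : (2 : ℝ) ^ (α * l) = (2 ^ (α / 2 * l)) ^ 2 := by
        rw [← Real.rpow_natCast, ← Real.rpow_mul (by norm_num)]; congr 1; push_cast; ring
      rw [this]
      gcongr
      exact le_self_pow₀ hb1 (by norm_num)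
    rw [scale_div_two_pow_rpow (by positivity), Real.mul_rpow (by norm_num) hρ]
    calc 8 ^ p * ρ ^ p * 2 ^ (-p * l) * (√(N (l + 1) * u) + N (l + 1))
        ≤ 8 ^ p * ρ ^ p * 2 ^ (-p * l) * ((β + 1) * 2 ^ α * (2 ^ (α / 2 * l) * 2 ^ (α / 2 * L)) +
          (β + 1) * 2 ^ α * 2 ^ (α * l)) := by gcongr
      _ = 8 ^ p * ((β + 1) * 2 ^ α) * ρ ^ p * (2 ^ (α / 2 * L) * (2 ^ (-p * l) * 2 ^ (α / 2 * l)) +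
          (2 ^ (-p * l) * 2 ^ (α * l))) := by ring
      _ = _ := by
        have e1 : (2 : ℝ) ^ (-p * l) * 2 ^ (α / 2 * l) = 2 ^ ((α / 2 - p) * l) := by
          rw [← Real.rpow_add (by norm_num)]; congr 1; ring
        have e2 : (2 : ℝ) ^ (-p * l) * 2 ^ (α * l) = 2 ^ ((α - p) * l) := by
          rw [← Real.rpow_add (by norm_num)]; congr 1; ring
        rw [e1, e2]
  have hsum : ∑ l ∈ Finset.range L, (8 * ρ / 2 ^ l) ^ p * (√(N (l + 1) * u) + N (l + 1)) ≤
      8 ^ p * ((β + 1) * 2 ^ α) * (c1 + c2) * (ρ ^ p * v) := by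
    calc _ ≤ ∑ l ∈ Finset.range L, 8 ^ p * ((β + 1) * 2 ^ α) * ρ ^ p *
          (2 ^ (α / 2 * L) * 2 ^ ((α / 2 - p) * l) + 2 ^ ((α - p) * l)) :=
          Finset.sum_le_sum fun l _ => hlev l
      _ = 8 ^ p * ((β + 1) * 2 ^ α) * ρ ^ p * (2 ^ (α / 2 * L) *
          ∑ l ∈ Finset.range L, 2 ^ ((α / 2 - p) * l) +
          ∑ l ∈ Finset.range L, 2 ^ ((α - p) * l)) := by
        rw [← Finset.mul_sum, Finset.sum_add_distrib, ← Finset.mul_sum]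
      _ ≤ 8 ^ p * ((β + 1) * 2 ^ α) * ρ ^ p * (2 ^ (α / 2 * L) *
          (2 ^ ((α / 2 - p) * L) * c1) + v * c2) := by
        gcongr
        · exact sum_two_rpow_le hγ1 L
        · exact sum_two_rpow_le hγ2 L
      _ = 8 ^ p * ((β + 1) * 2 ^ α) * ρ ^ p * ((2 ^ (α / 2 * L) *
          2 ^ ((α / 2 - p) * L)) * c1 + v * c2) := by ring
      _ = _ := by
        have : (2 : ℝ) ^ (α / 2 * L) * 2 ^ ((α / 2 - p) * L) = v := by
          rw [← Real.rpow_add (by norm_num), hv]; congr 1; ring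
        rw [this]; ring
  have hpos : 0 ≤ ρ ^ p * v := by positivity
  refine ⟨hleaf.trans ?_, (add_le_add htop hsum).trans ?_⟩
  · gcongr
    have : 0 ≤ 8 ^ p * ((β + 1) * 2 ^ α) * (c1 + c2) := by positivity
    have : (0:ℝ) ≤ 2 ^ p := by positivity
    linarith
  · rw [← add_mul]
    gcongr
    have : (0:ℝ) ≤ 8 ^ p := by positivity
    linarith

end Numerics

/-! ### The main bound inside a ball -/

section MainBound

variable {E Ω : Type*}

/-- The scales √(n μ(cell)) + 1 add up, and Cauchy–Schwarz applies because the cells partition B. -/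
lemma IsIIDSample.subExp_sum_countDev [MeasurableSpace Ω] [MeasurableSpace E] [MeasurableSingletonClass E]
    {X : ℕ → Ω → E} {μ : Measure E} {P : Measure Ω} [IsProbabilityMeasure P]
    [IsProbabilityMeasure μ] (h : IsIIDSample X μ P) (n : ℕ) {B : Set E} (hB : MeasurableSet B)
    {g : E → E} (hg : Measurable g) {C : Finset E} (hC : ∀ x, g x ∈ C) (hne : C.Nonempty) :
    SubExp P (fun ω => ∑ c ∈ C, countDev X μ n (g ⁻¹' {c} ∩ B) ω)
      (√(C.card * (n * μ.real B)) + C.card) := by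
  refine (SubExp.sum hne fun c _ =>
    h.subExp_countDev n ((hg (measurableSet_singleton c)).inter hB)).mono ?_
  rw [Finset.sum_add_distrib, Finset.sum_const, nsmul_eq_mul, mul_one]
  gcongr
  refine Real.le_sqrt_of_sq_le ((sq_sum_le_card_mul_sum_sq).trans (le_of_eq ?_))
  congr 1
  simp_rw [Real.sq_sqrt (mul_nonneg (Nat.cast_nonneg n) measureReal_nonneg)]
  rw [← Finset.mul_sum]
  congr 1
  have := sum_measure_fiber (μ.restrict B) hg hC
  rw [Measure.restrict_apply_univ] at this
  rw [measureReal_def, ← this, ENNReal.toReal_sum fun c _ => measure_ne_top _ _]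
  refine Finset.sum_congr rfl fun c _ => ?_
  rw [Measure.restrict_apply (hg (measurableSet_singleton c)), measureReal_def]

lemma lintegral_empiricalMeasure [MeasurableSpace E] (X : ℕ → Ω → E) {n : ℕ} (hn : n ≠ 0) (ω : Ω)
    {F : E → ℝ≥0∞} (hF : Measurable F) :
    (n : ℝ≥0∞) * ∫⁻ x, F x ∂(empiricalMeasure X n ω) = ∑ i ∈ Finset.range n, F (X i ω) := by
  rw [empiricalMeasure, lintegral_smul_measure, smul_eq_mul, ← mul_assoc,
    ENNReal.mul_inv_cancel (by simpa using hn) (ENNReal.natCast_ne_top n), one_mul,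
    lintegral_finsetSum_measure]
  exact Finset.sum_congr rfl fun i _ => lintegral_dirac' _ hF

lemma isProbabilityMeasure_empiricalMeasure [MeasurableSpace E] (X : ℕ → Ω → E) {n : ℕ}
    (hn : n ≠ 0) (ω : Ω) : IsProbabilityMeasure (empiricalMeasure X n ω) := by
  refine ⟨?_⟩
  rw [empiricalMeasure, Measure.smul_apply, Measure.finsetSum_apply]
  simp [ENNReal.inv_mul_cancel (a := (n : ℝ≥0∞)) (by simpa using hn) (ENNReal.natCast_ne_top n)]

lemma IsIIDSample.isProbabilityMeasure [MeasurableSpace Ω] [MeasurableSpace E] {X : ℕ → Ω → E} {μ : Measure E}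
    {P : Measure Ω} [IsProbabilityMeasure P] (h : IsIIDSample X μ P) : IsProbabilityMeasure μ := by
  rw [← h.law 0]
  exact Measure.isProbabilityMeasure_map (h.measurable 0).aemeasurable

lemma IsIIDSample.ae_ae_empiricalMeasure [MeasurableSpace Ω] [MeasurableSpace E] [MeasurableSingletonClass E]
    {X : ℕ → Ω → E} {μ : Measure E} {P : Measure Ω} (h : IsIIDSample X μ P) {S : Set E}
    (hS : ∀ᵐ z ∂μ, z ∈ S) (n : ℕ) : ∀ᵐ ω ∂P, ∀ᵐ x ∂(empiricalMeasure X n ω), x ∈ S := by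
  have h1 : ∀ i, ∀ᵐ ω ∂P, X i ω ∈ S := fun i =>
    ae_of_ae_map (h.measurable i).aemeasurable (by rw [h.law i]; exact hS)
  filter_upwards [ae_all_iff.2 h1] with ω hω
  rw [ae_iff, empiricalMeasure, Measure.smul_apply, Measure.finsetSum_apply, smul_eq_mul]
  rw [Finset.sum_eq_zero, mul_zero]
  intro i _
  rw [← ae_iff, ae_dirac_eq]
  exact hω i

lemma natCast_mul_ofReal_rpow_mul_excess [MeasurableSpace E] (X : ℕ → Ω → E) (μ : Measure E)
    [IsProbabilityMeasure μ] {n : ℕ} (hn : n ≠ 0) (ω : Ω) {G : Set E} (hG : MeasurableSet G) {x p : ℝ}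
    (hx : 0 ≤ x) (hp : 0 ≤ p) :
    (n : ℝ≥0∞) * (ENNReal.ofReal x ^ p * excess μ (empiricalMeasure X n ω) G) =
      ENNReal.ofReal (x ^ p * countDev X μ n G ω) := by
  rw [mul_left_comm, natCast_mul_excess X μ hn ω hG, ENNReal.ofReal_rpow_of_nonneg hx hp,
    ENNReal.ofReal_mul (by positivity)]

lemma sum_mul_add_mul_mul {ι : Type*} (s : Finset ι) (a b : ι → ℝ≥0∞) (x y : ℝ≥0∞) :
    ∑ k ∈ s, (x * a k + y * (x * b k)) = x * ∑ k ∈ s, a k + y * (x * ∑ k ∈ s, b k) := by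
  rw [Finset.sum_add_distrib, Finset.mul_sum, Finset.mul_sum, Finset.mul_sum]

lemma sum_dyadic_rpow_le {R p : ℝ} (hR : 0 ≤ R) (hp : 1 ≤ p) (K : ℕ) :
    ∑ k ∈ Finset.range K, (R / 2 ^ k) ^ p ≤ 2 * R ^ p := by
  have h1 : ∀ k : ℕ, (R / 2 ^ k) ^ p ≤ R ^ p * (1 / 2) ^ k := fun k => by
    rw [scale_div_two_pow_rpow hR, one_div, inv_pow, ← Real.rpow_natCast, ← Real.rpow_neg (by norm_num)]
    gcongr
    · norm_num
    · nlinarith [(Nat.cast_nonneg k : (0:ℝ) ≤ k)]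
  calc _ ≤ ∑ k ∈ Finset.range K, R ^ p * (1 / 2) ^ k := Finset.sum_le_sum fun k _ => h1 k
    _ = R ^ p * ∑ k ∈ Finset.range K, (1 / 2 : ℝ) ^ k := by rw [Finset.mul_sum]
    _ ≤ R ^ p * 2 := by
        gcongr
        exact sum_geometric_two_le K
    _ = _ := mul_comm _ _

/-- The main bound: up to the contribution of the observations outside of a ball, `n W_p^p(μ, L_n)`
has exponential moments at an explicit scale. -/
lemma exists_subExp_bound {p α β : ℝ} (hp : 1 ≤ p) (hα : 2 * p < α) (hβ : 0 < β) :
    ∃ c : ℝ, 0 < c ∧ ∀ (E : Type u) [MetricSpace E] [PolishSpace E] [MeasurableSpace E]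
      [BorelSpace E] (Ω : Type v) [MeasurableSpace Ω] (P : Measure Ω) [IsProbabilityMeasure P]
      (X : ℕ → Ω → E) (μ : Measure E) (S : Set E) (x₀ : E), IsIIDSample X μ P →
      (∀ᵐ z ∂μ, z ∈ S) → HasCoveringDim S x₀ α β → ∀ n : ℕ, n ≠ 0 → ∀ R : ℝ, 0 < R → ∀ B : ℝ,
      R ^ p ≤ B → (∀ K : ℕ, ∑ k ∈ Finset.range K, (R / 2 ^ k) ^ p *
        (n * (tail μ x₀ (R / 2 ^ (k + 1))).toReal) ^ ((α - p) / α) ≤ B) →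
      ∃ T : Ω → ℝ, SubExp P T (c * B) ∧ ∀ᵐ ω ∂P,
        (n : ℝ≥0∞) * wassersteinPow p μ (empiricalMeasure X n ω) ≤
          ENNReal.ofReal (c * B) + ENNReal.ofReal (T ω) + 2 ^ (p - 1) *
            (n * ∫⁻ x in (Metric.closedBall x₀ R)ᶜ, edist x x₀ ^ p ∂μ +
              ∑ i ∈ Finset.range n,
                (Metric.closedBall x₀ R)ᶜ.indicator (fun x => edist x x₀ ^ p) (X i ω)) := by
  obtain ⟨C₀, hC₀, hblock⟩ := exists_block_constant hp hα hβ
  have hα0 : 0 < α := by linarith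
  have hp0 : 0 ≤ p := by linarith
  -- The first summand pays for the annuli, the second for the innermost ball.
  refine ⟨C₀ * (2 ^ (α - p) * 3) + 2 ^ p, by positivity, ?_⟩
  intro E _ _ _ _ Ω _ P _ X μ S x₀ hX hS hcov n hn R hR B hRB hB
  have := hX.isProbabilityMeasure
  have hB0 : 0 < B := (Real.rpow_pos_of_pos hR p).trans_le hRB
  set A := annulus x₀ R with hA
  have hAm : ∀ k, MeasurableSet (A k) := measurableSet_annulus x₀ R
  set u : ℕ → ℝ := fun k => n * μ.real (A k) with hu
  have hu0 : ∀ k, 0 ≤ u k := fun k => by positivity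
  choose L hL1 hL2 using fun k => exists_depth hα0 (hu0 k)
  -- With n annuli the innermost ball has radius R/2^n, and its cost after multiplication by n is
  -- harmless since n ≤ 2^(pn).
  obtain ⟨f, C, hf, hC, hcard, hW⟩ := hcov.wassersteinPow_le hβ hα0.le hR hp n L
  set r : ℕ → ℝ := fun k => R / 2 ^ k with hr
  have hr0 : ∀ k, 0 < r k := fun k => by positivity
  set V : ℕ → ℝ := fun k => r k ^ p * 2 ^ ((α - p) * L k) with hV
  have hnum := fun k => hblock (r k) (u k) (L k) (fun l => ((C k l).card : ℝ)) (hr0 k).le (hu0 k)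
    (hL1 k) (fun l => Nat.cast_nonneg _) (hcard k)
  -- The choice of depth gives 2^((α-p)L) ≲ (1 + u)^s ≤ 1 + u^s with s = (α - p)/α. The terms 1 sum
  -- to at most 2 R^p ≤ 2B, the terms u^s to at most B.
  have hVsum : ∑ k ∈ Finset.range n, V k ≤ 2 ^ (α - p) * 3 * B := by
    have h1 : ∀ k, V k ≤ 2 ^ (α - p) * (r k ^ p + r k ^ p *
        (n * (tail μ x₀ (R / 2 ^ (k + 1))).toReal) ^ ((α - p) / α)) := by
      intro k
      have hs0 : 0 ≤ (α - p) / α := div_nonneg (by linarith) hα0.le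
      have hs1 : (α - p) / α ≤ 1 := (div_le_one hα0).2 (by linarith)
      have hut : u k ≤ n * (tail μ x₀ (R / 2 ^ (k + 1))).toReal := by
        refine mul_le_mul_of_nonneg_left ?_ (Nat.cast_nonneg n)
        exact ENNReal.toReal_mono (measure_ne_top _ _) (measure_mono fun x hx => hx.2)
      have h2 : (2 : ℝ) ^ ((α - p) * L k) ≤ 2 ^ (α - p) * (1 + u k ^ ((α - p) / α)) := by
        calc (2 : ℝ) ^ ((α - p) * L k) = (2 ^ (α * L k)) ^ ((α - p) / α) := by
              rw [← Real.rpow_mul (by norm_num)]; congr 1; field_simp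
          _ ≤ (2 ^ α * (1 + u k)) ^ ((α - p) / α) := by gcongr; exact hL2 k
          _ = 2 ^ (α - p) * (1 + u k) ^ ((α - p) / α) := by
              rw [Real.mul_rpow (by positivity) (by linarith [hu0 k]), ← Real.rpow_mul (by norm_num)]
              congr 2; field_simp
          _ ≤ _ := by
              gcongr
              have := Real.rpow_add_le_add_rpow zero_le_one (hu0 k) hs0 hs1
              rwa [Real.one_rpow] at this
      calc V k ≤ r k ^ p * (2 ^ (α - p) * (1 + (n * (tail μ x₀ (R / 2 ^ (k + 1))).toReal) ^ ((α - p) / α))) := by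
            refine mul_le_mul_of_nonneg_left (h2.trans ?_) (by have := hr0 k; positivity)
            gcongr
        _ = _ := by ring
    calc _ ≤ ∑ k ∈ Finset.range n, 2 ^ (α - p) * (r k ^ p + r k ^ p *
        (n * (tail μ x₀ (R / 2 ^ (k + 1))).toReal) ^ ((α - p) / α)) :=
          Finset.sum_le_sum fun k _ => h1 k
      _ = 2 ^ (α - p) * (∑ k ∈ Finset.range n, r k ^ p + ∑ k ∈ Finset.range n, r k ^ p *
        (n * (tail μ x₀ (R / 2 ^ (k + 1))).toReal) ^ ((α - p) / α)) := by
          rw [← Finset.mul_sum, Finset.sum_add_distrib]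
      _ ≤ 2 ^ (α - p) * (2 * B + B) := by
          gcongr
          · exact (sum_dyadic_rpow_le hR.le hp n).trans (by gcongr)
          · exact hB n
      _ = _ := by ring
  -- All random costs of the k-th block: the imbalance of the annulus, which leaves the block, and
  -- the moves between levels of its tree.
  let t : ℕ → Ω → ℝ := fun k ω => 2 ^ (p - 1) * r k ^ p * countDev X μ n (A k) ω +
    ∑ l ∈ Finset.range (L k), (8 * r k / 2 ^ l) ^ p *
      ∑ c ∈ C k (l + 1), countDev X μ n (f k (l + 1) ⁻¹' {c} ∩ A k) ω
  have ht : ∀ k ∈ Finset.range n, SubExp P (t k) (C₀ * V k) := by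
    intro k _
    have hrk := hr0 k
    refine SubExp.mono (SubExp.add_sum
      ((hX.subExp_countDev n (hAm k)).const_mul (by positivity)) _ fun l _ =>
      (hX.subExp_sum_countDev n (hAm k) (hf k (l + 1)) (hC k (l + 1))
        ⟨_, hC k (l + 1) x₀⟩).const_mul (by positivity)) (hnum k).2
  have hT := SubExp.sum (Finset.nonempty_range_iff.2 hn) ht
  refine ⟨fun ω => ∑ k ∈ Finset.range n, t k ω, hT.mono ?_, ?_⟩
  · rw [← Finset.mul_sum, add_mul, mul_assoc]
    have : (0:ℝ) ≤ 2 ^ p * B := by positivity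
    have := mul_le_mul_of_nonneg_left hVsum hC₀.le
    linarith
  filter_upwards [hX.ae_ae_empiricalMeasure hS n] with ω hω
  have hprob := isProbabilityMeasure_empiricalMeasure X hn ω
  set ν := empiricalMeasure X n ω with hν
  have hWω := mul_le_mul_right (hW μ ν hS hω) (n : ℝ≥0∞)
  have htwo : (2 : ℝ≥0∞) ^ (p - 1) = ENNReal.ofReal (2 ^ (p - 1)) := by
    rw [← ENNReal.ofReal_rpow_of_pos (by norm_num)]; simp
  have hlast : (n : ℝ≥0∞) * ∫⁻ x in (Metric.closedBall x₀ R)ᶜ, edist x x₀ ^ p ∂ν =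
      ∑ i ∈ Finset.range n,
        (Metric.closedBall x₀ R)ᶜ.indicator (fun x => edist x x₀ ^ p) (X i ω) := by
    have hmc : MeasurableSet (Metric.closedBall x₀ R)ᶜ :=
      Metric.isClosed_closedBall.measurableSet.compl
    rw [← lintegral_indicator hmc]
    exact lintegral_empiricalMeasure X hn ω
      (((measurable_id.edist measurable_const).pow_const p).indicator hmc)
  have hdet : ∑ k ∈ Finset.range n, (8 * r k / 2 ^ L k) ^ p * u k + 2 ^ (p - 1) * (2 * (n * (R / 2 ^ n) ^ p)) ≤
      (C₀ * (2 ^ (α - p) * 3) + 2 ^ p) * B := by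
    have h1 : ∑ k ∈ Finset.range n, (8 * r k / 2 ^ L k) ^ p * u k ≤ C₀ * (2 ^ (α - p) * 3) * B := by
      refine (Finset.sum_le_sum fun k _ => (hnum k).1).trans ?_
      rw [← Finset.mul_sum, mul_assoc]
      exact mul_le_mul_of_nonneg_left hVsum hC₀.le
    have h2 : n * (R / 2 ^ n) ^ p ≤ B := by
      refine le_trans ?_ hRB
      rw [scale_div_two_pow_rpow hR.le, mul_left_comm]
      refine mul_le_of_le_one_right (by positivity) ?_
      have : (n : ℝ) ≤ 2 ^ (p * n) := by
        calc (n : ℝ) ≤ 2 ^ n := by exact_mod_cast Nat.lt_two_pow_self.le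
          _ = 2 ^ (n : ℝ) := (Real.rpow_natCast _ _).symm
          _ ≤ 2 ^ (p * n) := by
            refine Real.rpow_le_rpow_of_exponent_le (by norm_num) ?_
            nlinarith [(Nat.cast_nonneg n : (0:ℝ) ≤ n)]
      rw [neg_mul, Real.rpow_neg (by norm_num), ← div_eq_mul_inv]
      exact (div_le_one (by positivity)).2 this
    have h3 : (2 : ℝ) ^ (p - 1) * (2 * (n * (R / 2 ^ n) ^ p)) ≤ 2 ^ p * B := by
      calc (2 : ℝ) ^ (p - 1) * (2 * (n * (R / 2 ^ n) ^ p)) ≤ 2 ^ (p - 1) * (2 * B) := by gcongr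
        _ = (2 ^ (p - 1) * 2 ^ (1 : ℝ)) * B := by rw [Real.rpow_one]; ring
        _ = _ := by rw [← Real.rpow_add (by norm_num)]; congr 2; ring
    linarith
  have hnμ : ∀ k, (n : ℝ≥0∞) * μ (A k) = ENNReal.ofReal (u k) := fun k => by
    rw [hu, ENNReal.ofReal_mul (by positivity), ENNReal.ofReal_natCast, ofReal_measureReal]
  have hcD : ∀ G ω, 0 ≤ countDev X μ n G ω := fun G ω => abs_nonneg _
  have hterm : ∀ k, (n : ℝ≥0∞) * (ENNReal.ofReal (8 * r k / 2 ^ (L k)) ^ p * μ (A k) +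
        ∑ l ∈ Finset.range (L k), ENNReal.ofReal (8 * r k / 2 ^ l) ^ p *
            ∑ c ∈ C k (l + 1), excess μ ν (f k (l + 1) ⁻¹' {c} ∩ A k)) +
      2 ^ (p - 1) * (n * (ENNReal.ofReal (r k) ^ p * excess μ ν (A k))) =
      ENNReal.ofReal ((8 * r k / 2 ^ L k) ^ p * u k) + ENNReal.ofReal (t k ω) := by
    intro k
    have hrk := hr0 k
    rw [natCast_mul_ofReal_rpow_mul_excess X μ hn ω (hAm k) hrk.le hp0, mul_add,
      mul_left_comm (n : ℝ≥0∞), hnμ, ENNReal.ofReal_rpow_of_nonneg (by positivity) hp0,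
      ← ENNReal.ofReal_mul (by positivity), Finset.mul_sum, htwo,
      ← ENNReal.ofReal_mul (by positivity), add_assoc]
    congr 1
    rw [ENNReal.ofReal_add (by have := hcD (A k) ω; positivity)
      (Finset.sum_nonneg fun l _ => mul_nonneg (by positivity)
        (Finset.sum_nonneg fun c _ => hcD _ _)), add_comm,
      ENNReal.ofReal_sum_of_nonneg fun l _ => mul_nonneg (by positivity)
        (Finset.sum_nonneg fun c _ => hcD _ _), mul_assoc]
    congr 1
    refine Finset.sum_congr rfl fun l _ => ?_
    rw [mul_left_comm, Finset.mul_sum, ENNReal.ofReal_rpow_of_nonneg (by positivity) hp0,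
      ENNReal.ofReal_mul (by positivity), ENNReal.ofReal_sum_of_nonneg fun c _ => hcD _ _]
    congr 1
    refine Finset.sum_congr rfl fun c _ => ?_
    exact natCast_mul_excess X μ hn ω ((hf k (l + 1) (measurableSet_singleton c)).inter (hAm k))
  have hinner : (n : ℝ≥0∞) * ENNReal.ofReal (R / 2 ^ n) ^ p = ENNReal.ofReal (n * (R / 2 ^ n) ^ p) := by
    rw [ENNReal.ofReal_mul (by positivity), ENNReal.ofReal_natCast,
      ENNReal.ofReal_rpow_of_nonneg (by positivity) hp0]
  have ht0 : ∀ k ∈ Finset.range n, 0 ≤ t k ω := fun k hk => (ht k hk).nonneg ω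
  calc (n : ℝ≥0∞) * wassersteinPow p μ ν ≤ _ := hWω
    _ = ∑ k ∈ Finset.range n, ((n : ℝ≥0∞) * (ENNReal.ofReal (8 * r k / 2 ^ (L k)) ^ p * μ (A k) +
        ∑ l ∈ Finset.range (L k), ENNReal.ofReal (8 * r k / 2 ^ l) ^ p *
            ∑ c ∈ C k (l + 1), excess μ ν (f k (l + 1) ⁻¹' {c} ∩ A k)) +
        2 ^ (p - 1) * (n * (ENNReal.ofReal (r k) ^ p * excess μ ν (A k)))) +
        2 ^ (p - 1) * (2 * (n * ENNReal.ofReal (R / 2 ^ n) ^ p)) +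
        2 ^ (p - 1) * (n * ∫⁻ x in (Metric.closedBall x₀ R)ᶜ, edist x x₀ ^ p ∂μ +
          n * ∫⁻ x in (Metric.closedBall x₀ R)ᶜ, edist x x₀ ^ p ∂ν) := by
        rw [sum_mul_add_mul_mul]
        ring
    _ = ∑ k ∈ Finset.range n, (ENNReal.ofReal ((8 * r k / 2 ^ L k) ^ p * u k) + ENNReal.ofReal (t k ω)) +
        2 ^ (p - 1) * (2 * (n * ENNReal.ofReal (R / 2 ^ n) ^ p)) + _ := by
        rw [Finset.sum_congr rfl fun k _ => hterm k]
    _ = ENNReal.ofReal (∑ k ∈ Finset.range n, (8 * r k / 2 ^ L k) ^ p * u k +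
          2 ^ (p - 1) * (2 * (n * (R / 2 ^ n) ^ p))) + ENNReal.ofReal (∑ k ∈ Finset.range n, t k ω) + _ := by
        rw [Finset.sum_add_distrib, ← ENNReal.ofReal_sum_of_nonneg ht0,
          ← ENNReal.ofReal_sum_of_nonneg fun k _ => (by
            have := hr0 k; have := hu0 k; positivity), hinner, htwo,
          add_right_comm (ENNReal.ofReal _)]
        congr 2
        rw [ENNReal.ofReal_add (Finset.sum_nonneg fun k _ => (by
            have := hr0 k; have := hu0 k; positivity)) (by positivity),
          ENNReal.ofReal_mul (by positivity), ENNReal.ofReal_mul (by positivity)]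
        simp
    _ ≤ _ := by
        rw [hlast]
        gcongr
        exact htwo.ge

end MainBound

/-! ### Moments and dyadic sums controlled by the tail -/

section Moments

variable {E : Type*} [MetricSpace E] [MeasurableSpace E] {μ : Measure E} {x₀ : E}

lemma tail_le_of_weakMoment_le {q K : ℝ} (h : weakMoment μ x₀ q ≤ ENNReal.ofReal K) {t : ℝ}
    (ht : 0 < t) : tail μ x₀ t ≤ ENNReal.ofReal (K * t ^ (-q)) := by
  have h1 : ENNReal.ofReal t ^ q * tail μ x₀ t ≤ ENNReal.ofReal K := by
    refine le_trans ?_ h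
    have := le_iSup (fun t : ℝ≥0 => (t : ℝ≥0∞) ^ q * tail μ x₀ (t : ℝ)) t.toNNReal
    rwa [Real.coe_toNNReal _ ht.le] at this
  have h2 : ENNReal.ofReal (t ^ (-q)) * ENNReal.ofReal t ^ q = 1 := by
    rw [ENNReal.ofReal_rpow_of_pos ht, ← ENNReal.ofReal_mul (by positivity), ← Real.rpow_add ht]
    simp
  calc tail μ x₀ t = ENNReal.ofReal (t ^ (-q)) * (ENNReal.ofReal t ^ q * tail μ x₀ t) := by
        rw [← mul_assoc, h2, one_mul]
    _ ≤ ENNReal.ofReal (t ^ (-q)) * ENNReal.ofReal K := by gcongr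
    _ = _ := by rw [mul_comm, ENNReal.ofReal_mul' (by positivity)]

lemma tail_anti {s t : ℝ} (h : s ≤ t) : tail μ x₀ t ≤ tail μ x₀ s :=
  measure_mono (compl_subset_compl.2 (Metric.closedBall_subset_closedBall h))

lemma tsum_ofReal_geometric {c x : ℝ} (hc : 0 ≤ c) (hx : 0 ≤ x) (hx1 : x < 1) :
    ∑' j : ℕ, ENNReal.ofReal (c * x ^ j) = ENNReal.ofReal (c * (1 - x)⁻¹) := by
  rw [← ENNReal.ofReal_tsum_of_nonneg (fun j => by positivity)
    ((summable_geometric_of_lt_one hx hx1).mul_left c), tsum_mul_left,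
    tsum_geometric_of_lt_one hx hx1]

/-- Moments outside of a ball under a polynomial tail bound. -/
lemma lintegral_compl_closedBall_le [BorelSpace E] {p q K R : ℝ} (hp : 0 ≤ p) (hq : p < q)
    (hK : 0 ≤ K) (hR : 0 < R) (h : ∀ t : ℝ, 0 < t → tail μ x₀ t ≤ ENNReal.ofReal (K * t ^ (-q))) :
    ∫⁻ x in (Metric.closedBall x₀ R)ᶜ, edist x x₀ ^ p ∂μ ≤
      ENNReal.ofReal (2 ^ p * (1 - 2 ^ (p - q))⁻¹ * (K * R ^ (p - q))) := by
  have hm : ∀ t : ℝ, MeasurableSet (Metric.closedBall x₀ t)ᶜ := fun t =>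
    Metric.isClosed_closedBall.measurableSet.compl
  have hlt : (2 : ℝ) ^ (p - q) < 1 := Real.rpow_lt_one_of_one_lt_of_neg (by norm_num) (by linarith)
  -- A point of the shell (R 2^n, R 2^(n+1)] is paid for by the n-th term.
  have hpt : ∀ x, (Metric.closedBall x₀ R)ᶜ.indicator (fun x => edist x x₀ ^ p) x ≤
      ∑' j : ℕ, (Metric.closedBall x₀ (R * 2 ^ j))ᶜ.indicator
        (fun _ => ENNReal.ofReal ((R * 2 ^ (j + 1)) ^ p)) x := by
    intro x
    by_cases hx : x ∈ (Metric.closedBall x₀ R)ᶜ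
    · rw [indicator_of_mem hx]
      have hd : R < dist x x₀ := by simpa using hx
      have h1 : 1 < dist x x₀ / R := (one_lt_div hR).2 hd
      obtain ⟨n, hn1, hn2⟩ := exists_mem_Ioc_zpow (zero_lt_one.trans h1) (one_lt_two : (1 : ℝ) < 2)
      have hn0 : 0 ≤ n := by
        by_contra hcon
        have : (2 : ℝ) ^ (n + 1) ≤ 1 := zpow_le_one_of_nonpos₀ (by norm_num) (by omega)
        linarith
      lift n to ℕ using hn0
      have hn2' : dist x x₀ / R ≤ 2 ^ (n + 1) := by exact_mod_cast hn2
      have hn1' : 2 ^ n < dist x x₀ / R := by exact_mod_cast hn1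
      rw [lt_div_iff₀ hR, mul_comm] at hn1'
      rw [div_le_iff₀ hR, mul_comm] at hn2'
      refine le_trans ?_ (ENNReal.le_tsum n)
      rw [indicator_of_mem (by simpa using hn1'), edist_dist,
        ENNReal.ofReal_rpow_of_nonneg dist_nonneg hp]
      gcongr
    · rw [indicator_of_notMem hx]; exact bot_le
  rw [← lintegral_indicator (hm R)]
  refine (lintegral_mono hpt).trans ?_
  rw [lintegral_tsum fun j => (measurable_const.indicator (hm _)).aemeasurable]
  simp_rw [lintegral_indicator_const (hm _)]
  calc ∑' j : ℕ, ENNReal.ofReal ((R * 2 ^ (j + 1)) ^ p) * μ (Metric.closedBall x₀ (R * 2 ^ j))ᶜ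
      ≤ ∑' j : ℕ, ENNReal.ofReal (2 ^ p * (K * R ^ (p - q)) * (2 ^ (p - q)) ^ j) := by
        refine ENNReal.tsum_le_tsum fun j => ?_
        refine (mul_le_mul_right (h (R * 2 ^ j) (by positivity)) _).trans (le_of_eq ?_)
        rw [← ENNReal.ofReal_mul (by positivity)]
        congr 1
        have e1 : (R * 2 ^ (j + 1)) ^ p = 2 ^ p * (R * 2 ^ j) ^ p := by
          rw [← Real.mul_rpow (by norm_num) (by positivity)]; congr 1; ring
        have e2 : (R * 2 ^ j) ^ p * (R * 2 ^ j) ^ (-q) = R ^ (p - q) * (2 ^ (p - q)) ^ j := by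
          rw [← Real.rpow_add (by positivity), ← sub_eq_add_neg, Real.mul_rpow hR.le (by positivity),
            ← Real.rpow_natCast, ← Real.rpow_natCast, ← Real.rpow_mul (by norm_num),
            ← Real.rpow_mul (by norm_num), mul_comm (j : ℝ)]
        rw [e1]
        linear_combination 2 ^ p * K * e2
    _ = _ := by
        rw [tsum_ofReal_geometric (by positivity) (by positivity) hlt]
        congr 1; ring

/-- Moments inside a ball under a polynomial tail bound. -/
lemma lintegral_closedBall_le [BorelSpace E] {p q K R : ℝ} (hp : 0 < p) (hq : q < p)
    (hK : 0 ≤ K) (hR : 0 < R) (h : ∀ t : ℝ, 0 < t → tail μ x₀ t ≤ ENNReal.ofReal (K * t ^ (-q))) :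
    ∫⁻ x in Metric.closedBall x₀ R, edist x x₀ ^ p ∂μ ≤
      ENNReal.ofReal (2 ^ q * (1 - 2 ^ (q - p))⁻¹ * (K * R ^ (p - q))) := by
  have hm : ∀ t : ℝ, MeasurableSet (Metric.closedBall x₀ t)ᶜ := fun t =>
    Metric.isClosed_closedBall.measurableSet.compl
  have hlt : (2 : ℝ) ^ (q - p) < 1 := Real.rpow_lt_one_of_one_lt_of_neg (by norm_num) (by linarith)
  have hpt : ∀ x, (Metric.closedBall x₀ R).indicator (fun x => edist x x₀ ^ p) x ≤
      ∑' j : ℕ, (Metric.closedBall x₀ (R / 2 ^ (j + 1)))ᶜ.indicator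
        (fun _ => ENNReal.ofReal ((R / 2 ^ j) ^ p)) x := by
    intro x
    by_cases hx : x ∈ Metric.closedBall x₀ R
    · rw [indicator_of_mem hx]
      have hd : dist x x₀ ≤ R := hx
      rcases (dist_nonneg (x := x) (y := x₀)).eq_or_lt with h0 | h0
      · rw [edist_dist, ← h0, ENNReal.ofReal_zero, ENNReal.zero_rpow_of_pos hp]; exact bot_le
      have h1 : 1 ≤ R / dist x x₀ := (one_le_div h0).2 hd
      obtain ⟨n, hn1, hn2⟩ := exists_nat_pow_near h1 (one_lt_two : (1 : ℝ) < 2)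
      rw [le_div_iff₀ h0] at hn1
      rw [div_lt_iff₀ h0] at hn2
      refine le_trans ?_ (ENNReal.le_tsum n)
      have hmem : x ∈ (Metric.closedBall x₀ (R / 2 ^ (n + 1)))ᶜ := by
        simp only [mem_compl_iff, Metric.mem_closedBall, not_le]
        rw [div_lt_iff₀ (by positivity)]; linarith
      rw [indicator_of_mem hmem, edist_dist, ENNReal.ofReal_rpow_of_nonneg dist_nonneg hp.le]
      gcongr
      rw [le_div_iff₀ (by positivity)]; linarith
    · rw [indicator_of_notMem hx]; exact bot_le
  rw [← lintegral_indicator Metric.isClosed_closedBall.measurableSet]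
  refine (lintegral_mono hpt).trans ?_
  rw [lintegral_tsum fun j => (measurable_const.indicator (hm _)).aemeasurable]
  simp_rw [lintegral_indicator_const (hm _)]
  calc ∑' j : ℕ, ENNReal.ofReal ((R / 2 ^ j) ^ p) * μ (Metric.closedBall x₀ (R / 2 ^ (j + 1)))ᶜ
      ≤ ∑' j : ℕ, ENNReal.ofReal (2 ^ q * (K * R ^ (p - q)) * (2 ^ (q - p)) ^ j) := by
        refine ENNReal.tsum_le_tsum fun j => ?_
        refine (mul_le_mul_right (h (R / 2 ^ (j + 1)) (by positivity)) _).trans (le_of_eq ?_)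
        rw [← ENNReal.ofReal_mul (by positivity)]
        congr 1
        have e1 : (R / 2 ^ (j + 1)) ^ (-q) = 2 ^ q * (R / 2 ^ j) ^ (-q) := by
          rw [pow_succ, ← div_div, Real.div_rpow (div_nonneg hR.le (by positivity)) (by norm_num),
            Real.rpow_neg (x := 2) (by norm_num), div_inv_eq_mul, mul_comm]
        have e2 : (R / 2 ^ j) ^ p * (R / 2 ^ j) ^ (-q) = R ^ (p - q) * (2 ^ (q - p)) ^ j := by
          rw [← Real.rpow_add (by positivity), ← sub_eq_add_neg, scale_div_two_pow_rpow hR.le,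
            ← Real.rpow_natCast, ← Real.rpow_mul (by norm_num)]
          ring_nf
        rw [e1]
        linear_combination 2 ^ q * K * e2
    _ = _ := by
        rw [tsum_ofReal_geometric (by positivity) (by positivity) hlt]
        congr 1; ring

/-- Under a tail of order qp the k-th term is bounded by a multiple of 2^(-pk(1 - qs)); for qs < 1
this is a convergent geometric series, of the order of its first term. -/
lemma sum_dyadic_tail_le {p q s : ℝ} (hp : 0 < p) (hs : 0 ≤ s) (hqs : q * s < 1) :
    ∃ c : ℝ, 1 ≤ c ∧ ∀ (E : Type u) [MetricSpace E] [MeasurableSpace E] (μ : Measure E) (x₀ : E)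
      (n : ℕ) (K R : ℝ), 0 ≤ K → 0 < R →
      (∀ t : ℝ, 0 < t → tail μ x₀ t ≤ ENNReal.ofReal (K * t ^ (-(q * p)))) → ∀ N : ℕ,
      ∑ k ∈ Finset.range N, (R / 2 ^ k) ^ p * (n * (tail μ x₀ (R / 2 ^ (k + 1))).toReal) ^ s ≤
        c * (R ^ p * (n * (K * R ^ (-(q * p)))) ^ s) := by
  set x : ℝ := 2 ^ (-(p * (1 - q * s))) with hx
  have hx0 : 0 < x := by positivity
  have hx1 : x < 1 := Real.rpow_lt_one_of_one_lt_of_neg (by norm_num) (by nlinarith)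
  have hinv : 0 < (1 - x)⁻¹ := inv_pos.2 (by linarith)
  refine ⟨1 + 2 ^ (q * p * s) * (1 - x)⁻¹, by
    have : 0 ≤ 2 ^ (q * p * s) * (1 - x)⁻¹ := by positivity
    linarith, ?_⟩
  intro E _ _ μ x₀ n K R hK hR h N
  have hterm : ∀ k : ℕ, (R / 2 ^ k) ^ p * (n * (tail μ x₀ (R / 2 ^ (k + 1))).toReal) ^ s ≤
      2 ^ (q * p * s) * (R ^ p * (n * (K * R ^ (-(q * p)))) ^ s) * x ^ k := by
    intro k
    have h1 : (tail μ x₀ (R / 2 ^ (k + 1))).toReal ≤ K * (R / 2 ^ (k + 1)) ^ (-(q * p)) :=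
      ENNReal.toReal_le_of_le_ofReal (by positivity) (h _ (by positivity))
    have e1 : (R / 2 ^ (k + 1)) ^ (-(q * p)) = R ^ (-(q * p)) * 2 ^ (q * p * (k + 1)) := by
      rw [scale_div_two_pow_rpow hR.le]; push_cast; ring_nf
    have e2 : (n * (K * (R / 2 ^ (k + 1)) ^ (-(q * p)))) ^ s =
        (n * (K * R ^ (-(q * p)))) ^ s * 2 ^ (q * p * (k + 1) * s) := by
      rw [e1, ← mul_assoc, ← mul_assoc, Real.mul_rpow (by positivity) (by positivity),
        ← Real.rpow_mul (by norm_num), mul_assoc]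
    have e3 : x ^ k = 2 ^ (-(p * k)) * 2 ^ (q * p * k * s) := by
      rw [hx, ← Real.rpow_natCast, ← Real.rpow_mul (by norm_num), ← Real.rpow_add (by norm_num)]
      congr 1; ring
    have e4 : (2 : ℝ) ^ (q * p * (k + 1) * s) = 2 ^ (q * p * k * s) * 2 ^ (q * p * s) := by
      rw [← Real.rpow_add (by norm_num)]; congr 1; ring
    calc (R / 2 ^ k) ^ p * (n * (tail μ x₀ (R / 2 ^ (k + 1))).toReal) ^ s
        ≤ (R / 2 ^ k) ^ p * (n * (K * (R / 2 ^ (k + 1)) ^ (-(q * p)))) ^ s := by gcongr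
      _ = _ := by
        rw [e2, scale_div_two_pow_rpow hR.le, e3, e4]
        ring_nf
  refine (Finset.sum_le_sum fun k _ => hterm k).trans ?_
  rw [← Finset.mul_sum]
  have hg : ∑ k ∈ Finset.range N, x ^ k ≤ (1 - x)⁻¹ := by
    rw [← tsum_geometric_of_lt_one hx0.le hx1]
    exact (summable_geometric_of_lt_one hx0.le hx1).sum_le_tsum _ fun k _ => by positivity
  have hnn : 0 ≤ R ^ p * (n * (K * R ^ (-(q * p)))) ^ s := by positivity
  calc _ ≤ 2 ^ (q * p * s) * (R ^ p * (n * (K * R ^ (-(q * p)))) ^ s) * (1 - x)⁻¹ := by gcongr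
    _ ≤ _ := by nlinarith

/-- The part of the tail integral over a dyadic interval. -/
lemma tail_rpow_mul_le_setLIntegral {p s a : ℝ} (hp : 1 ≤ p) (hs : 0 ≤ s) (ha : 0 < a) :
    tail μ x₀ a ^ s * ENNReal.ofReal ((a / 2) ^ p) ≤
      ∫⁻ t in Ioc (a / 2) a, tail μ x₀ t ^ s * ENNReal.ofReal (t ^ (p - 1)) := by
  calc tail μ x₀ a ^ s * ENNReal.ofReal ((a / 2) ^ p)
      = ∫⁻ _ in Ioc (a / 2) a, tail μ x₀ a ^ s * ENNReal.ofReal ((a / 2) ^ (p - 1)) := by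
        rw [setLIntegral_const, Real.volume_Ioc, mul_assoc, ← ENNReal.ofReal_mul (by positivity)]
        congr 2
        rw [Real.rpow_sub_one (by positivity)]
        field_simp
        ring
    _ ≤ _ := by
        refine setLIntegral_mono' measurableSet_Ioc fun t ht => ?_
        refine mul_le_mul' (ENNReal.rpow_le_rpow (tail_anti ht.2) hs) (ENNReal.ofReal_le_ofReal ?_)
        exact Real.rpow_le_rpow (by positivity) ht.1.le (by linarith)

/-- Monotonicity of the tail turns the integral into a pointwise bound. For s > 0, a finite integral
thus yields a weak moment of order p/s. -/
lemma tail_rpow_mul_le_tailIntegral {p s a : ℝ} (hp : 1 ≤ p) (hs : 0 ≤ s) (ha : 0 < a) :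
    tail μ x₀ a ^ s * ENNReal.ofReal ((a / 2) ^ p) ≤ tailIntegral μ x₀ s p :=
  (tail_rpow_mul_le_setLIntegral hp hs ha).trans
    (lintegral_mono_set fun _ ht => (half_pos ha).trans ht.1)

/-- The intervals (a/2, a] for the successive radii a = R/2^(k+1) are disjoint. This replaces the
geometric series at the critical exponent. -/
lemma sum_tail_rpow_mul_le_tailIntegral {p s R : ℝ} (hp : 1 ≤ p) (hs : 0 ≤ s) (hR : 0 < R) (N : ℕ) :
    ∑ k ∈ Finset.range N, tail μ x₀ (R / 2 ^ (k + 1)) ^ s * ENNReal.ofReal ((R / 2 ^ (k + 1) / 2) ^ p) ≤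
      tailIntegral μ x₀ s p := by
  have hdisj : Pairwise (Function.onFun Disjoint fun k : ℕ => Ioc (R / 2 ^ (k + 1) / 2) (R / 2 ^ (k + 1))) := by
    refine (pairwise_disjoint_on _).2 fun k l hkl => ?_
    rw [Set.disjoint_left]
    intro t ht ht'
    have : k + 1 + 1 ≤ l + 1 := by omega
    have h1 : R / 2 ^ (l + 1) ≤ R / 2 ^ (k + 1 + 1) := by gcongr; norm_num
    have h2 : R / 2 ^ (k + 1) / 2 = R / 2 ^ (k + 1 + 1) := by rw [pow_succ 2 (k + 1), div_div]
    linarith [ht.1, ht'.2]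
  calc _ ≤ ∑ k ∈ Finset.range N, ∫⁻ t in Ioc (R / 2 ^ (k + 1) / 2) (R / 2 ^ (k + 1)),
        tail μ x₀ t ^ s * ENNReal.ofReal (t ^ (p - 1)) :=
        Finset.sum_le_sum fun k _ => tail_rpow_mul_le_setLIntegral hp hs (by positivity)
    _ = ∫⁻ t in ⋃ k ∈ Finset.range N, Ioc (R / 2 ^ (k + 1) / 2) (R / 2 ^ (k + 1)),
        tail μ x₀ t ^ s * ENNReal.ofReal (t ^ (p - 1)) :=
        (lintegral_biUnion_finset (fun i _ j _ hij => hdisj hij) (fun _ _ => measurableSet_Ioc) _).symm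
    _ ≤ _ := by
        refine lintegral_mono_set (iUnion₂_subset fun k _ t ht => ?_)
        exact lt_trans (by positivity) ht.1

end Moments

/-! ### Sums over the sample: second moments and union bounds -/

section TailSums

variable {E Ω : Type*} [MeasurableSpace E] [MeasurableSpace Ω] {X : ℕ → Ω → E} {μ : Measure E}
  {P : Measure Ω}

lemma IsIIDSample.lintegral_comp (h : IsIIDSample X μ P) {F : E → ℝ≥0∞} (hF : Measurable F) (i : ℕ) :
    ∫⁻ ω, F (X i ω) ∂P = ∫⁻ x, F x ∂μ := by
  rw [← h.law i, lintegral_map hF (h.measurable i)]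

/-- Expand the square: diagonal terms give second moments, and off-diagonal ones factor by
independence. No centring is needed, because the mean will be small compared with the threshold. -/
lemma IsIIDSample.lintegral_sum_sq_le (h : IsIIDSample X μ P) {F : E → ℝ≥0∞} (hF : Measurable F)
    (n : ℕ) : ∫⁻ ω, (∑ i ∈ Finset.range n, F (X i ω)) ^ 2 ∂P ≤
      n * ∫⁻ x, F x ^ 2 ∂μ + (n * ∫⁻ x, F x ∂μ) ^ 2 := by
  have hm : ∀ i, Measurable fun ω => F (X i ω) := fun i => hF.comp (h.measurable i)
  have hterm : ∀ i j, ∫⁻ ω, F (X i ω) * F (X j ω) ∂P ≤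
      (if i = j then ∫⁻ x, F x ^ 2 ∂μ else 0) + (∫⁻ x, F x ∂μ) ^ 2 := by
    intro i j
    split_ifs with hij
    · subst hij
      refine le_add_right (le_of_eq ?_)
      simp_rw [← sq]
      exact h.lintegral_comp (hF.pow_const 2) i
    · have hind : IndepFun (fun ω => F (X i ω)) (fun ω => F (X j ω)) P :=
        (h.indep.indepFun hij).comp hF hF
      have := lintegral_mul_eq_lintegral_mul_lintegral_of_indepFun (hm i) (hm j) hind
      simp only [Pi.mul_apply] at this
      rw [this, h.lintegral_comp hF, h.lintegral_comp hF, zero_add, sq]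
  have hmm : ∀ i j, Measurable fun ω => F (X i ω) * F (X j ω) := fun i j => (hm i).mul (hm j)
  simp_rw [sq (∑ i ∈ Finset.range n, F (X i _)), Finset.sum_mul_sum]
  rw [lintegral_finsetSum _ fun i _ => Finset.measurable_fun_sum _ fun j _ => hmm i j]
  simp_rw [lintegral_finsetSum (Finset.range n) fun j _ => hmm _ j]
  calc _ ≤ ∑ i ∈ Finset.range n, ∑ j ∈ Finset.range n,
        ((if i = j then ∫⁻ x, F x ^ 2 ∂μ else 0) + (∫⁻ x, F x ∂μ) ^ 2) :=
        Finset.sum_le_sum fun i _ => Finset.sum_le_sum fun j _ => hterm i j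
    _ = _ := by
        simp_rw [Finset.sum_add_distrib, Finset.sum_ite_eq]
        rw [Finset.sum_congr rfl fun i hi => if_pos hi]
        simp only [Finset.sum_const, Finset.card_range, nsmul_eq_mul]
        ring

lemma IsIIDSample.measure_exists_le (h : IsIIDSample X μ P) {G : Set E} (hG : MeasurableSet G)
    (n : ℕ) : P {ω | ∃ i ∈ Finset.range n, X i ω ∈ G} ≤ n * μ G := by
  have : {ω | ∃ i ∈ Finset.range n, X i ω ∈ G} = ⋃ i ∈ Finset.range n, X i ⁻¹' G := by
    ext ω; simp
  rw [this]
  refine (measure_biUnion_finset_le _ _).trans ?_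
  have h1 : ∀ i ∈ Finset.range n, P (X i ⁻¹' G) = μ G := fun i _ => by
    rw [← h.law i, Measure.map_apply (h.measurable i) hG]
  rw [Finset.sum_congr rfl h1]
  simp

end TailSums

/-! ### The contribution of observations outside the ball -/

section TailSumsMetric

variable {E Ω : Type*} [MetricSpace E] [MeasurableSpace E] [BorelSpace E] [MeasurableSpace Ω]
  {X : ℕ → Ω → E} {μ : Measure E} {P : Measure Ω}

/-- Truncation at level `M` and a second moment bound. -/
lemma IsIIDSample.measure_sum_indicator_gt_le (h : IsIIDSample X μ P) (x₀ : E) {p y : ℝ} (R M : ℝ)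
    (hy : 0 < y) (n : ℕ) :
    P {ω | ENNReal.ofReal y < ∑ i ∈ Finset.range n,
      (Metric.closedBall x₀ R)ᶜ.indicator (fun x => edist x x₀ ^ p) (X i ω)} ≤
      n * tail μ x₀ M + (n * ∫⁻ x in Metric.closedBall x₀ M, edist x x₀ ^ (2 * p) ∂μ +
        (n * ∫⁻ x in (Metric.closedBall x₀ R)ᶜ, edist x x₀ ^ p ∂μ) ^ 2) / ENNReal.ofReal y ^ 2 := by
  have hmR : MeasurableSet (Metric.closedBall x₀ R) := Metric.isClosed_closedBall.measurableSet
  have hmM : MeasurableSet (Metric.closedBall x₀ M) := Metric.isClosed_closedBall.measurableSet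
  have hmd : Measurable fun x : E => edist x x₀ ^ p :=
    measurable_edist_left.pow_const p
  set Z := (Metric.closedBall x₀ R)ᶜ.indicator (fun x => edist x x₀ ^ p) with hZ
  set F := (Metric.closedBall x₀ M).indicator Z with hF
  have hFm : Measurable F := (hmd.indicator hmR.compl).indicator hmM
  have hsub : {ω | ENNReal.ofReal y < ∑ i ∈ Finset.range n, Z (X i ω)} ⊆
      {ω | ∃ i ∈ Finset.range n, X i ω ∈ (Metric.closedBall x₀ M)ᶜ} ∪
      {ω | ENNReal.ofReal y ^ 2 ≤ (∑ i ∈ Finset.range n, F (X i ω)) ^ 2} := by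
    intro ω hω
    by_cases hex : ∃ i ∈ Finset.range n, X i ω ∈ (Metric.closedBall x₀ M)ᶜ
    · exact Or.inl hex
    · right
      have hω' : ENNReal.ofReal y < ∑ i ∈ Finset.range n, Z (X i ω) := hω
      push Not at hex
      have : ∑ i ∈ Finset.range n, F (X i ω) = ∑ i ∈ Finset.range n, Z (X i ω) :=
        Finset.sum_congr rfl fun i hi => indicator_of_mem (by simpa using hex i hi) _
      rw [mem_ofPred_eq, this]
      gcongr
  refine (measure_mono hsub).trans ((measure_union_le _ _).trans (add_le_add ?_ ?_))
  · exact h.measure_exists_le hmM.compl n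
  · have hSm : Measurable fun ω => (∑ i ∈ Finset.range n, F (X i ω)) ^ 2 :=
      (Finset.measurable_fun_sum _ fun i _ => hFm.comp (h.measurable i)).pow_const 2
    refine (meas_ge_le_lintegral_div hSm.aemeasurable (by simpa using hy) (by simp)).trans ?_
    gcongr
    refine (h.lintegral_sum_sq_le hFm n).trans ?_
    rw [← lintegral_indicator hmM, ← lintegral_indicator hmR.compl]
    gcongr with x x
    · by_cases hx : x ∈ Metric.closedBall x₀ M
      · rw [hF, indicator_of_mem hx, indicator_of_mem hx, mul_comm, ENNReal.rpow_mul, ENNReal.rpow_two]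
        gcongr
        exact indicator_le_self _ _ _
      · simp [hF, hx]
    · exact indicator_le_self _ _ _

/-- Tail of the sum over the observations outside of a ball, at the natural truncation level. -/
lemma IsIIDSample.measure_sum_indicator_gt_le_of_tail (h : IsIIDSample X μ P) {x₀ : E}
    {p r K y : ℝ} (hp : 1 ≤ p) (hr1 : 1 < r) (hr2 : r < 2) (hK : 0 < K) (hy : 0 < y) {n : ℕ}
    (hn : n ≠ 0) (ht : ∀ t : ℝ, 0 < t → tail μ x₀ t ≤ ENNReal.ofReal (K * t ^ (-(r * p)))) {A : ℝ}
    (hA : 0 < A) (hAK : A ^ r = n * K) :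
    n * ∫⁻ x in (Metric.closedBall x₀ (A ^ p⁻¹))ᶜ, edist x x₀ ^ p ∂μ ≤
      ENNReal.ofReal (2 ^ p * (1 - 2 ^ (p - r * p))⁻¹ * A) ∧
    P {ω | ENNReal.ofReal y < ∑ i ∈ Finset.range n,
      (Metric.closedBall x₀ (A ^ p⁻¹))ᶜ.indicator (fun x => edist x x₀ ^ p) (X i ω)} ≤
      ENNReal.ofReal ((1 + 2 ^ (r * p) * (1 - 2 ^ (r * p - 2 * p))⁻¹) * (A / y) ^ r +
        (2 ^ p * (1 - 2 ^ (p - r * p))⁻¹) ^ 2 * (A / y) ^ 2) := by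
  have hp0 : 0 < p := by linarith
  have hn0 : (0 : ℝ) < n := by exact_mod_cast Nat.pos_of_ne_zero hn
  have hlt1 : (2 : ℝ) ^ (p - r * p) < 1 :=
    Real.rpow_lt_one_of_one_lt_of_neg (by norm_num) (by nlinarith)
  have hlt2 : (2 : ℝ) ^ (r * p - 2 * p) < 1 :=
    Real.rpow_lt_one_of_one_lt_of_neg (by norm_num) (by nlinarith)
  have hc1 : 0 < (1 - (2 : ℝ) ^ (p - r * p))⁻¹ := inv_pos.2 (by linarith)
  have hc2 : 0 < (1 - (2 : ℝ) ^ (r * p - 2 * p))⁻¹ := inv_pos.2 (by linarith)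
  set c1 := 2 ^ p * (1 - (2 : ℝ) ^ (p - r * p))⁻¹
  set c2 := 2 ^ (r * p) * (1 - (2 : ℝ) ^ (r * p - 2 * p))⁻¹
  have hc1' : 0 < c1 := by positivity
  have hc2' : 0 < c2 := by positivity
  -- At this R the bound n K R^(-rp) equals 1: about one observation is expected outside. The
  -- truncation level M is the distance at which one observation alone reaches y. The moment outside
  -- R converges because r > 1, and the second moment inside M is controlled because r < 2.
  set R := A ^ p⁻¹ with hR
  set M := y ^ p⁻¹ with hM
  have hR0 : 0 < R := by positivity
  have hM0 : 0 < M := by positivity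
  have hpow : ∀ a : ℝ, 0 < a → ∀ e : ℝ, (a ^ p⁻¹) ^ (e * p) = a ^ e := fun a ha e => by
    rw [← Real.rpow_mul ha.le]; congr 1; field_simp
  have hn' : (n : ℝ≥0∞) = ENNReal.ofReal n := (ENNReal.ofReal_natCast n).symm
  have hfirst : n * ∫⁻ x in (Metric.closedBall x₀ R)ᶜ, edist x x₀ ^ p ∂μ ≤ ENNReal.ofReal (c1 * A) := by
    refine (mul_le_mul_right (lintegral_compl_closedBall_le hp0.le (by nlinarith) hK.le hR0 ht) _).trans ?_
    rw [hn', ← ENNReal.ofReal_mul hn0.le]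
    refine ENNReal.ofReal_le_ofReal (le_of_eq ?_)
    have e : R ^ (p - r * p) = A ^ (1 - r) := by rw [← hpow A hA]; congr 1; ring
    have e2 : A ^ r * A ^ (1 - r) = A := by rw [← Real.rpow_add hA]; simp
    rw [e]
    calc n * (c1 * (K * A ^ (1 - r))) = c1 * ((n * K) * A ^ (1 - r)) := by ring
      _ = _ := by rw [← hAK, e2]
  refine ⟨hfirst, (h.measure_sum_indicator_gt_le x₀ R M hy n).trans ?_⟩
  have h1 : n * tail μ x₀ M ≤ ENNReal.ofReal ((A / y) ^ r) := by
    refine (mul_le_mul_right (ht M hM0) _).trans ?_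
    rw [hn', ← ENNReal.ofReal_mul hn0.le]
    refine ENNReal.ofReal_le_ofReal (le_of_eq ?_)
    have e : M ^ (-(r * p)) = y ^ (-r) := by rw [← hpow y hy]; congr 1; ring
    rw [e, ← mul_assoc, ← hAK, Real.div_rpow hA.le hy.le, Real.rpow_neg hy.le, div_eq_mul_inv]
  have h2 : n * ∫⁻ x in Metric.closedBall x₀ M, edist x x₀ ^ (2 * p) ∂μ ≤
      ENNReal.ofReal (c2 * (A / y) ^ r * y ^ 2) := by
    refine (mul_le_mul_right (lintegral_closedBall_le (by linarith) (by nlinarith) hK.le hM0 ht) _).trans ?_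
    rw [hn', ← ENNReal.ofReal_mul hn0.le]
    refine ENNReal.ofReal_le_ofReal (le_of_eq ?_)
    have e : M ^ (2 * p - r * p) = y ^ (-r) * y ^ 2 := by
      rw [← Real.rpow_two, ← Real.rpow_add hy, ← hpow y hy]; congr 1; ring
    rw [e, Real.div_rpow hA.le hy.le, Real.rpow_neg hy.le, hAK, div_eq_mul_inv]
    ring
  calc _ ≤ ENNReal.ofReal ((A / y) ^ r) + (ENNReal.ofReal (c2 * (A / y) ^ r * y ^ 2) +
        ENNReal.ofReal (c1 * A) ^ 2) / ENNReal.ofReal y ^ 2 := by gcongr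
    _ = _ := by
        rw [← ENNReal.ofReal_pow (by positivity), ← ENNReal.ofReal_pow (by positivity),
          ← ENNReal.ofReal_add (by positivity) (by positivity),
          ← ENNReal.ofReal_div_of_pos (by positivity), ← ENNReal.ofReal_add (by positivity) (by positivity)]
        congr 1
        field_simp
        ring

end TailSumsMetric

/-! ### Splitting a deviation and the non-asymptotic estimate -/

lemma exp_neg_le_two_div_sq {z : ℝ} (hz : 0 < z) : Real.exp (-z) ≤ 2 / z ^ 2 := by
  rw [Real.exp_neg, ← one_div, div_le_div_iff₀ (Real.exp_pos z) (by positivity)]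
  have := Real.quadratic_le_exp_of_nonneg hz.le
  nlinarith

/-- The threshold is shared in thirds between the deterministic terms, the exponentially
concentrated T and the outside sum Z. The first share is never exceeded, so T or Z must exceed its
own. -/
lemma measure_gt_le_of_ae_le {Ω : Type*} [MeasurableSpace Ω] {P : Measure Ω} {p a m y : ℝ}
    {W Z : Ω → ℝ≥0∞} {T : Ω → ℝ} {M : ℝ≥0∞} (ha : 0 ≤ a) (hm : 0 ≤ m) (hy : 0 < y)
    (hM : M ≤ ENNReal.ofReal m) (hsmall : a + 2 ^ (p - 1) * m ≤ y / 3)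
    (h : ∀ᵐ ω ∂P, W ω ≤ ENNReal.ofReal a + ENNReal.ofReal (T ω) + 2 ^ (p - 1) * (M + Z ω)) :
    P {ω | ENNReal.ofReal y < W ω} ≤
      P {ω | y / 3 < T ω} + P {ω | ENNReal.ofReal (y / (3 * 2 ^ (p - 1))) < Z ω} := by
  refine le_trans ?_ (measure_union_le _ _)
  refine measure_mono_ae ?_
  filter_upwards [h] with ω hω hlt
  by_contra hcon
  have hcon' : ¬ (y / 3 < T ω ∨ ENNReal.ofReal (y / (3 * 2 ^ (p - 1))) < Z ω) := hcon
  push Not at hcon'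
  have hlt' : ENNReal.ofReal y < W ω := hlt
  refine absurd (hlt'.trans_le hω) (not_lt.2 ?_)
  have htwo : (2 : ℝ≥0∞) ^ (p - 1) = ENNReal.ofReal (2 ^ (p - 1)) := by
    rw [← ENNReal.ofReal_rpow_of_pos (by norm_num)]; simp
  have h3 : (2 : ℝ≥0∞) ^ (p - 1) * Z ω ≤ ENNReal.ofReal (y / 3) := by
    refine (mul_le_mul_right hcon'.2 _).trans ?_
    rw [htwo, ← ENNReal.ofReal_mul (by positivity)]
    refine ENNReal.ofReal_le_ofReal (le_of_eq ?_)
    field_simp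
  calc _ ≤ ENNReal.ofReal a + ENNReal.ofReal (y / 3) +
        (2 ^ (p - 1) * ENNReal.ofReal m + ENNReal.ofReal (y / 3)) := by
        rw [mul_add]
        gcongr
        exact hcon'.1
    _ = ENNReal.ofReal (a + y / 3 + (2 ^ (p - 1) * m + y / 3)) := by
        rw [htwo, ENNReal.ofReal_add (by positivity) (by positivity),
          ENNReal.ofReal_add (by positivity) (by positivity),
          ENNReal.ofReal_add (by positivity) (by positivity),
          ENNReal.ofReal_mul (p := 2 ^ (p - 1)) (by positivity)]
    _ ≤ ENNReal.ofReal y := ENNReal.ofReal_le_ofReal (by linarith)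

section Deviation

/-- Non-asymptotic deviation bound in the regime of tails of order `r ∈ (1, 2)`. -/
lemma exists_deviation_bound {p α β r b : ℝ} (hp : 1 ≤ p) (hα : 2 * p < α) (hβ : 0 < β)
    (hr1 : 1 < r) (hr2 : r < 2) (hb : 1 ≤ b) :
    ∃ c : ℝ, 0 < c ∧ ∀ (E : Type u) [MetricSpace E] [PolishSpace E] [MeasurableSpace E]
      [BorelSpace E] (Ω : Type v) [MeasurableSpace Ω] (P : Measure Ω) [IsProbabilityMeasure P]
      (X : ℕ → Ω → E) (μ : Measure E) (S : Set E) (x₀ : E), IsIIDSample X μ P →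
      (∀ᵐ z ∂μ, z ∈ S) → HasCoveringDim S x₀ α β → ∀ n : ℕ, n ≠ 0 → ∀ K A y : ℝ, 0 < K → 0 < A →
      0 < y → A ^ r = n * K → (∀ t : ℝ, 0 < t → tail μ x₀ t ≤ ENNReal.ofReal (K * t ^ (-(r * p)))) →
      (∀ N : ℕ, ∑ k ∈ Finset.range N, (A ^ p⁻¹ / 2 ^ k) ^ p *
        (n * (tail μ x₀ (A ^ p⁻¹ / 2 ^ (k + 1))).toReal) ^ ((α - p) / α) ≤ b * A) →
      P {ω | ENNReal.ofReal y < n * wassersteinPow p μ (empiricalMeasure X n ω)} ≤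
        ENNReal.ofReal (c * (A / y) ^ r) := by
  obtain ⟨c₀, hc₀, hmain⟩ := exists_subExp_bound.{u, v} hp hα hβ
  have hp0 : 0 < p := by linarith
  have hlt1 : (2 : ℝ) ^ (p - r * p) < 1 :=
    Real.rpow_lt_one_of_one_lt_of_neg (by norm_num) (by nlinarith)
  have hlt2 : (2 : ℝ) ^ (r * p - 2 * p) < 1 :=
    Real.rpow_lt_one_of_one_lt_of_neg (by norm_num) (by nlinarith)
  have hc1 : 0 < (1 - (2 : ℝ) ^ (p - r * p))⁻¹ := inv_pos.2 (by linarith)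
  have hc2 : 0 < (1 - (2 : ℝ) ^ (r * p - 2 * p))⁻¹ := inv_pos.2 (by linarith)
  obtain ⟨c1, hc1e⟩ : ∃ c1, c1 = 2 ^ p * (1 - (2 : ℝ) ^ (p - r * p))⁻¹ := ⟨_, rfl⟩
  obtain ⟨c2, hc2e⟩ : ∃ c2, c2 = 2 ^ (r * p) * (1 - (2 : ℝ) ^ (r * p - 2 * p))⁻¹ := ⟨_, rfl⟩
  have hc1' : 0 < c1 := by rw [hc1e]; positivity
  have hc2' : 0 < c2 := by rw [hc2e]; positivity
  obtain ⟨κ, hκ⟩ : ∃ κ : ℝ, κ = 3 * 2 ^ (p - 1) := ⟨_, rfl⟩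
  have hκ0 : 0 < κ := by rw [hκ]; positivity
  -- Beyond c3 A the deterministic terms are at most y/3; the added 1 ensures A ≤ y there.
  set c3 := 3 * (c₀ * b + 2 ^ (p - 1) * c1) + 1 with hc3
  have hc3' : 1 ≤ c3 := by
    have : 0 < 3 * (c₀ * b + 2 ^ (p - 1) * c1) := by positivity
    rw [hc3]; linarith
  refine ⟨c3 ^ r + 12 * (3 * (c₀ * b)) ^ 2 + (1 + c2) * κ ^ r + c1 ^ 2 * κ ^ 2, by positivity, ?_⟩
  intro E _ _ _ _ Ω _ P _ X μ S x₀ hX hS hcov n hn K A y hK hA hy hAK ht hB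
  set z := A / y with hz
  have hz0 : 0 < z := by positivity
  -- For small y the claimed bound is at least 1 and there is nothing to prove. Otherwise z ≤ 1, and
  -- since r < 2 every z² is absorbed into z^r, including the quadratic bound on the exponential
  -- term.
  rcases le_or_gt y (c3 * A) with hyA | hyA
  · refine prob_le_one.trans ?_
    rw [ENNReal.one_le_ofReal]
    have h1 : 1 ≤ c3 * z := by
      rw [hz, ← mul_div_assoc]; exact (one_le_div hy).2 hyA
    have h2 : 1 ≤ c3 ^ r * z ^ r := by
      rw [← Real.mul_rpow (by linarith) hz0.le]
      exact Real.one_le_rpow h1 (by linarith)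
    have h3 : 0 ≤ (12 * (3 * (c₀ * b)) ^ 2 + (1 + c2) * κ ^ r + c1 ^ 2 * κ ^ 2) * z ^ r := by
      positivity
    linarith
  have hAy : A ≤ y := by nlinarith
  have hz1 : z ≤ 1 := (div_le_one hy).2 hAy
  have hzr : z ^ 2 ≤ z ^ r := by
    rw [← Real.rpow_two]
    exact Real.rpow_le_rpow_of_exponent_ge hz0 hz1 hr2.le
  have hRp : (A ^ p⁻¹) ^ p = A := by rw [← Real.rpow_mul hA.le, inv_mul_cancel₀ hp0.ne', Real.rpow_one]
  obtain ⟨T, hT, hTW⟩ := hmain E Ω P X μ S x₀ hX hS hcov n hn (A ^ p⁻¹) (by positivity) (b * A)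
    (by rw [hRp]; nlinarith) hB
  obtain ⟨hm1, hm2⟩ := hX.measure_sum_indicator_gt_le_of_tail (y := y / κ) hp hr1 hr2 hK
    (by positivity) hn ht hA hAK
  rw [← hc1e] at hm1
  rw [← hc1e, ← hc2e] at hm2
  rw [hκ] at hm2
  refine (measure_gt_le_of_ae_le (by positivity) (by positivity) hy hm1
    (by rw [hc3] at hyA; linarith) hTW).trans ((add_le_add (hT.measure_gt_le _) hm2).trans ?_)
  rw [← hκ]
  rw [← ENNReal.ofReal_add (by positivity) (by positivity)]
  refine ENNReal.ofReal_le_ofReal ?_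
  have e1 : 6 * Real.exp (-(y / 3 / (c₀ * (b * A)))) ≤ 12 * (3 * (c₀ * b)) ^ 2 * z ^ 2 := by
    have := exp_neg_le_two_div_sq (z := y / 3 / (c₀ * (b * A))) (by positivity)
    refine (mul_le_mul_of_nonneg_left this (by norm_num)).trans (le_of_eq ?_)
    rw [hz]; field_simp; ring
  have e2 : A / (y / κ) = κ * z := by rw [hz]; field_simp
  rw [e2, Real.mul_rpow hκ0.le hz0.le, mul_pow]
  have h4 : 12 * (3 * (c₀ * b)) ^ 2 * z ^ 2 ≤ 12 * (3 * (c₀ * b)) ^ 2 * z ^ r := by gcongr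
  have h5 : c1 ^ 2 * (κ ^ 2 * z ^ 2) ≤ c1 ^ 2 * (κ ^ 2 * z ^ r) := by gcongr
  have h6 : 0 ≤ c3 ^ r * z ^ r := by positivity
  linarith

end Deviation

/-! ### Passing to the infimum over tail constants and rescaling -/

section Scaling

/-- Lets a moment, which may be zero, be replaced by any strictly larger and hence positive constant
K, with no loss in the limit. -/
lemma le_ofReal_of_forall_gt {a : ℝ≥0∞} {g : ℝ → ℝ} (hg : Continuous g) {m : ℝ}
    (h : ∀ K, m < K → a ≤ ENNReal.ofReal (g K)) : a ≤ ENNReal.ofReal (g m) := by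
  have ht : Tendsto (fun K => ENNReal.ofReal (g K)) (𝓝[>] m) (𝓝 (ENNReal.ofReal (g m))) :=
    ((ENNReal.continuous_ofReal.comp hg).tendsto m).mono_left nhdsWithin_le_nhds
  exact ge_of_tendsto ht (eventually_nhdsWithin_of_forall fun K hK => h K hK)

lemma devProb_eq {E Ω : Type*} [MetricSpace E] [MeasurableSpace E] [MeasurableSpace Ω]
    (P : Measure Ω) (X : ℕ → Ω → E) (μ : Measure E) (p : ℝ) {n : ℕ} (hn : n ≠ 0) (x ρ : ℝ) :
    devProb P X μ p n (x / (n : ℝ) ^ (1 - ρ)) =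
      P {ω | ENNReal.ofReal (x * (n : ℝ) ^ ρ) < n * wassersteinPow p μ (empiricalMeasure X n ω)} := by
  have hn0 : (0 : ℝ) < n := by exact_mod_cast Nat.pos_of_ne_zero hn
  have e : ENNReal.ofReal (x * (n : ℝ) ^ ρ) = n * ENNReal.ofReal (x / (n : ℝ) ^ (1 - ρ)) := by
    rw [← ENNReal.ofReal_natCast, ← ENNReal.ofReal_mul hn0.le, Real.rpow_sub hn0, Real.rpow_one]
    congr 1
    field_simp
  unfold devProb
  congr 1
  ext ω
  rw [mem_ofPred_eq, mem_ofPred_eq, e,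
    ENNReal.mul_lt_mul_iff_right (by simpa using hn) (ENNReal.natCast_ne_top n)]

/-- The normalisation cancels the n in A^r = nK against n^(rρ) exactly, so the final bound depends
on neither n nor ρ. -/
lemma scaling_identity {n : ℕ} (hn : n ≠ 0) {x ρ r c A K : ℝ} (hx : 0 < x) (hA : 0 < A)
    (hAK : A ^ r = n * K) :
    (n : ℝ) ^ (r * ρ - 1) * (c * (A / (x * (n : ℝ) ^ ρ)) ^ r) = c / x ^ r * K := by
  have hn0 : (0 : ℝ) < n := by exact_mod_cast Nat.pos_of_ne_zero hn
  rw [Real.div_rpow hA.le (by positivity), Real.mul_rpow hx.le (by positivity), hAK,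
    ← Real.rpow_mul hn0.le, Real.rpow_sub_one hn0.ne', mul_comm ρ r]
  field_simp

end Scaling

/-! ### Bounds valid for every n -/

section NonAsymptotic

/-- Below the critical exponent, r (α - p)/α < 1 makes the dyadic sum geometric. With R^p =
(nK)^(1/r) one has n K R^(-rp) = 1, so the sum is of order R^p. -/
lemma exists_weakMoment_bound {p α β r : ℝ} (hp : 1 ≤ p) (hα : 2 * p < α) (hβ : 0 < β)
    (hr1 : 1 < r) (hr2 : r < α / (α - p)) :
    ∃ C : ℝ, 0 < C ∧
      ∀ (E : Type u) [MetricSpace E] [PolishSpace E] [MeasurableSpace E] [BorelSpace E]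
        (Ω : Type v) [MeasurableSpace Ω] (P : Measure Ω) [IsProbabilityMeasure P]
        (X : ℕ → Ω → E) (μ : Measure E) (S : Set E) (x₀ : E),
        IsIIDSample X μ P → (∀ᵐ z ∂μ, z ∈ S) → HasCoveringDim S x₀ α β →
        weakMoment μ x₀ (r * p) < ∞ →
        ∀ ρ x : ℝ, 0 < x → ∀ n : ℕ, 1 ≤ n →
          ENNReal.ofReal ((n : ℝ) ^ (r * ρ - 1)) * devProb P X μ p n (x / (n : ℝ) ^ (1 - ρ)) ≤
            ENNReal.ofReal (C / x ^ r) * weakMoment μ x₀ (r * p) := by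
  have hp0 : 0 < p := by linarith
  have hαp : 0 < α - p := by linarith
  have hα0 : 0 < α := by linarith
  have hrs : r * ((α - p) / α) < 1 := by
    rw [lt_div_iff₀ hαp] at hr2
    rw [← mul_div_assoc, div_lt_one hα0]; exact hr2
  have hr2' : r < 2 := hr2.trans ((div_lt_iff₀ hαp).2 (by linarith))
  obtain ⟨b, hb, hsum⟩ := sum_dyadic_tail_le.{u} hp0 (by positivity : 0 ≤ (α - p) / α) hrs
  obtain ⟨c, hc, hdev⟩ := exists_deviation_bound.{u, v} hp hα hβ hr1 hr2' hb
  refine ⟨c, hc, ?_⟩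
  intro E _ _ _ _ Ω _ P _ X μ S x₀ hX hS hcov hw ρ x hx n hn
  have hn1 : n ≠ 0 := by omega
  have hn0 : (0 : ℝ) < n := by exact_mod_cast hn
  rw [← ENNReal.ofReal_toReal hw.ne, ← ENNReal.ofReal_mul (by positivity)]
  refine le_ofReal_of_forall_gt (g := fun K => c / x ^ r * K) (by fun_prop) fun K hK => ?_
  have hK0 : 0 < K := ENNReal.toReal_nonneg.trans_lt hK
  have ht : ∀ t : ℝ, 0 < t → tail μ x₀ t ≤ ENNReal.ofReal (K * t ^ (-(r * p))) := fun t ht =>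
    tail_le_of_weakMoment_le ((ENNReal.le_ofReal_iff_toReal_le hw.ne hK0.le).2 hK.le) ht
  set A : ℝ := (n * K) ^ r⁻¹ with hA
  have hA0 : 0 < A := by positivity
  have hAK : A ^ r = n * K := by
    rw [hA, ← Real.rpow_mul (by positivity), inv_mul_cancel₀ (by linarith), Real.rpow_one]
  have hRp : (A ^ p⁻¹) ^ p = A := by
    rw [← Real.rpow_mul hA0.le, inv_mul_cancel₀ hp0.ne', Real.rpow_one]
  have hRq : (A ^ p⁻¹) ^ (-(r * p)) = (n * K)⁻¹ := by
    rw [← hAK, ← Real.rpow_neg hA0.le, ← Real.rpow_mul hA0.le]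
    congr 1; field_simp
  have hB := hsum E μ x₀ n K (A ^ p⁻¹) hK0.le (by positivity) ht
  have e : (n : ℝ) * (K * (n * K)⁻¹) = 1 := by field_simp
  rw [hRp, hRq, e, Real.one_rpow, mul_one] at hB
  have hfin := hdev E Ω P X μ S x₀ hX hS hcov n hn1 K A (x * (n : ℝ) ^ ρ) hK0 hA0 (by positivity)
    hAK ht hB
  rw [devProb_eq P X μ p hn1]
  refine (mul_le_mul_right hfin _).trans ?_
  rw [← ENNReal.ofReal_mul (by positivity), scaling_identity hn1 hx hA0 hAK]

/-- At the critical exponent r = 1/s the geometric series no longer converges. The integral serves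
twice: it bounds the dyadic sum, and pointwise it gives a tail of order rp with constant (2^p J)^r
for any J above it. -/
lemma exists_momentIntegral_bound {p α β : ℝ} (hp : 1 ≤ p) (hα : 2 * p < α) (hβ : 0 < β) :
    ∃ C : ℝ, 0 < C ∧
      ∀ (E : Type u) [MetricSpace E] [PolishSpace E] [MeasurableSpace E] [BorelSpace E]
        (Ω : Type v) [MeasurableSpace Ω] (P : Measure Ω) [IsProbabilityMeasure P]
        (X : ℕ → Ω → E) (μ : Measure E) (S : Set E) (x₀ : E),
        IsIIDSample X μ P → (∀ᵐ z ∂μ, z ∈ S) → HasCoveringDim S x₀ α β →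
        momentIntegral μ x₀ α p < ∞ →
        ∀ ρ x : ℝ, 0 < x → ∀ n : ℕ, 1 ≤ n →
          ENNReal.ofReal ((n : ℝ) ^ (α / (α - p) * ρ - 1)) *
            devProb P X μ p n (x / (n : ℝ) ^ (1 - ρ)) ≤
            ENNReal.ofReal (C / x ^ (α / (α - p))) * momentIntegral μ x₀ α p ^ (α / (α - p)) := by
  have hp0 : 0 < p := by linarith
  have hαp : 0 < α - p := by linarith
  have hα0 : 0 < α := by linarith
  obtain ⟨r, hr⟩ : ∃ r, r = α / (α - p) := ⟨_, rfl⟩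
  obtain ⟨s, hs⟩ : ∃ s, s = (α - p) / α := ⟨_, rfl⟩
  have hs0 : 0 < s := by rw [hs]; positivity
  have hsr : s * r = 1 := by rw [hs, hr]; field_simp
  have hr1 : 1 < r := by rw [hr, one_lt_div hαp]; linarith
  have hr2 : r < 2 := by rw [hr, div_lt_iff₀ hαp]; linarith
  -- The factor 4^p compares R/2^k with the left end R/2^(k+2) of the interval on which the integral
  -- is used.
  have hb : (1 : ℝ) ≤ 4 ^ p := Real.one_le_rpow (by norm_num) hp0.le
  obtain ⟨c, hc, hdev⟩ := exists_deviation_bound.{u, v} hp hα hβ hr1 hr2 hb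
  rw [← hr]
  refine ⟨c * (2 ^ p) ^ r, by positivity, ?_⟩
  intro E _ _ _ _ Ω _ P _ X μ S x₀ hX hS hcov hI ρ x hx n hn
  have := hX.isProbabilityMeasure
  have hn1 : n ≠ 0 := by omega
  have hn0 : (0 : ℝ) < n := by exact_mod_cast hn
  rw [← ENNReal.ofReal_toReal hI.ne, ENNReal.ofReal_rpow_of_nonneg ENNReal.toReal_nonneg (by linarith),
    ← ENNReal.ofReal_mul (by positivity)]
  refine le_ofReal_of_forall_gt (g := fun J => c * (2 ^ p) ^ r / x ^ r * J ^ r)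
    (continuous_const.mul (Real.continuous_rpow_const (by linarith))) fun J hJ => ?_
  have hJ0 : 0 < J := ENNReal.toReal_nonneg.trans_lt hJ
  have hIJ : tailIntegral μ x₀ s p ≤ ENNReal.ofReal J := by
    rw [hs]; exact (ENNReal.le_ofReal_iff_toReal_le hI.ne hJ0.le).2 hJ.le
  have htop : ∀ t, tail μ x₀ t ≠ ∞ := fun t => measure_ne_top _ _
  have hreal : ∀ t a, 0 ≤ a → tail μ x₀ t ^ s * ENNReal.ofReal a =
      ENNReal.ofReal ((tail μ x₀ t).toReal ^ s * a) := fun t a ha => by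
    rw [ENNReal.ofReal_mul (by positivity), ← ENNReal.ofReal_rpow_of_nonneg ENNReal.toReal_nonneg hs0.le,
      ENNReal.ofReal_toReal (htop t)]
  have ht : ∀ t : ℝ, 0 < t → tail μ x₀ t ≤ ENNReal.ofReal ((2 ^ p * J) ^ r * t ^ (-(r * p))) := by
    intro t ht
    have h1 := (tail_rpow_mul_le_tailIntegral (μ := μ) (x₀ := x₀) hp hs0.le ht).trans hIJ
    rw [hreal _ _ (by positivity), ENNReal.ofReal_le_ofReal_iff hJ0.le, Real.div_rpow ht.le (by norm_num),
      ← mul_div_assoc, div_le_iff₀ (by positivity)] at h1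
    refine (ENNReal.le_ofReal_iff_toReal_le (htop t) (by positivity)).2 ?_
    have h2 : (tail μ x₀ t).toReal ^ s ≤ 2 ^ p * J * t ^ (-p) := by
      rw [Real.rpow_neg ht.le, ← div_eq_mul_inv, le_div_iff₀ (by positivity)]
      linarith
    have h3 := Real.rpow_le_rpow (by positivity) h2 (by linarith : 0 ≤ r)
    rw [← Real.rpow_mul ENNReal.toReal_nonneg, hsr, Real.rpow_one, Real.mul_rpow (by positivity) (by positivity),
      ← Real.rpow_mul ht.le] at h3
    refine h3.trans (le_of_eq ?_)
    congr 2; ring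
  set A : ℝ := n ^ s * (2 ^ p * J) with hA
  have hA0 : 0 < A := by positivity
  have hAK : A ^ r = n * (2 ^ p * J) ^ r := by
    rw [hA, Real.mul_rpow (by positivity) (by positivity), ← Real.rpow_mul hn0.le, hsr, Real.rpow_one]
  have hB : ∀ N : ℕ, ∑ k ∈ Finset.range N, (A ^ p⁻¹ / 2 ^ k) ^ p *
        (n * (tail μ x₀ (A ^ p⁻¹ / 2 ^ (k + 1))).toReal) ^ ((α - p) / α) ≤ 4 ^ p * A := by
    intro N
    rw [← hs]
    set R := A ^ p⁻¹
    have hR : 0 < R := by positivity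
    have h1 := (sum_tail_rpow_mul_le_tailIntegral (μ := μ) (x₀ := x₀) hp hs0.le hR N).trans hIJ
    simp_rw [hreal _ _ (Real.rpow_nonneg (div_nonneg (div_nonneg hR.le (pow_nonneg zero_le_two _)) zero_le_two) p)] at h1
    rw [← ENNReal.ofReal_sum_of_nonneg fun k _ => by positivity, ENNReal.ofReal_le_ofReal_iff hJ0.le] at h1
    have e : ∀ k : ℕ, (R / 2 ^ k) ^ p * (n * (tail μ x₀ (R / 2 ^ (k + 1))).toReal) ^ s =
        n ^ s * 4 ^ p * ((tail μ x₀ (R / 2 ^ (k + 1))).toReal ^ s * (R / 2 ^ (k + 1) / 2) ^ p) := by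
      intro k
      have : R / 2 ^ k = 4 * (R / 2 ^ (k + 1) / 2) := by rw [pow_succ]; field_simp; ring
      rw [this, Real.mul_rpow (by norm_num) (by positivity), Real.mul_rpow hn0.le ENNReal.toReal_nonneg]
      ring
    simp_rw [e]
    rw [← Finset.mul_sum, hA]
    have h2 : (1 : ℝ) ≤ 2 ^ p := Real.one_le_rpow (by norm_num) hp0.le
    calc _ ≤ (n : ℝ) ^ s * 4 ^ p * J := by gcongr
      _ ≤ n ^ s * 4 ^ p * (2 ^ p * J) := by gcongr; exact le_mul_of_one_le_left hJ0.le h2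
      _ = _ := by ring
  have hfin := hdev E Ω P X μ S x₀ hX hS hcov n hn1 ((2 ^ p * J) ^ r) A (x * (n : ℝ) ^ ρ)
    (by positivity) hA0 (by positivity) hAK ht hB
  rw [devProb_eq P X μ p hn1]
  refine (mul_le_mul_right hfin _).trans ?_
  rw [← ENNReal.ofReal_mul (by positivity), scaling_identity hn1 hx hA0 hAK,
    Real.mul_rpow (by positivity) hJ0.le]
  refine ENNReal.ofReal_le_ofReal (le_of_eq ?_)
  ring

end NonAsymptotic

/-! ### One large observation or two outside the ball -/

section TwoJumps

lemma IsIIDSample.measure_exists_pair_le {E Ω : Type*} [MeasurableSpace E] [MeasurableSpace Ω]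
    {X : ℕ → Ω → E} {μ : Measure E} {P : Measure Ω} (h : IsIIDSample X μ P) {G : Set E}
    (hG : MeasurableSet G) (n : ℕ) :
    P {ω | ∃ i ∈ Finset.range n, ∃ j ∈ Finset.range n, i ≠ j ∧ X i ω ∈ G ∧ X j ω ∈ G} ≤
      (n * μ G) ^ 2 := by
  have hsub : {ω | ∃ i ∈ Finset.range n, ∃ j ∈ Finset.range n, i ≠ j ∧ X i ω ∈ G ∧ X j ω ∈ G} ⊆
      ⋃ i ∈ Finset.range n, ⋃ j ∈ Finset.range n, {ω | i ≠ j ∧ X i ω ∈ G ∧ X j ω ∈ G} := by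
    rintro ω ⟨i, hi, j, hj, hω⟩
    exact mem_biUnion hi (mem_biUnion hj hω)
  have hterm : ∀ i j, P {ω | i ≠ j ∧ X i ω ∈ G ∧ X j ω ∈ G} ≤ μ G ^ 2 := by
    intro i j
    by_cases hij : i = j
    · simp [hij]
    · have h1 : {ω | i ≠ j ∧ X i ω ∈ G ∧ X j ω ∈ G} = X i ⁻¹' G ∩ X j ⁻¹' G := by
        ext ω; simp [hij]
      rw [h1, (h.indep.indepFun hij).measure_inter_preimage_eq_mul _ _ hG hG,
        ← Measure.map_apply (h.measurable i) hG, ← Measure.map_apply (h.measurable j) hG, h.law,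
        h.law, sq]
  refine (measure_mono hsub).trans ((measure_biUnion_finset_le _ _).trans ?_)
  calc _ ≤ ∑ i ∈ Finset.range n, ∑ j ∈ Finset.range n, μ G ^ 2 :=
        Finset.sum_le_sum fun i _ => (measure_biUnion_finset_le _ _).trans
          (Finset.sum_le_sum fun j _ => hterm i j)
    _ = _ := by
        simp only [Finset.sum_const, Finset.card_range, nsmul_eq_mul]
        ring

/-- Either one observation is large, or at least two of them lie outside of the ball. -/
lemma IsIIDSample.measure_sum_indicator_gt_le_of_jumps {E Ω : Type*} [MetricSpace E]
    [MeasurableSpace E] [BorelSpace E] [MeasurableSpace Ω] {X : ℕ → Ω → E} {μ : Measure E}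
    {P : Measure Ω} (h : IsIIDSample X μ P) (x₀ : E) {p y : ℝ} (R : ℝ) (hp : 0 < p) (hy : 0 < y)
    (n : ℕ) :
    P {ω | ENNReal.ofReal y < ∑ i ∈ Finset.range n,
      (Metric.closedBall x₀ R)ᶜ.indicator (fun x => edist x x₀ ^ p) (X i ω)} ≤
      n * tail μ x₀ (y ^ p⁻¹) + (n * tail μ x₀ R) ^ 2 := by
  have hm : ∀ t : ℝ, MeasurableSet (Metric.closedBall x₀ t)ᶜ := fun t =>
    Metric.isClosed_closedBall.measurableSet.compl
  refine (measure_mono ?_).trans ((measure_union_le _ _).trans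
    (add_le_add (h.measure_exists_le (hm (y ^ p⁻¹)) n) (h.measure_exists_pair_le (hm R) n)))
  intro ω hω
  by_contra hcon
  simp only [mem_union, mem_ofPred_eq, not_or, not_exists, not_and, mem_compl_iff, not_not] at hcon
  obtain ⟨h1, h2⟩ := hcon
  have hω' : ENNReal.ofReal y < ∑ i ∈ Finset.range n,
      (Metric.closedBall x₀ R)ᶜ.indicator (fun x => edist x x₀ ^ p) (X i ω) := hω
  refine absurd hω' (not_lt.2 ?_)
  have hle : ∀ i ∈ Finset.range n, edist (X i ω) x₀ ^ p ≤ ENNReal.ofReal y := by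
    intro i hi
    have h3 : dist (X i ω) x₀ ≤ y ^ p⁻¹ := h1 i hi
    rw [edist_dist, ENNReal.ofReal_rpow_of_nonneg dist_nonneg hp.le]
    refine ENNReal.ofReal_le_ofReal ?_
    calc dist (X i ω) x₀ ^ p ≤ (y ^ p⁻¹) ^ p := by gcongr
      _ = y := by rw [← Real.rpow_mul hy.le, inv_mul_cancel₀ hp.ne', Real.rpow_one]
  by_cases hex : ∃ i ∈ Finset.range n, X i ω ∈ (Metric.closedBall x₀ R)ᶜ
  · obtain ⟨i, hi, hiR⟩ := hex
    rw [Finset.sum_eq_single_of_mem i hi]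
    · exact (indicator_le_self _ _ _).trans (hle i hi)
    · intro j hj hij
      exact indicator_of_notMem (notMem_compl_iff.2 (h2 i hi j hj (Ne.symm hij) hiR)) _
  · push Not at hex
    rw [Finset.sum_eq_zero fun i hi => indicator_of_notMem (hex i hi) _]
    exact bot_le

end TwoJumps

/-! ### The limit regime: a single large observation -/

section Asymptotic

lemma tendsto_rpow_mul_exp_neg_rpow {a b ε : ℝ} (hb : 0 < b) (hε : 0 < ε) :
    Tendsto (fun n : ℕ => (n : ℝ) ^ a * Real.exp (-b * (n : ℝ) ^ ε)) atTop (𝓝 0) := by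
  have h1 := (tendsto_rpow_mul_exp_neg_mul_atTop_nhds_zero (a / ε) b hb).comp
    ((tendsto_rpow_atTop hε).comp tendsto_natCast_atTop_atTop)
  refine h1.congr fun n => ?_
  simp only [Function.comp_apply]
  rw [← Real.rpow_mul (Nat.cast_nonneg n)]
  congr 2
  field_simp

/-- Above the critical exponent the dyadic bound would blow up at small radii. A lower order
restores convergence; for t ≤ 1 the trivial bound H ≤ 1 is enough. -/
lemma tail_le_of_order_le {E : Type*} [MetricSpace E] [MeasurableSpace E] {μ : Measure E}
    [IsProbabilityMeasure μ] {x₀ : E} {q q' K : ℝ} (hq' : 0 ≤ q') (hqq : q' ≤ q)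
    (h : ∀ t : ℝ, 0 < t → tail μ x₀ t ≤ ENNReal.ofReal (K * t ^ (-q))) (t : ℝ) (ht : 0 < t) :
    tail μ x₀ t ≤ ENNReal.ofReal (max 1 K * t ^ (-q')) := by
  rcases le_total t 1 with h1 | h1
  · refine prob_le_one.trans ?_
    rw [ENNReal.one_le_ofReal]
    exact one_le_mul_of_one_le_of_one_le (le_max_left _ _)
      (Real.one_le_rpow_of_pos_of_le_one_of_nonpos ht h1 (by linarith))
  · refine (h t ht).trans (ENNReal.ofReal_le_ofReal ?_)
    refine mul_le_mul (le_max_right _ _)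
      (Real.rpow_le_rpow_of_exponent_le h1 (by linarith)) (by positivity)
      (zero_le_one.trans (le_max_left _ _))

set_option maxHeartbeats 1000000 in
/-- Asymptotic deviations are governed by a single large observation. -/
lemma limsup_devProb_le {p α β r : ℝ} (hp : 1 ≤ p) (hα : 2 * p < α) (hβ : 0 < β)
    (hr : α / (α - p) < r) (E : Type u) [MetricSpace E] [PolishSpace E] [MeasurableSpace E]
    [BorelSpace E] (Ω : Type v) [MeasurableSpace Ω] (P : Measure Ω) [IsProbabilityMeasure P]
    (X : ℕ → Ω → E) (μ : Measure E) (S : Set E) (x₀ : E) (hX : IsIIDSample X μ P)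
    (hS : ∀ᵐ z ∂μ, z ∈ S) (hcov : HasCoveringDim S x₀ α β) (hw : weakMoment μ x₀ (r * p) < ∞)
    {ρ : ℝ} (hρ : ρ ∈ Ioc ((α - p) / α) 1) {x : ℝ} (hx : 0 < x) :
    limsup (fun n : ℕ => ENNReal.ofReal ((n : ℝ) ^ (r * ρ - 1)) *
      devProb P X μ p n (x / (n : ℝ) ^ (1 - ρ))) atTop ≤
      ENNReal.ofReal ((3 * 2 ^ (p - 1)) ^ r / x ^ r) * weakMoment μ x₀ (r * p) := by
  have hp0 : 0 < p := by linarith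
  have hαp : 0 < α - p := by linarith
  have hα0 : 0 < α := by linarith
  obtain ⟨s, hs⟩ : ∃ s, s = (α - p) / α := ⟨_, rfl⟩
  have hs0 : 0 < s := by rw [hs]; positivity
  have hr1 : 1 < r := lt_trans (by rw [one_lt_div hαp]; linarith) hr
  have hsr : 1 < r * s := by
    rw [hs, ← mul_div_assoc, one_lt_div hα0]; rwa [div_lt_iff₀ hαp] at hr
  rw [← hs] at hρ
  obtain ⟨hρ1, hρ2⟩ := hρ
  have hrρ : 1 < r * ρ := hsr.trans_le (by gcongr)
  -- This δ lowers the tail order to q with qs = 1 - δ. As ε ≤ δ and ρ ≤ 1, (ρ - ε)(1 - δ) ≥ s,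
  -- which keeps the dyadic sum at most of order n^(ρ-ε).
  obtain ⟨δ, hδ⟩ : ∃ δ, δ = (ρ - s) / 2 := ⟨_, rfl⟩
  have hδ0 : 0 < δ := by linarith
  have hδ1 : δ < 1 := by linarith
  -- The second entry gives r(ρ - ε) ≥ 1, so the mean outside sum is of order at most n^(ρ-ε), and
  -- makes the normalised probability of two outside observations at most K² n^(-(rρ-1)/2).
  obtain ⟨ε, hε⟩ : ∃ ε, ε = min δ ((r * ρ - 1) / (4 * r)) := ⟨_, rfl⟩
  have hε0 : 0 < ε := by
    rw [hε]; exact lt_min hδ0 (div_pos (by linarith) (by linarith))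
  have hεδ : ε ≤ δ := by rw [hε]; exact min_le_left _ _
  have hεr : 4 * (r * ε) ≤ r * ρ - 1 := by
    have : ε ≤ (r * ρ - 1) / (4 * r) := by rw [hε]; exact min_le_right _ _
    rw [le_div_iff₀ (by linarith)] at this
    linarith
  have hρε : 0 < ρ - ε := by linarith
  obtain ⟨q, hq⟩ : ∃ q, q = (1 - δ) / s := ⟨_, rfl⟩
  have hq0 : 0 < q := by rw [hq]; exact div_pos (by linarith) hs0
  have hqs : q * s = 1 - δ := by rw [hq]; field_simp
  have hqr : q ≤ r := by
    rw [hq, div_le_iff₀ hs0]; linarith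
  obtain ⟨b, hb, hsum⟩ := sum_dyadic_tail_le.{u} hp0 hs0.le (by linarith : q * s < 1)
  obtain ⟨c₀, hc₀, hmain⟩ := exists_subExp_bound.{u, v} hp hα hβ
  have := hX.isProbabilityMeasure
  obtain ⟨κ, hκ⟩ : ∃ κ : ℝ, κ = 3 * 2 ^ (p - 1) := ⟨_, rfl⟩
  have hκ0 : 0 < κ := by rw [hκ]; positivity
  rw [← hκ, ← ENNReal.ofReal_toReal hw.ne, ← ENNReal.ofReal_mul (by positivity)]
  refine le_ofReal_of_forall_gt (g := fun K => κ ^ r / x ^ r * K) (by fun_prop) fun K hK => ?_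
  have hK0 : 0 < K := ENNReal.toReal_nonneg.trans_lt hK
  have ht : ∀ t : ℝ, 0 < t → tail μ x₀ t ≤ ENNReal.ofReal (K * t ^ (-(r * p))) := fun t ht =>
    tail_le_of_weakMoment_le ((ENNReal.le_ofReal_iff_toReal_le hw.ne hK0.le).2 hK.le) ht
  have ht' := tail_le_of_order_le (by positivity : 0 ≤ q * p) (by gcongr : q * p ≤ r * p) ht
  obtain ⟨K', hK'⟩ : ∃ K', K' = max 1 K := ⟨_, rfl⟩
  rw [← hK'] at ht'
  have hK'0 : 0 < K' := by rw [hK']; exact lt_max_of_lt_left one_pos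
  have hlt1 : (2 : ℝ) ^ (p - r * p) < 1 :=
    Real.rpow_lt_one_of_one_lt_of_neg (by norm_num) (by nlinarith)
  obtain ⟨c1, hc1e⟩ : ∃ c1, c1 = 2 ^ p * (1 - (2 : ℝ) ^ (p - r * p))⁻¹ := ⟨_, rfl⟩
  have hc1 : 0 < c1 := by
    rw [hc1e]; have : 0 < (1 - (2 : ℝ) ^ (p - r * p))⁻¹ := inv_pos.2 (by linarith)
    positivity
  obtain ⟨c2, hc2⟩ : ∃ c2, c2 = 1 + b * K' ^ s := ⟨_, rfl⟩
  have hc20 : 0 < c2 := by rw [hc2]; have : 0 < b := by linarith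
                           positivity
  -- The vanishing errors: the exponential tail of the inner part and the event of two observations
  -- outside the ball.
  obtain ⟨e, he⟩ : ∃ e : ℕ → ℝ, e = fun n : ℕ =>
    6 * ((n : ℝ) ^ (r * ρ - 1) * Real.exp (-(x / (3 * (c₀ * c2))) * (n : ℝ) ^ ε)) +
      K ^ 2 * (n : ℝ) ^ (-((r * ρ - 1) / 2)) := ⟨_, rfl⟩
  have he0 : Tendsto e atTop (𝓝 0) := by
    have h1 := (tendsto_rpow_mul_exp_neg_rpow (a := r * ρ - 1)
      (by positivity : 0 < x / (3 * (c₀ * c2))) hε0).const_mul 6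
    have h2 := ((tendsto_rpow_neg_atTop (by linarith : 0 < (r * ρ - 1) / 2)).comp
      tendsto_natCast_atTop_atTop).const_mul (K ^ 2)
    have := h1.add h2
    rw [he]
    simpa using this
  have hev : ∀ᶠ n : ℕ in atTop, (c₀ * c2 + 2 ^ (p - 1) * (c1 * K)) * (n : ℝ) ^ (-ε) ≤ x / 3 := by
    have h1 := ((tendsto_rpow_neg_atTop hε0).comp tendsto_natCast_atTop_atTop).const_mul
      (c₀ * c2 + 2 ^ (p - 1) * (c1 * K))
    rw [mul_zero] at h1
    exact (h1.eventually_lt_const (by positivity : (0 : ℝ) < x / 3)).mono fun n hn => hn.le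
  have hkey : ∀ᶠ n : ℕ in atTop, ENNReal.ofReal ((n : ℝ) ^ (r * ρ - 1)) *
      devProb P X μ p n (x / (n : ℝ) ^ (1 - ρ)) ≤ ENNReal.ofReal (κ ^ r / x ^ r * K + e n) := by
    filter_upwards [hev, eventually_ge_atTop 1] with n hn3 hn1
    have hn : n ≠ 0 := by omega
    have hn0 : (0 : ℝ) < n := by exact_mod_cast hn1
    have hn1' : (1 : ℝ) ≤ n := by exact_mod_cast hn1
    set y := x * (n : ℝ) ^ ρ with hy
    have hy0 : 0 < y := by positivity
    -- R^p = w lies a factor n^ε below the threshold scale: small enough for exponential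
    -- concentration, large enough for at most one outside observation to matter.
    set w := (n : ℝ) ^ (ρ - ε) with hw'
    have hw0 : 0 < w := by positivity
    set R := w ^ p⁻¹ with hR
    have hR0 : 0 < R := by positivity
    have hpow : ∀ a : ℝ, 0 < a → ∀ e : ℝ, (a ^ p⁻¹) ^ (e * p) = a ^ e := fun a ha e => by
      rw [← Real.rpow_mul ha.le]; congr 1; field_simp
    have hRp : R ^ p = w := by
      have := hpow w hw0 1
      rwa [one_mul, Real.rpow_one] at this
    have hwpow : ∀ e : ℝ, w ^ e = (n : ℝ) ^ ((ρ - ε) * e) := fun e => by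
      rw [hw', ← Real.rpow_mul hn0.le]
    have hn' : (n : ℝ≥0∞) = ENNReal.ofReal n := (ENNReal.ofReal_natCast n).symm
    have hB : ∀ N : ℕ, ∑ k ∈ Finset.range N, (R / 2 ^ k) ^ p *
        (n * (tail μ x₀ (R / 2 ^ (k + 1))).toReal) ^ s ≤ c2 * w := by
      intro N
      refine (hsum E μ x₀ n K' R hK'0.le hR0 ht' N).trans ?_
      have e1 : R ^ (-(q * p)) = (n : ℝ) ^ ((ρ - ε) * (-q)) := by
        rw [← hwpow, ← hpow w hw0]; congr 1; ring
      have e2 : w * (n * (K' * (n : ℝ) ^ ((ρ - ε) * (-q)))) ^ s =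
          K' ^ s * (n : ℝ) ^ (s + (ρ - ε) * δ) := by
        rw [mul_left_comm, Real.mul_rpow hK'0.le (by positivity), mul_left_comm,
          Real.mul_rpow hn0.le (by positivity), ← Real.rpow_mul hn0.le, hw', ← Real.rpow_add hn0,
          ← Real.rpow_add hn0]
        congr 2
        linear_combination -(ρ - ε) * hqs
      rw [e1, hRp, e2, hc2, add_mul, one_mul, mul_assoc]
      have e3 : (n : ℝ) ^ (s + (ρ - ε) * δ) ≤ w := by
        refine Real.rpow_le_rpow_of_exponent_le hn1' ?_
        nlinarith
      have : b * (K' ^ s * (n : ℝ) ^ (s + (ρ - ε) * δ)) ≤ b * (K' ^ s * w) := by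
        have : 0 < b := by linarith
        gcongr
      linarith
    rw [hs] at hB
    obtain ⟨T, hT, hTW⟩ := hmain E Ω P X μ S x₀ hX hS hcov n hn R hR0 (c2 * w)
      (by
        rw [hRp, hc2]
        have : 0 ≤ b * K' ^ s * w := by have : 0 < b := by linarith
                                        positivity
        linarith) hB
    have hfirst : n * ∫⁻ x in (Metric.closedBall x₀ R)ᶜ, edist x x₀ ^ p ∂μ ≤
        ENNReal.ofReal (c1 * K * w) := by
      refine (mul_le_mul_right (lintegral_compl_closedBall_le hp0.le (by nlinarith) hK0.le hR0 ht) _).trans ?_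
      rw [hn', ← ENNReal.ofReal_mul hn0.le, ← hc1e]
      refine ENNReal.ofReal_le_ofReal ?_
      have e1 : R ^ (p - r * p) = (n : ℝ) ^ ((ρ - ε) * (1 - r)) := by
        rw [← hwpow, ← hpow w hw0]; congr 1; ring
      have e2 : (n : ℝ) * (n : ℝ) ^ ((ρ - ε) * (1 - r)) ≤ w := by
        calc (n : ℝ) * (n : ℝ) ^ ((ρ - ε) * (1 - r)) = (n : ℝ) ^ (1 + (ρ - ε) * (1 - r)) := by
              rw [Real.rpow_add hn0, Real.rpow_one]
          _ ≤ w := by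
              refine Real.rpow_le_rpow_of_exponent_le hn1' ?_
              nlinarith
      calc n * (c1 * (K * R ^ (p - r * p))) = c1 * K * (n * (n : ℝ) ^ ((ρ - ε) * (1 - r))) := by
            rw [e1]; ring
        _ ≤ _ := by gcongr
    have hwy : w = (n : ℝ) ^ (-ε) * (n : ℝ) ^ ρ := by
      rw [← Real.rpow_add hn0, hw']; congr 1; ring
    have hsmall : c₀ * (c2 * w) + 2 ^ (p - 1) * (c1 * K * w) ≤ y / 3 := by
      have := mul_le_mul_of_nonneg_right hn3 (by positivity : 0 ≤ (n : ℝ) ^ ρ)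
      rw [mul_assoc, ← hwy] at this
      rw [hy]; linarith
    have hZb := hX.measure_sum_indicator_gt_le_of_jumps x₀ R hp0 (by positivity : 0 < y / κ) n
    have hjump : n * tail μ x₀ ((y / κ) ^ p⁻¹) ≤ ENNReal.ofReal (n * K * (κ / y) ^ r) := by
      refine (mul_le_mul_right (ht _ (by positivity)) _).trans ?_
      rw [hn', ← ENNReal.ofReal_mul hn0.le]
      refine ENNReal.ofReal_le_ofReal (le_of_eq ?_)
      have e1 : ((y / κ) ^ p⁻¹) ^ (-(r * p)) = (κ / y) ^ r := by
        rw [← neg_mul, hpow _ (by positivity), Real.rpow_neg (by positivity),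
          ← Real.inv_rpow (by positivity), inv_div]
      rw [e1, mul_assoc]
    have hpair : (n * tail μ x₀ R) ^ 2 ≤ ENNReal.ofReal ((n * K * (n : ℝ) ^ ((ρ - ε) * (-r))) ^ 2) := by
      rw [ENNReal.ofReal_pow (by positivity)]
      gcongr
      refine (mul_le_mul_right (ht _ hR0) _).trans ?_
      rw [hn', ← ENNReal.ofReal_mul hn0.le]
      refine ENNReal.ofReal_le_ofReal (le_of_eq ?_)
      rw [← hwpow, ← hpow w hw0, mul_assoc, neg_mul]
    rw [devProb_eq P X μ p hn]
    have hsub := measure_gt_le_of_ae_le (by positivity) (by positivity) hy0 hfirst hsmall hTW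
    rw [← hκ] at hsub
    refine (mul_le_mul_right (hsub.trans
      (add_le_add (hT.measure_gt_le _) (hZb.trans (add_le_add hjump hpair)))) _).trans ?_
    rw [← ENNReal.ofReal_add (by positivity) (by positivity),
      ← ENNReal.ofReal_add (by positivity) (by positivity), ← ENNReal.ofReal_mul (by positivity)]
    refine ENNReal.ofReal_le_ofReal ?_
    have f1 : y / 3 / (c₀ * (c2 * w)) = x / (3 * (c₀ * c2)) * (n : ℝ) ^ ε := by
      have : (n : ℝ) ^ ρ = w * (n : ℝ) ^ ε := by
        rw [hw', ← Real.rpow_add hn0]; congr 1; ring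
      rw [hy, this]; field_simp
    have f2 : (n : ℝ) ^ (r * ρ - 1) * (n * K * (κ / y) ^ r) = κ ^ r / x ^ r * K := by
      rw [hy, Real.div_rpow hκ0.le (by positivity), Real.mul_rpow hx.le (by positivity),
        ← Real.rpow_mul hn0.le, Real.rpow_sub_one hn0.ne', mul_comm ρ r]
      field_simp
    have f3 : (n : ℝ) ^ (r * ρ - 1) * (n * K * (n : ℝ) ^ ((ρ - ε) * (-r))) ^ 2 ≤
        K ^ 2 * (n : ℝ) ^ (-((r * ρ - 1) / 2)) := by
      have g1 : (n : ℝ) ^ (r * ρ - 1) * (n * K * (n : ℝ) ^ ((ρ - ε) * (-r))) ^ 2 =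
          K ^ 2 * (n : ℝ) ^ (r * ρ - 1 + (2 + (ρ - ε) * (-r) * 2)) := by
        rw [Real.rpow_add hn0, Real.rpow_add hn0, Real.rpow_mul hn0.le _ 2, Real.rpow_two, Real.rpow_two]
        ring
      rw [g1]
      exact mul_le_mul_of_nonneg_left
        (Real.rpow_le_rpow_of_exponent_le hn1' (by nlinarith)) (by positivity)
    rw [f1, mul_add, mul_add, f2, he]
    have f4 : -(x / (3 * (c₀ * c2)) * (n : ℝ) ^ ε) = -(x / (3 * (c₀ * c2))) * (n : ℝ) ^ ε := by ring
    rw [f4]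
    linarith
  refine (limsup_le_limsup hkey).trans ?_
  have hlim : Tendsto (fun n => ENNReal.ofReal (κ ^ r / x ^ r * K + e n)) atTop
      (𝓝 (ENNReal.ofReal (κ ^ r / x ^ r * K))) := by
    have := (ENNReal.continuous_ofReal.tendsto _).comp (he0.const_add (κ ^ r / x ^ r * K))
    rwa [add_zero] at this
  exact hlim.limsup_eq.le

end Asymptotic

/-- Square the pointwise bound √H(t) (t/2)^p ≤ I_(2p,p). The integral case is thereby reduced to the
weak moment of order 2p. -/
lemma weakMoment_le_sqrtMomentIntegral_sq {E : Type*} [MetricSpace E] [MeasurableSpace E]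
    (μ : Measure E) (x₀ : E) {p : ℝ} (hp : 1 ≤ p) :
    weakMoment μ x₀ (2 * p) ≤ ENNReal.ofReal (4 ^ p) * sqrtMomentIntegral μ x₀ p ^ 2 := by
  refine iSup_le fun t => ?_
  rcases (zero_le : 0 ≤ t).eq_or_lt with h0 | h0
  · rw [← h0, ENNReal.coe_zero, ENNReal.zero_rpow_of_pos (by linarith), zero_mul]
    exact bot_le
  have ht : (0 : ℝ) < t := h0
  have h1 := tail_rpow_mul_le_tailIntegral (μ := μ) (x₀ := x₀) (s := 1 / 2) hp (by norm_num) ht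
  have h2 : ((tail μ x₀ t) ^ (1 / 2 : ℝ)) ^ 2 = tail μ x₀ t := by
    rw [← ENNReal.rpow_natCast, ← ENNReal.rpow_mul]; simp
  have h3 : (t : ℝ≥0∞) ^ (2 * p) = ENNReal.ofReal (4 ^ p) * ENNReal.ofReal ((t / 2) ^ p) ^ 2 := by
    rw [← ENNReal.ofReal_coe_nnreal, ENNReal.ofReal_rpow_of_pos ht, ← ENNReal.ofReal_pow (by positivity),
      ← ENNReal.ofReal_mul (by positivity)]
    congr 1
    have e : ((t / 2 : ℝ) ^ p) ^ 2 = ((t / 2 : ℝ) ^ 2) ^ p := by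
      rw [← Real.rpow_two, ← Real.rpow_two, ← Real.rpow_mul (by positivity),
        ← Real.rpow_mul (by positivity), mul_comm]
    rw [e, ← Real.mul_rpow (by norm_num) (by positivity), Real.rpow_mul ht.le, Real.rpow_two]
    congr 1
    ring
  calc (t : ℝ≥0∞) ^ (2 * p) * tail μ x₀ t
      = ENNReal.ofReal (4 ^ p) *
        (tail μ x₀ t ^ (1 / 2 : ℝ) * ENNReal.ofReal ((t / 2) ^ p)) ^ 2 := by
        rw [h3, mul_pow, h2]; ring
    _ ≤ _ := by
        gcongr
        exact h1

end WassersteinEmpirical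

/-! ### Assembly of the six statements -/

theorem mainTheorem8 (p : ℝ) (hp : 1 ≤ p) :
    (∀ r : ℝ, 2 < r → ∃ C : ℝ, 0 < C ∧ ∀ α β : ℝ, 2 * p < α → 0 < β →
      ∀ (E : Type u) [MetricSpace E] [PolishSpace E] [MeasurableSpace E] [BorelSpace E]
        (Ω : Type v) [MeasurableSpace Ω] (P : Measure Ω) [IsProbabilityMeasure P]
        (X : ℕ → Ω → E) (μ : Measure E) (S : Set E) (x₀ : E),
        WassersteinEmpirical.IsIIDSample X μ P → (∀ᵐ z ∂μ, z ∈ S) →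
        WassersteinEmpirical.HasCoveringDim S x₀ α β →
        WassersteinEmpirical.weakMoment μ x₀ (r * p) < ∞ →
        ∀ ρ ∈ Ioc ((α - p) / α) 1, ∀ x : ℝ, 0 < x →
          limsup (fun n : ℕ => ENNReal.ofReal ((n : ℝ) ^ (r * ρ - 1)) *
            WassersteinEmpirical.devProb P X μ p n (x / (n : ℝ) ^ (1 - ρ))) atTop ≤
            ENNReal.ofReal (C / x ^ r) * WassersteinEmpirical.weakMoment μ x₀ (r * p)) ∧
    (∃ C : ℝ, 0 < C ∧ ∀ α β : ℝ, 2 * p < α → 0 < β →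
      ∀ (E : Type u) [MetricSpace E] [PolishSpace E] [MeasurableSpace E] [BorelSpace E]
        (Ω : Type v) [MeasurableSpace Ω] (P : Measure Ω) [IsProbabilityMeasure P]
        (X : ℕ → Ω → E) (μ : Measure E) (S : Set E) (x₀ : E),
        WassersteinEmpirical.IsIIDSample X μ P → (∀ᵐ z ∂μ, z ∈ S) →
        WassersteinEmpirical.HasCoveringDim S x₀ α β →
        WassersteinEmpirical.sqrtMomentIntegral μ x₀ p < ∞ →
        ∀ ρ ∈ Ioc ((α - p) / α) 1, ∀ x : ℝ, 0 < x →
          limsup (fun n : ℕ => ENNReal.ofReal ((n : ℝ) ^ (2 * ρ - 1)) *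
            WassersteinEmpirical.devProb P X μ p n (x / (n : ℝ) ^ (1 - ρ))) atTop ≤
            ENNReal.ofReal (C / x ^ 2) * WassersteinEmpirical.sqrtMomentIntegral μ x₀ p ^ 2) ∧
    (∀ r : ℝ, r < 2 → ∃ C : ℝ, 0 < C ∧ ∀ α β : ℝ, 2 * p < α → 0 < β → α / (α - p) < r →
      ∀ (E : Type u) [MetricSpace E] [PolishSpace E] [MeasurableSpace E] [BorelSpace E]
        (Ω : Type v) [MeasurableSpace Ω] (P : Measure Ω) [IsProbabilityMeasure P]
        (X : ℕ → Ω → E) (μ : Measure E) (S : Set E) (x₀ : E),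
        WassersteinEmpirical.IsIIDSample X μ P → (∀ᵐ z ∂μ, z ∈ S) →
        WassersteinEmpirical.HasCoveringDim S x₀ α β →
        WassersteinEmpirical.weakMoment μ x₀ (r * p) < ∞ →
        ∀ ρ ∈ Ioc ((α - p) / α) 1, ∀ x : ℝ, 0 < x →
          limsup (fun n : ℕ => ENNReal.ofReal ((n : ℝ) ^ (r * ρ - 1)) *
            WassersteinEmpirical.devProb P X μ p n (x / (n : ℝ) ^ (1 - ρ))) atTop ≤
            ENNReal.ofReal (C / x ^ r) * WassersteinEmpirical.weakMoment μ x₀ (r * p)) ∧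
    (∀ α β : ℝ, 2 * p < α → 0 < β → ∃ C : ℝ, 0 < C ∧
      ∀ (E : Type u) [MetricSpace E] [PolishSpace E] [MeasurableSpace E] [BorelSpace E]
        (Ω : Type v) [MeasurableSpace Ω] (P : Measure Ω) [IsProbabilityMeasure P]
        (X : ℕ → Ω → E) (μ : Measure E) (S : Set E) (x₀ : E),
        WassersteinEmpirical.IsIIDSample X μ P → (∀ᵐ z ∂μ, z ∈ S) →
        WassersteinEmpirical.HasCoveringDim S x₀ α β →
        WassersteinEmpirical.momentIntegral μ x₀ α p < ∞ →
        ∀ ρ ∈ Icc ((α - p) / α) 1, ∀ x : ℝ, 0 < x → ∀ n : ℕ, 1 ≤ n →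
          ENNReal.ofReal ((n : ℝ) ^ (α / (α - p) * ρ - 1)) *
            WassersteinEmpirical.devProb P X μ p n (x / (n : ℝ) ^ (1 - ρ)) ≤
            ENNReal.ofReal (C / x ^ (α / (α - p))) *
              WassersteinEmpirical.momentIntegral μ x₀ α p ^ (α / (α - p))) ∧
    (∀ α β r : ℝ, 2 * p < α → 0 < β → 1 < r → r < α / (α - p) → ∃ C : ℝ, 0 < C ∧
      ∀ (E : Type u) [MetricSpace E] [PolishSpace E] [MeasurableSpace E] [BorelSpace E]
        (Ω : Type v) [MeasurableSpace Ω] (P : Measure Ω) [IsProbabilityMeasure P]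
        (X : ℕ → Ω → E) (μ : Measure E) (S : Set E) (x₀ : E),
        WassersteinEmpirical.IsIIDSample X μ P → (∀ᵐ z ∂μ, z ∈ S) →
        WassersteinEmpirical.HasCoveringDim S x₀ α β →
        WassersteinEmpirical.weakMoment μ x₀ (r * p) < ∞ →
        ∀ ρ ∈ Icc (1 / r) 1, ∀ x : ℝ, 0 < x → ∀ n : ℕ, 1 ≤ n →
          ENNReal.ofReal ((n : ℝ) ^ (r * ρ - 1)) *
            WassersteinEmpirical.devProb P X μ p n (x / (n : ℝ) ^ (1 - ρ)) ≤
            ENNReal.ofReal (C / x ^ r) * WassersteinEmpirical.weakMoment μ x₀ (r * p)) ∧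
    (∀ α β r : ℝ, 2 * p < α → 0 < β → 1 < r → r ≠ 2 → r ≠ α / (α - p) → ∃ C : ℝ, 0 < C ∧
      ∀ (E : Type u) [MetricSpace E] [PolishSpace E] [MeasurableSpace E] [BorelSpace E]
        (Ω : Type v) [MeasurableSpace Ω] (P : Measure Ω) [IsProbabilityMeasure P]
        (X : ℕ → Ω → E) (μ : Measure E) (S : Set E) (x₀ : E),
        WassersteinEmpirical.IsIIDSample X μ P → (∀ᵐ z ∂μ, z ∈ S) →
        WassersteinEmpirical.HasCoveringDim S x₀ α β →
        WassersteinEmpirical.weakMoment μ x₀ (r * p) < ∞ →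
        ∀ x : ℝ, 0 < x →
          limsup (fun n : ℕ => ENNReal.ofReal ((n : ℝ) ^ (r - 1)) *
            WassersteinEmpirical.devProb P X μ p n x) atTop ≤
            ENNReal.ofReal (C / x ^ r) * WassersteinEmpirical.weakMoment μ x₀ (r * p)) := by

  have hαs : ∀ {α : ℝ}, 2 * p < α → (α - p) / α < 1 := fun {α} hα =>
    (div_lt_one (by linarith)).2 (by linarith)
  have hr0 : ∀ {α : ℝ}, 2 * p < α → α / (α - p) < 2 := fun {α} hα =>
    (div_lt_iff₀ (by linarith)).2 (by linarith)
  -- The base 3 · 2^(p-1) combines the split of the threshold in thirds with the convexity factor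
  -- 2^(p-1) on the outside sum; α and β do not enter.
  refine ⟨fun r hr => ⟨(3 * 2 ^ (p - 1)) ^ r, by positivity, ?_⟩,
    ⟨(3 * 2 ^ (p - 1)) ^ (2 : ℝ) * 4 ^ p, by positivity, ?_⟩,
    fun r hr => ⟨(3 * 2 ^ (p - 1)) ^ r, by positivity, ?_⟩, ?_, ?_, ?_⟩
  · intro α β hα hβ E _ _ _ _ Ω _ P _ X μ S x₀ hX hS hcov hw ρ hρ x hx
    exact WassersteinEmpirical.limsup_devProb_le hp hα hβ ((hr0 hα).trans hr) E Ω P X μ S x₀ hX hS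
      hcov hw hρ hx
  · intro α β hα hβ E _ _ _ _ Ω _ P _ X μ S x₀ hX hS hcov hI ρ hρ x hx
    have hle := WassersteinEmpirical.weakMoment_le_sqrtMomentIntegral_sq μ x₀ hp
    have hw : WassersteinEmpirical.weakMoment μ x₀ (2 * p) < ∞ :=
      hle.trans_lt (ENNReal.mul_lt_top ENNReal.ofReal_lt_top (ENNReal.pow_lt_top hI))
    refine (WassersteinEmpirical.limsup_devProb_le hp hα hβ (hr0 hα) E Ω P X μ S x₀ hX hS
      hcov hw hρ hx).trans ?_
    refine (mul_le_mul_right hle _).trans (le_of_eq ?_)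
    rw [← mul_assoc, ← ENNReal.ofReal_mul (by positivity)]
    congr 2
    rw [Real.rpow_two x]
    ring
  · intro α β hα hβ hr' E _ _ _ _ Ω _ P _ X μ S x₀ hX hS hcov hw ρ hρ x hx
    exact WassersteinEmpirical.limsup_devProb_le hp hα hβ hr' E Ω P X μ S x₀ hX hS
      hcov hw hρ hx
  · intro α β hα hβ
    obtain ⟨C, hC, h⟩ := WassersteinEmpirical.exists_momentIntegral_bound hp hα hβ
    exact ⟨C, hC, fun E _ _ _ _ Ω _ P _ X μ S x₀ hX hS hcov hI ρ _ x hx n hn =>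
      h E Ω P X μ S x₀ hX hS hcov hI ρ x hx n hn⟩
  · intro α β r hα hβ hr1 hr2
    obtain ⟨C, hC, h⟩ := WassersteinEmpirical.exists_weakMoment_bound hp hα hβ hr1 hr2
    exact ⟨C, hC, fun E _ _ _ _ Ω _ P _ X μ S x₀ hX hS hcov hw ρ _ x hx n hn =>
      h E Ω P X μ S x₀ hX hS hcov hw ρ x hx n hn⟩
  · intro α β r hα hβ hr1 _ hrα
    -- At ρ = 1: below the critical exponent the bound for every n passes to the limsup; above it
    -- the single-observation asymptotics apply.
    rcases lt_or_gt_of_ne hrα with hlt | hgt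
    · obtain ⟨C, hC, h⟩ := WassersteinEmpirical.exists_weakMoment_bound hp hα hβ hr1 hlt
      refine ⟨C, hC, fun E _ _ _ _ Ω _ P _ X μ S x₀ hX hS hcov hw x hx => ?_⟩
      refine limsup_le_of_le (by isBoundedDefault) ?_
      filter_upwards [eventually_ge_atTop 1] with n hn
      simpa using h E Ω P X μ S x₀ hX hS hcov hw 1 x hx n hn
    · refine ⟨(3 * 2 ^ (p - 1)) ^ r, by positivity,
        fun E _ _ _ _ Ω _ P _ X μ S x₀ hX hS hcov hw x hx => ?_⟩
      simpa using WassersteinEmpirical.limsup_devProb_le hp hα hβ hgt E Ω P X μ S x₀ hX hS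
        hcov hw ⟨hαs hα, le_rfl⟩ hx
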